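/- \textbf{Conventions.} All Lie groups and subgroups are connected. Let $G$ be a connected (real, finite-dimensional, Hausdorff) Lie group with Lie algebra $\mathfrak g$. A connected compact subgroup $H\subset G$ is called \emph{admissible} if the homogeneous manifold $G/H$ admits a $G$-invariant Lorentzian metric (signature $(1,n-1)$, $n=\dim G/H\ge 1$). It is \emph{maximal admissible}, and $G/H$ is a \emph{minimal admissible manifold}, if $H$ is admissible and is not properly contained in any other admissible connected compact subgroup of $G$. A \emph{maximal compact subgroup} is a connected compact subgroup not properly contained in any other connected compact subgroup. A \emph{reductive decomposition} of $G/H$ is a direct sum decomposition $\mathfrak g=\mathfrak h+\mathfrak m$, $\mathfrak h=\mathrm{Lie}(H)$, with $\mathrm{Ad}_H\mathfrak m\subset\mathfrak m$. \textbf{Theorem.} Let $G=G_1\times G_2$ be a product of two connected Lie groups with Lie algebras $\mathfrak g_1,\mathfrak g_2$, let $M=G/H$ be a minimal admissible manifold, and let $\mathfrak h=\mathrm{Lie}(H)\subset\mathfrak g=\mathfrak g_1+\mathfrak g_2$. (1) If $H=H_1\times H_2$ with subgroups $H_i\subset G_i$, then one of $H_1,H_2$ is maximal admissible in its group $G_i$,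 and the other one is a maximal compact subgroup of its group. (2) If $H$ is not of the form $H_1\times H_2$ with subgroups $H_i\subset G_i$, put $\mathfrak h_i=\mathfrak h\cap\mathfrak g_i$. Then there are maximal compact subgroups $K_i\subset G_i$, with Lie algebras $\mathfrak k_i$, and elements $t_i\in\mathfrak g_i\setminus\mathfrak h_i$ $(i=1,2)$ such that $$\mathfrak h=\mathfrak h_1+\mathfrak h_2+\mathbb R(t_1+t_2),\qquad \mathfrak h_i+\mathbb R t_i=Z_{\mathfrak k_i}(t_i)\quad (i=1,2),$$ where $Z_{\mathfrak k_i}(t_i)=\{X\in\mathfrak k_i : [X,t_i]=0\}$. Moreover $Z_{\mathfrak k_i}(t_i)$ has an $\mathrm{ad}_{\mathfrak h}$-invariant complement in $\mathfrak g_i$, $i=1,2$, and for any such complements $\mathfrak m_1,\mathfrak m_2$ $$\mathfrak g=\mathfrak h+\mathfrak m,\qquad \mathfrak m=\mathfrak m_1+\mathfrak m_2+\mathbb R(t_1-t_2),$$ is a reductive decomposition of $M=G/H$. -/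

import Mathlib

open scoped Manifold ContDiff

noncomputable section

namespace HomLorentz

section General

variable {E : Type*} [NormedAddCommGroup E] [NormedSpace ℝ E]
  {HM : Type*} [TopologicalSpace HM] (I : ModelWithCorners ℝ E HM)
  {G : Type*} [TopologicalSpace G] [ChartedSpace HM G] [Group G]

/-- A smooth real Lie group has the regularity under which Mathlib puts the Lie algebra structure
on the tangent space `GroupLieAlgebra I G` at the identity. -/
instance instLieGroupMinSmoothness [LieGroup I ∞ G] : LieGroup I (minSmoothness ℝ 3) G := by
  rw [minSmoothness_of_isRCLikeNormedField]
  infer_instance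

/-- `IsExpCurve I X γ`: the curve `γ` is `t ↦ exp (t X)`, that is, the integral curve through the
identity of the left-invariant vector field defined by `X`. -/
def IsExpCurve (X : GroupLieAlgebra I G) (γ : ℝ → G) : Prop :=
  γ 0 = 1 ∧ IsMIntegralCurve (I := I) γ (mulInvariantVectorField (I := I) X)

/-- The Lie algebra `{X | exp (t X) ∈ H for all t}` of a closed subgroup `H` of a Lie group, as a
subspace of the Lie algebra of the group. (For closed `H` the displayed set is a linear subspace,
so that the span adds nothing to it; it only provides the bundled type.) -/
def lieAlg (H : Subgroup G) : Submodule ℝ (GroupLieAlgebra I G) :=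
  Submodule.span ℝ {X | ∃ γ : ℝ → G, IsExpCurve I X γ ∧ ∀ t, γ t ∈ H}

/-- The adjoint representation: `Ad a` is the differential at the identity of `x ↦ a x a⁻¹`. -/
def Ad (a : G) : GroupLieAlgebra I G →L[ℝ] GroupLieAlgebra I G :=
  mfderiv I I (fun x : G => a * x * a⁻¹) 1

/-- The centralizer `{X ∈ 𝔨 | [t, X] = 0}` of `t` in a subspace `𝔨` of the Lie algebra. -/
def centralizerIn [CompleteSpace E] [LieGroup I ∞ G]
    (𝔨 : Submodule ℝ (GroupLieAlgebra I G)) (t : GroupLieAlgebra I G) :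
    Submodule ℝ (GroupLieAlgebra I G) :=
  𝔨 ⊓ LinearMap.ker (LieAlgebra.ad ℝ (GroupLieAlgebra I G) t)

/-- The tangent space at `a` of the coset `a H`, i.e. the kernel of the differential at `a` of the
projection `G → G/H`. -/
def vertical (H : Subgroup G) (a : G) : Submodule ℝ (TangentSpace I a) :=
  Submodule.span ℝ {u | ∃ X ∈ lieAlg I H, u = mulInvariantVectorField (I := I) X a}

/-- Lorentzian metrics `g` on the homogeneous manifold `G/H`, given by their pull-back
`β = π^* g` along the projection `π : G → G/H`. With `T_{aH}(G/H) = T_a G / T_a (a H)`, the smooth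
symmetric bilinear tensor fields on `G/H` are exactly the smooth symmetric bilinear tensor fields
on `G` which are preserved by the right translations by elements of `H` and vanish on the vertical
vectors; smoothness is tested on the frame of left-invariant vector fields. The last field says
that the induced form on `T_a G / T_a (a H)` is nondegenerate with exactly one negative square. -/
structure IsLorentzMetric (H : Subgroup G)
    (β : ∀ a : G, TangentSpace I a →L[ℝ] TangentSpace I a →L[ℝ] ℝ) : Prop where
  symm : ∀ (a : G) (u v : TangentSpace I a), β a u v = β a v u
  smooth : ∀ X Y : GroupLieAlgebra I G, ContMDiff I 𝓘(ℝ, ℝ) ∞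
    (fun a : G => β a (mulInvariantVectorField (I := I) X a) (mulInvariantVectorField (I := I) Y a))
  right_translation : ∀ (a : G), ∀ h ∈ H, ∀ u v : TangentSpace I a,
    β (a * h) (mfderiv I I (fun x : G => x * h) a u) (mfderiv I I (fun x : G => x * h) a v)
      = β a u v
  vertical_eq_zero : ∀ (a : G), ∀ u ∈ vertical I H a, ∀ v, β a u v = 0
  index_one : ∀ a : G, ∃ v : TangentSpace I a, β a v v < 0 ∧
    ∀ w : TangentSpace I a, β a v w = 0 → w ∉ vertical I H a → 0 < β a w w

/-- Invariance, under the left action of `G` on `G/H`, of a tensor field on `G/H` (given by its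
pull-back to `G`). -/
def IsInvariant (β : ∀ a : G, TangentSpace I a →L[ℝ] TangentSpace I a →L[ℝ] ℝ) : Prop :=
  ∀ (b a : G) (u v : TangentSpace I a),
    β (b * a) (mfderiv I I (fun x : G => b * x) a u) (mfderiv I I (fun x : G => b * x) a v)
      = β a u v

/-- Connected compact subgroups. -/
def IsConnectedCompact (H : Subgroup G) : Prop :=
  IsCompact (H : Set G) ∧ IsConnected (H : Set G)

/-- Maximal compact subgroups (all subgroups being connected, by convention). -/
def IsMaximalCompact (K : Subgroup G) : Prop :=
  IsConnectedCompact K ∧ ∀ K' : Subgroup G, IsConnectedCompact K' → K ≤ K' → K' = K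

/-- A connected subgroup `H` of `G` is admissible if `G/H` is proper, i.e. `H` is compact, and
admits an invariant Lorentzian metric. -/
def IsAdmissible (H : Subgroup G) : Prop :=
  IsConnectedCompact H ∧ ∃ β : ∀ a : G, TangentSpace I a →L[ℝ] TangentSpace I a →L[ℝ] ℝ,
    IsLorentzMetric I H β ∧ IsInvariant I β

/-- `H` is maximal admissible (equivalently, `G/H` is a minimal admissible manifold). -/
def IsMaximalAdmissible (H : Subgroup G) : Prop :=
  IsAdmissible I H ∧ ∀ H' : Subgroup G, IsAdmissible I H' → H ≤ H' → H' = H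

/-- `𝔤 = 𝔥 ⊕ 𝔪` is a reductive decomposition for `G/H`. -/
def IsReductiveDecomposition (H : Subgroup G) (𝔪 : Submodule ℝ (GroupLieAlgebra I G)) : Prop :=
  IsCompl (lieAlg I H) 𝔪 ∧ ∀ a ∈ H, ∀ Y ∈ 𝔪, Ad I a Y ∈ 𝔪

end General

section Product

variable {E₁ : Type*} [NormedAddCommGroup E₁] [NormedSpace ℝ E₁]
  {E₂ : Type*} [NormedAddCommGroup E₂] [NormedSpace ℝ E₂]
  {HM₁ : Type*} [TopologicalSpace HM₁] (I₁ : ModelWithCorners ℝ E₁ HM₁)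
  {HM₂ : Type*} [TopologicalSpace HM₂] (I₂ : ModelWithCorners ℝ E₂ HM₂)
  (G₁ : Type*) [TopologicalSpace G₁] [ChartedSpace HM₁ G₁] [Group G₁]
  (G₂ : Type*) [TopologicalSpace G₂] [ChartedSpace HM₂ G₂] [Group G₂]

/-- The inclusion of `𝔤₁` in the Lie algebra `𝔤` of `G₁ × G₂`: the differential of `x ↦ (x, 1)`. -/
def incl₁ : GroupLieAlgebra I₁ G₁ →L[ℝ] GroupLieAlgebra (I₁.prod I₂) (G₁ × G₂) :=
  mfderiv I₁ (I₁.prod I₂) (fun x : G₁ => (x, (1 : G₂))) 1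

/-- The inclusion of `𝔤₂` in the Lie algebra `𝔤` of `G₁ × G₂`: the differential of `y ↦ (1, y)`. -/
def incl₂ : GroupLieAlgebra I₂ G₂ →L[ℝ] GroupLieAlgebra (I₁.prod I₂) (G₁ × G₂) :=
  mfderiv I₂ (I₁.prod I₂) (fun y : G₂ => ((1 : G₁), y)) 1

end Product

/-- `IsAdInvariantComplement ι 𝔥 𝔠 𝔫`, for the inclusion `ι : 𝔤' → 𝔤` of a factor: `𝔫` is a
complement of `𝔠` in `𝔤'` which is preserved by `ad X` for all `X ∈ 𝔥 ⊆ 𝔤`. -/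
def IsAdInvariantComplement {V W : Type*} [AddCommGroup V] [Module ℝ V] [AddCommGroup W]
    [Module ℝ W] [Bracket W W] (ι : V →ₗ[ℝ] W) (𝔥 : Submodule ℝ W) (𝔠 𝔫 : Submodule ℝ V) : Prop :=
  IsCompl 𝔠 𝔫 ∧ ∀ X ∈ 𝔥, ∀ Y ∈ 𝔫, ⁅X, ι Y⁆ ∈ 𝔫.map ι

end HomLorentz

end

open HomLorentz

set_option linter.unusedSectionVars false
set_option linter.style.haveILetI false

/-! Admissibility is a linear condition. A connected compact `H` is admissible exactly when some `Ad
H`-fixed vector lies outside `𝔥`. Given an invariant Lorentzian form on `𝔤/𝔥` and a timelike `v`,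
the pairing of `v` with its `H`-orbit never vanishes, so it stays negative by connectedness, and the
Haar average of the orbit is fixed and not in `𝔥` (`exists_fixed_of_isAdmissible`). Conversely, an
invariant inner product with the sign reversed along a fixed direction transverse to `𝔥` is
Lorentzian modulo `𝔥` (`isAdmissible_of_fixed`).

If `H = H₁ × H₂`, a fixed vector outside `𝔥₁ + 𝔥₂` has a component outside some `𝔥ᵢ`, and this
component is already fixed by `Hᵢ`. So `Hᵢ` is admissible and the other factor can be any connected
compact group; maximality of `H` then gives both claims (`maximalAdmissible_prod`).

If `H` is not a product, let `Kᵢ` be maximal compact subgroups containing the projections `Pᵢ` of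
`H`, and let `u = (u₁, u₂)` be a fixed vector orthogonal to `𝔥` for an inner product `B₁ + B₂`
invariant under `K₁ × K₂`. Each `uᵢ` is fixed by `Pᵢ`, and `u` lies in the Lie algebra of `P₁ × P₂`,
for otherwise `P₁ × P₂` would be admissible and hence equal to `H`. Let `Q` be the product of the
identity components of the stabilizers of `uᵢ` in `Kᵢ`. It contains `H`, and `u` is a fixed vector
of its Lie algebra `𝔮`. The point is that `𝔥` is the whole hyperplane orthogonal to `u` in `𝔮`
(`exists_isHyperplaneData`).

That hyperplane need not a priori be the Lie algebra of a closed subgroup. Instead one finds a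
character of `Q` that is trivial on `H` and nontrivial on `exp (ℝ u)`; the identity component of its
kernel contains `H`, misses `u` and has codimension at most one (`exists_codim_one_subgroup`), so by
maximality it is `H`. Characters come from a Peter–Weyl argument on `L²`: a nontrivial central
one-parameter subgroup of a compact group is detected by the determinant of a finite-dimensional
subrepresentation (`exists_character_ne_one`).

Once `𝔥` is cut out of `𝔷₁ + 𝔷₂` by the equation `B₁(u₁, x) + B₂(u₂, y) = 0`, where `𝔷ᵢ` is the
centralizer of `uᵢ` in `𝔨ᵢ`, the rest is linear algebra with `tᵢ` suitable multiples of `uᵢ`. The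
Lie theory needed underneath is the exponential map, the product formula, Cartan's closed subgroup
theorem and the derivative of `Ad`. -/

noncomputable section

namespace HomLorentz

/-! ### The group law in a chart at the identity -/

section Chart
open Set Filter Topology

variable {E : Type*} [NormedAddCommGroup E] [NormedSpace ℝ E]
  {HM : Type*} [TopologicalSpace HM] (I : ModelWithCorners ℝ E HM)
  (G : Type*) [TopologicalSpace G] [ChartedSpace HM G] [Group G]

/-- The coordinates of the identity in the preferred chart at the identity. -/
def chartOne : E := extChartAt I (1 : G) 1

/-- The group multiplication in the preferred chart at the identity. -/
def locMul (z : E × E) : E :=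
  extChartAt I (1 : G) ((extChartAt I (1 : G)).symm z.1 * (extChartAt I (1 : G)).symm z.2)

/-- The partial derivative of the multiplication in the second variable at the identity. -/
def leftField (p : E) : E →L[ℝ] E :=
  (fderiv ℝ (locMul I G) (p, chartOne I G)).comp (ContinuousLinearMap.inr ℝ E E)

/-- The partial derivative of the multiplication in the first variable at the identity. -/
def rightField (p : E) : E →L[ℝ] E :=
  (fderiv ℝ (locMul I G) (chartOne I G, p)).comp (ContinuousLinearMap.inl ℝ E E)

variable {G}

lemma extChartAt_symm_chartOne : (extChartAt I (1 : G)).symm (chartOne I G) = 1 :=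
  extChartAt_to_inv (I := I) (1 : G)

variable (G)

lemma target_mem_nhds_chartOne [I.Boundaryless] :
    (extChartAt I (1 : G)).target ∈ 𝓝 (chartOne I G) :=
  extChartAt_target_mem_nhds (I := I) (1 : G)

lemma locMul_right_one [I.Boundaryless] {p : E} (hp : p ∈ (extChartAt I (1 : G)).target) :
    locMul I G (p, chartOne I G) = p := by
  simp only [locMul, extChartAt_symm_chartOne, mul_one]
  exact (extChartAt I (1 : G)).right_inv hp

lemma locMul_left_one [I.Boundaryless] {p : E} (hp : p ∈ (extChartAt I (1 : G)).target) :
    locMul I G (chartOne I G, p) = p := by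
  simp only [locMul, extChartAt_symm_chartOne, one_mul]
  exact (extChartAt I (1 : G)).right_inv hp

variable [LieGroup I ∞ G]

lemma contDiffAt_locMul [I.Boundaryless] :
    ContDiffAt ℝ ∞ (locMul I G) (chartOne I G, chartOne I G) := by
  have hs : ContMDiffAt 𝓘(ℝ, E) I ∞ (extChartAt I (1 : G)).symm (chartOne I G) :=
    (contMDiffOn_extChartAt_symm (I := I) (n := ∞) (1 : G)).contMDiffAt
      (target_mem_nhds_chartOne I G)
  rw [← contMDiffAt_iff_contDiffAt]
  have h1 : ContMDiffAt 𝓘(ℝ, E × E) I ∞ (fun z : E × E => (extChartAt I (1 : G)).symm z.1)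
      (chartOne I G, chartOne I G) :=
    ContMDiffAt.comp (g := (extChartAt I (1 : G)).symm) (f := fun z : E × E => z.1)
      (chartOne I G, chartOne I G) hs contDiff_fst.contMDiff.contMDiffAt
  have h2 : ContMDiffAt 𝓘(ℝ, E × E) I ∞ (fun z : E × E => (extChartAt I (1 : G)).symm z.2)
      (chartOne I G, chartOne I G) :=
    ContMDiffAt.comp (g := (extChartAt I (1 : G)).symm) (f := fun z : E × E => z.2)
      (chartOne I G, chartOne I G) hs contDiff_snd.contMDiff.contMDiffAt
  have h3 := h1.mul h2
  have h4 : ContMDiffAt I 𝓘(ℝ, E) ∞ (extChartAt I (1 : G))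
      ((extChartAt I (1 : G)).symm (chartOne I G) * (extChartAt I (1 : G)).symm (chartOne I G)) := by
    rw [extChartAt_symm_chartOne, mul_one]
    exact contMDiffAt_extChartAt
  exact ContMDiffAt.comp (g := (extChartAt I (1 : G))) (chartOne I G, chartOne I G) h4 h3

lemma leftField_chartOne [I.Boundaryless] :
    leftField I G (chartOne I G) = ContinuousLinearMap.id ℝ E := by
  have h : HasFDerivAt (locMul I G) (fderiv ℝ (locMul I G) (chartOne I G, chartOne I G))
      (chartOne I G, chartOne I G) :=
    ((contDiffAt_locMul I G).differentiableAt (by simp)).hasFDerivAt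
  have h2 := h.comp (chartOne I G) (hasFDerivAt_prodMk_right (𝕜 := ℝ) (chartOne I G) (chartOne I G))
  refine h2.unique ((hasFDerivAt_id (𝕜 := ℝ) (chartOne I G)).congr_of_eventuallyEq ?_)
  filter_upwards [target_mem_nhds_chartOne I G] with p hp
  exact locMul_left_one I G hp

lemma rightField_chartOne [I.Boundaryless] :
    rightField I G (chartOne I G) = ContinuousLinearMap.id ℝ E := by
  have h : HasFDerivAt (locMul I G) (fderiv ℝ (locMul I G) (chartOne I G, chartOne I G))
      (chartOne I G, chartOne I G) :=
    ((contDiffAt_locMul I G).differentiableAt (by simp)).hasFDerivAt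
  have h2 := h.comp (f := fun p : E => (p, chartOne I G)) (chartOne I G) (hasFDerivAt_prodMk_left (𝕜 := ℝ) (chartOne I G) (chartOne I G))
  refine h2.unique ((hasFDerivAt_id (𝕜 := ℝ) (chartOne I G)).congr_of_eventuallyEq ?_)
  filter_upwards [target_mem_nhds_chartOne I G] with p hp
  exact locMul_right_one I G hp

lemma contDiffAt_fderiv_locMul [I.Boundaryless] :
    ContDiffAt ℝ ∞ (fderiv ℝ (locMul I G)) (chartOne I G, chartOne I G) :=
  (contDiffAt_locMul I G).fderiv_right (by simp)

lemma contDiffAt_leftField [I.Boundaryless] :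
    ContDiffAt ℝ ∞ (leftField I G) (chartOne I G) := by
  have h : ContDiffAt ℝ ∞ (fun p : E => fderiv ℝ (locMul I G) (p, chartOne I G)) (chartOne I G) :=
    ContDiffAt.comp (g := fderiv ℝ (locMul I G)) (f := fun p : E => (p, chartOne I G))
      (chartOne I G) (contDiffAt_fderiv_locMul I G) (by fun_prop)
  exact h.clm_comp contDiffAt_const

lemma contDiffAt_rightField [I.Boundaryless] :
    ContDiffAt ℝ ∞ (rightField I G) (chartOne I G) := by
  have h : ContDiffAt ℝ ∞ (fun p : E => fderiv ℝ (locMul I G) (chartOne I G, p)) (chartOne I G) :=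
    ContDiffAt.comp (g := fderiv ℝ (locMul I G)) (f := fun p : E => (chartOne I G, p))
      (chartOne I G) (contDiffAt_fderiv_locMul I G) (by fun_prop)
  exact h.clm_comp contDiffAt_const

/-- Symmetry of the second derivative of the multiplication. -/
lemma fderiv_leftField_eq_fderiv_rightField [I.Boundaryless] (X Y : E) :
    fderiv ℝ (rightField I G) (chartOne I G) X Y = fderiv ℝ (leftField I G) (chartOne I G) Y X := by
  have hsymm := (contDiffAt_locMul I G).isSymmSndFDerivAt
    (by rw [minSmoothness_of_isRCLikeNormedField]; exact WithTop.coe_le_coe.2 (le_top : (2 : ℕ∞) ≤ ⊤))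
  have hd : HasFDerivAt (fderiv ℝ (locMul I G))
      (fderiv ℝ (fderiv ℝ (locMul I G)) (chartOne I G, chartOne I G))
      (chartOne I G, chartOne I G) :=
    ((contDiffAt_fderiv_locMul I G).differentiableAt (by simp)).hasFDerivAt
  have hl := (hd.comp (f := fun p : E => (p, chartOne I G)) (chartOne I G)
    (hasFDerivAt_prodMk_left (𝕜 := ℝ) (chartOne I G) (chartOne I G))).clm_comp
      (hasFDerivAt_const (ContinuousLinearMap.inr ℝ E E) (chartOne I G))
  have hr := (hd.comp (chartOne I G)
    (hasFDerivAt_prodMk_right (𝕜 := ℝ) (chartOne I G) (chartOne I G))).clm_comp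
      (hasFDerivAt_const (ContinuousLinearMap.inl ℝ E E) (chartOne I G))
  have hl' : fderiv ℝ (leftField I G) (chartOne I G) = _ := hl.fderiv
  have hr' : fderiv ℝ (rightField I G) (chartOne I G) = _ := hr.fderiv
  rw [hl', hr']
  simpa using hsymm (0, X) (Y, 0)

end Chart

/-! ### One-parameter subgroups and the exponential map -/

section ExpCurve
open Set Filter Topology

variable {E : Type*} [NormedAddCommGroup E] [NormedSpace ℝ E]
  {HM : Type*} [TopologicalSpace HM] (I : ModelWithCorners ℝ E HM)
  {G : Type*} [TopologicalSpace G] [ChartedSpace HM G] [Group G] [LieGroup I ∞ G]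

lemma mdifferentiableAt_mul_left (a g : G) : MDifferentiableAt I I (fun x : G => a * x) g :=
  (contMDiff_mul_left (I := I) (n := ∞)).contMDiffAt.mdifferentiableAt (by simp)

lemma mdifferentiableAt_mul_right (a g : G) : MDifferentiableAt I I (fun x : G => x * a) g :=
  (contMDiff_mul_right (I := I) (n := ∞)).contMDiffAt.mdifferentiableAt (by simp)

lemma mfderiv_mul_left_mulInvariantVectorField (a g : G) (X : GroupLieAlgebra I G) :
    mfderiv I I (fun x : G => a * x) g (mulInvariantVectorField X g) =
      mulInvariantVectorField X (a * g) := by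
  have h : (fun x : G => a * g * x) = (fun x => a * x) ∘ (fun x => g * x) := by
    ext x; simp [mul_assoc]
  have h2 := mfderiv_comp_of_eq (I := I) (I' := I) (I'' := I) (x := (1 : G)) (y := g)
    (mdifferentiableAt_mul_left I a g) (mdifferentiableAt_mul_left I g 1) (mul_one g)
  rw [← h] at h2
  simp only [mulInvariantVectorField]
  rw [h2]
  -- The chain rule produces the base point `g * 1`. All tangent spaces are the model space, so it
  -- is replaced by `g` through a congruence in the base point.
  exact congrArg (fun z : G => (mfderiv I I (fun x : G => a * x) z : E →L[ℝ] E)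
    (mfderiv I I (fun x : G => g * x) 1 X)) (mul_one g).symm

lemma mulInvariantVectorField_one (X : GroupLieAlgebra I G) :
    mulInvariantVectorField X (1 : G) = X := by
  have h : ∀ f : G → G, f = id → (show E →L[ℝ] E from mfderiv I I f 1) X = X := by
    rintro _ rfl
    rw [mfderiv_id]
    rfl
  exact h _ (by ext x; simp)

/-- Left-invariant vector fields in the chart at the identity. -/
lemma eventually_mfderiv_extChartAt_mulInvariantVectorField [I.Boundaryless] :
    ∀ᶠ p in 𝓝 (chartOne I G), p ∈ (extChartAt I (1 : G)).target ∧
      ∀ X : GroupLieAlgebra I G,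
      mfderiv I 𝓘(ℝ, E) (extChartAt I (1 : G)) ((extChartAt I (1 : G)).symm p)
        (mulInvariantVectorField X ((extChartAt I (1 : G)).symm p)) = leftField I G p X := by
  have hd : ∀ᶠ z in 𝓝 (chartOne I G, chartOne I G), DifferentiableAt ℝ (locMul I G) z :=
    (((contDiffAt_locMul I G).of_le (m := 1) (by exact mod_cast le_top)).eventually
      (by simp)).mono fun z hz => hz.differentiableAt (by simp)
  have hd2 : ∀ᶠ p in 𝓝 (chartOne I G), DifferentiableAt ℝ (locMul I G) (p, chartOne I G) :=
    (Continuous.tendsto (f := fun p : E => (p, chartOne I G)) (by fun_prop) _).eventually hd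
  filter_upwards [hd2, target_mem_nhds_chartOne I G] with p hp hpt
  refine ⟨hpt, fun X => ?_⟩
  set g := (extChartAt I (1 : G)).symm p with hg
  have hgs : g ∈ (extChartAt I (1 : G)).source := (extChartAt I (1 : G)).map_target hpt
  have hφ : MDifferentiableAt I 𝓘(ℝ, E) (extChartAt I (1 : G)) g :=
    mdifferentiableAt_extChartAt (by rwa [extChartAt_source] at hgs)
  have h2 := mfderiv_comp_of_eq (I := I) (I' := I) (I'' := 𝓘(ℝ, E)) (x := (1 : G)) (y := g)
    hφ (mdifferentiableAt_mul_left I g 1) (mul_one g)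
  have h3 : mfderiv I 𝓘(ℝ, E) (extChartAt I (1 : G) ∘ fun x => g * x) (1 : G)
      = leftField I G p := by
    have hm : MDifferentiableAt I 𝓘(ℝ, E) (extChartAt I (1 : G) ∘ fun x => g * x) (1 : G) :=
      MDifferentiableAt.comp_of_eq (1 : G) hφ (mdifferentiableAt_mul_left I g 1) (mul_one g)
    rw [hm.mfderiv]
    rw [I.range_eq_univ, fderivWithin_univ]
    have h4 : writtenInExtChartAt I 𝓘(ℝ, E) (1 : G) (extChartAt I (1 : G) ∘ fun x => g * x)
        = fun q => locMul I G (p, q) := by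
      ext q
      simp only [writtenInExtChartAt, extChartAt_model_space_eq_id, locMul, hg]
      rfl
    rw [h4]
    exact (hp.hasFDerivAt.comp (f := fun q : E => (p, q)) (chartOne I G)
      (hasFDerivAt_prodMk_right (𝕜 := ℝ) p (chartOne I G))).fderiv
  rw [← h3, h2]
  exact congrArg (fun z : G => (mfderiv I 𝓘(ℝ, E) (extChartAt I (1 : G)) z : E →L[ℝ] E)
    (mfderiv I I (fun x : G => g * x) 1 X)) (mul_one g).symm

lemma contMDiff_mulInvariantVectorField_one (X : GroupLieAlgebra I G) :
    ContMDiff I I.tangent 1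
      (fun g : G => (⟨g, mulInvariantVectorField X g⟩ : TangentBundle I G)) :=
  (contMDiff_mulInvariantVectorField X).of_le (by
    rw [minSmoothness_of_isRCLikeNormedField]; exact WithTop.coe_le_coe.2 (by norm_num))

lemma isMIntegralCurve_mul_left {γ : ℝ → G} {X : GroupLieAlgebra I G} (a : G)
    (h : IsMIntegralCurve (I := I) γ (mulInvariantVectorField X)) :
    IsMIntegralCurve (I := I) (fun t => a * γ t) (mulInvariantVectorField X) := by
  intro t
  have := HasMFDerivAt.comp t (mdifferentiableAt_mul_left I a (γ t)).hasMFDerivAt (h t)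
  refine this.congr_mfderiv ?_
  ext
  change mfderiv I I (fun x : G => a * x) (γ t) ((1 : ℝ) • mulInvariantVectorField X (γ t)) =
    (1 : ℝ) • mulInvariantVectorField X (a * γ t)
  rw [one_smul, one_smul, mfderiv_mul_left_mulInvariantVectorField]

lemma isMIntegralCurveOn_mul_left {γ : ℝ → G} {X : GroupLieAlgebra I G} {s : Set ℝ} (a : G)
    (h : IsMIntegralCurveOn (I := I) γ (mulInvariantVectorField X) s) :
    IsMIntegralCurveOn (I := I) (fun t => a * γ t) (mulInvariantVectorField X) s := by
  intro t ht
  have := HasMFDerivAt.comp_hasMFDerivWithinAt t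
    (mdifferentiableAt_mul_left I a (γ t)).hasMFDerivAt (h t ht)
  refine this.congr_mfderiv ?_
  ext
  change mfderiv I I (fun x : G => a * x) (γ t) ((1 : ℝ) • mulInvariantVectorField X (γ t)) =
    (1 : ℝ) • mulInvariantVectorField X (a * γ t)
  rw [one_smul, one_smul, mfderiv_mul_left_mulInvariantVectorField]

variable [CompleteSpace E] [I.Boundaryless] [T2Space G]

/-- Left translates of a local integral curve through the identity are integral curves through every
other point on the same time interval, and a uniform existence time makes the field complete. -/
lemma exists_isExpCurve (X : GroupLieAlgebra I G) : ∃ γ : ℝ → G, IsExpCurve I X γ := by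
  haveI : IsManifold I 1 G := IsManifold.of_le (n := ∞) (by exact mod_cast le_top)
  have hv := contMDiff_mulInvariantVectorField_one I X
  obtain ⟨γ, h0, hγ⟩ := exists_isMIntegralCurveAt_of_contMDiffAt_boundaryless (t₀ := 0)
    (hv.contMDiffAt (x := (1 : G)))
  obtain ⟨ε, hε, hγ⟩ := isMIntegralCurveAt_iff'.1 hγ
  refine exists_isMIntegralCurve_of_isMIntegralCurveOn hv hε (fun x => ?_) 1
  refine ⟨fun t => x * γ t, by simp [h0], ?_⟩
  have := isMIntegralCurveOn_mul_left I x hγ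
  rwa [Real.ball_eq_Ioo, zero_sub, zero_add] at this

lemma isMIntegralCurve_unique {X : GroupLieAlgebra I G} {γ γ' : ℝ → G}
    (h : IsMIntegralCurve (I := I) γ (mulInvariantVectorField X))
    (h' : IsMIntegralCurve (I := I) γ' (mulInvariantVectorField X)) (h0 : γ 0 = γ' 0) :
    γ = γ' := by
  haveI : IsManifold I 1 G := IsManifold.of_le (n := ∞) (by exact mod_cast le_top)
  exact isMIntegralCurve_Ioo_eq_of_contMDiff_boundaryless
    (contMDiff_mulInvariantVectorField_one I X) h h' h0

/-- The exponential map. -/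
def lexp (X : GroupLieAlgebra I G) : G := (exists_isExpCurve I X).choose 1

lemma IsExpCurve.smul {X : GroupLieAlgebra I G} {γ : ℝ → G} (h : IsExpCurve I X γ) (c : ℝ) :
    IsExpCurve I (c • X) (fun t => γ (t * c)) := by
  refine ⟨by simp [h.1], ?_⟩
  rw [mulInvariantVectorField_smul]
  exact h.2.comp_mul c

lemma IsExpCurve.eq_lexp {X : GroupLieAlgebra I G} {γ : ℝ → G} (h : IsExpCurve I X γ) (t : ℝ) :
    γ t = lexp I (t • X) := by
  have h1 := (exists_isExpCurve I (t • X)).choose_spec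
  have h2 := h.smul I t
  have := isMIntegralCurve_unique I h1.2 h2.2 (h1.1.trans h2.1.symm)
  rw [lexp, this]
  simp

lemma isExpCurve_lexp (X : GroupLieAlgebra I G) : IsExpCurve I X (fun t => lexp I (t • X)) := by
  obtain ⟨γ, h⟩ := exists_isExpCurve I X
  have : γ = fun t => lexp I (t • X) := funext fun t => h.eq_lexp I t
  exact this ▸ h

lemma lexp_zero : lexp I (0 : GroupLieAlgebra I G) = 1 := by
  simpa using (isExpCurve_lexp I (0 : GroupLieAlgebra I G)).1

lemma lexp_add_smul (X : GroupLieAlgebra I G) (s t : ℝ) :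
    lexp I ((s + t) • X) = lexp I (s • X) * lexp I (t • X) := by
  have h := isExpCurve_lexp I X
  have h1 := isMIntegralCurve_mul_left I (lexp I (s • X)) h.2
  have h2 := h.2.comp_add s
  have := isMIntegralCurve_unique I h1 h2 (by simp [lexp_zero])
  have := congrFun this t
  simp only [Function.comp] at this
  rw [this, add_comm]

lemma lexp_neg (X : GroupLieAlgebra I G) : lexp I (-X) = (lexp I X)⁻¹ := by
  have := lexp_add_smul I X (-1) 1
  simp only [neg_add_cancel, zero_smul, lexp_zero, neg_smul, one_smul] at this
  exact eq_inv_of_mul_eq_one_left this.symm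

lemma lexp_nsmul (X : GroupLieAlgebra I G) (n : ℕ) : lexp I ((n : ℝ) • X) = lexp I X ^ n := by
  induction n with
  | zero => simp [lexp_zero]
  | succ n ih =>
    rw [Nat.cast_succ, lexp_add_smul, ih, one_smul, pow_succ]

lemma continuous_lexp_smul (X : GroupLieAlgebra I G) : Continuous fun t : ℝ => lexp I (t • X) :=
  (isExpCurve_lexp I X).2.continuous

end ExpCurve

/-! ### Strict differentiability of the exponential map at the origin -/

section ExpChart
open Set Filter Topology Metric

variable {E : Type*} [NormedAddCommGroup E] [NormedSpace ℝ E] [FiniteDimensional ℝ E]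
  [CompleteSpace E]
  {HM : Type*} [TopologicalSpace HM] (I : ModelWithCorners ℝ E HM) [I.Boundaryless]
  (G : Type*) [TopologicalSpace G] [ChartedSpace HM G] [Group G] [LieGroup I ∞ G] [T2Space G]

/-- The exponential map in the preferred chart at the identity. -/
def chartExp (X : E) : E := extChartAt I (1 : G) (lexp I (G := G) X)

lemma chartExp_zero : chartExp I G 0 = chartOne I G := by
  have : lexp I (G := G) (0 : E) = 1 := lexp_zero I
  rw [chartExp, this, chartOne]

/-- The flow equation in coordinates. A single neighbourhood of the identity works for all `X` and
`t` at once, which is what the uniform estimates below require. -/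
lemma eventually_hasDerivAt_chartExp :
    ∀ᶠ p in 𝓝 (chartOne I G), p ∈ (extChartAt I (1 : G)).target ∧ ∀ (X : E) (t : ℝ),
      lexp I (G := G) (t • X : E) ∈ (extChartAt I (1 : G)).source →
      chartExp I G (t • X) = p →
      HasDerivAt (fun s : ℝ => chartExp I G (s • X)) (leftField I G p X) t := by
  filter_upwards [eventually_mfderiv_extChartAt_mulInvariantVectorField I (G := G)]
    with p ⟨hpt, hp⟩
  refine ⟨hpt, fun X t hs hX => ?_⟩
  have hpe : (extChartAt I (1 : G)).symm p = lexp I (G := G) (t • X : E) := by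
    rw [← hX, chartExp]
    exact (extChartAt I (1 : G)).left_inv hs
  have hp := hp X
  rw [hpe] at hp
  have hφ : MDifferentiableAt I 𝓘(ℝ, E) (extChartAt I (1 : G)) (lexp I (G := G) (t • X : E)) :=
    mdifferentiableAt_extChartAt (by rwa [extChartAt_source] at hs)
  have h := HasMFDerivAt.comp t hφ.hasMFDerivAt ((isExpCurve_lexp I (G := G) X).2 t)
  have key : ∀ (T : E →L[ℝ] E) (v : E),
      HasFDerivAt (fun s : ℝ => chartExp I G (s • X)) (T.comp ((1 : ℝ →L[ℝ] ℝ).smulRight v)) t →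
      HasDerivAt (fun s : ℝ => chartExp I G (s • X)) (T v) t := fun T v h => by
    simpa using h.hasDerivAt
  rw [← hp]
  exact key _ _ (hasMFDerivAt_iff_hasFDerivAt.1 h)

/-- A first-exit argument, since continuity of the exponential map in `X` is not yet known. Near the
identity the coordinate velocity is at most `2 * ‖X‖`, so if `‖X‖ < d / 4` the curve moves at most
`d / 2` in unit time and cannot leave the ball of radius `d`. -/
lemma exists_forall_lexp_mem_source {δ : ℝ} (hδ : 0 < δ) :
    ∃ ρ > 0, ∀ X : E, ‖X‖ < ρ → ∀ t ∈ Icc (0 : ℝ) 1,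
      lexp I (G := G) (t • X : E) ∈ (extChartAt I (1 : G)).source ∧
        chartExp I G (t • X) ∈ ball (chartOne I G) δ := by
  set φ := extChartAt I (1 : G) with hφ
  set p0 := chartOne I G with hp0
  have hA : ∀ᶠ p in 𝓝 p0, ‖leftField I G p‖ < 2 := by
    refine (contDiffAt_leftField I G).continuousAt.norm.eventually_lt continuousAt_const ?_
    rw [leftField_chartOne]
    exact lt_of_le_of_lt ContinuousLinearMap.norm_id_le one_lt_two
  obtain ⟨r, hr, hball⟩ := Metric.eventually_nhds_iff_ball.1
    (hA.and (eventually_hasDerivAt_chartExp I G))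
  set d := min r δ with hd
  have hd0 : 0 < d := lt_min hr hδ
  refine ⟨d / 4, by positivity, fun X hX => ?_⟩
  set γ : ℝ → G := fun t => lexp I (G := G) (t • X : E) with hγ
  have hγc : Continuous γ := continuous_lexp_smul I (G := G) X
  set K : Set G := φ.source ∩ φ ⁻¹' ball p0 d with hK
  have hKo : IsOpen K := by
    rw [hK, hφ, extChartAt_source]; exact isOpen_extChartAt_preimage (I := I) (1 : G) isOpen_ball
  suffices h : ∀ t ∈ Icc (0 : ℝ) 1, γ t ∈ K from
    fun t ht => ⟨(h t ht).1, ball_subset_ball (min_le_right _ _) (h t ht).2⟩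
  by_contra! hne
  obtain ⟨t1, ht1, ht1K⟩ := hne
  have hcomp : IsCompact (Icc (0 : ℝ) 1 ∩ γ ⁻¹' Kᶜ) :=
    isCompact_Icc.inter_right (hKo.isClosed_compl.preimage hγc)
  obtain ⟨t0, ht0, hleast⟩ := hcomp.exists_isLeast ⟨t1, ht1, ht1K⟩
  have hbefore : ∀ t ∈ Ico (0 : ℝ) t0, γ t ∈ K := by
    intro t ht
    by_contra hc
    exact absurd (hleast ⟨⟨ht.1, ht.2.le.trans ht0.1.2⟩, hc⟩) (not_le.2 ht.2)
  have h0 : γ 0 = 1 := by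
    have : lexp I (G := G) (0 : E) = 1 := lexp_zero I
    simp [hγ, this]
  have h1K : γ 0 ∈ K := by
    rw [h0]
    exact ⟨mem_extChartAt_source _, mem_ball_self hd0⟩
  have ht0pos : 0 < t0 := by
    rcases ht0.1.1.eq_or_lt with h | h
    · exact absurd h1K (h ▸ ht0.2)
    · exact h
  have hmem : ∀ t ∈ Ico (0 : ℝ) t0, φ (γ t) ∈ closedBall p0 (d / 2) := by
    intro t ht
    have hder : ∀ s ∈ Icc (0 : ℝ) t, HasDerivWithinAt (fun s : ℝ => chartExp I G (s • X))
        (leftField I G (chartExp I G (s • X)) X) (Icc 0 t) s := by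
      intro s hs
      have hsK := hbefore s ⟨hs.1, hs.2.trans_lt ht.2⟩
      exact ((hball _ (ball_subset_ball (min_le_left _ _) hsK.2)).2.2 X s hsK.1
        rfl).hasDerivWithinAt
    have hbd : ∀ s ∈ Ico (0 : ℝ) t, ‖leftField I G (chartExp I G (s • X)) X‖ ≤ 2 * ‖X‖ := by
      intro s hs
      have hsK := hbefore s ⟨hs.1, hs.2.trans ht.2⟩
      refine (ContinuousLinearMap.le_opNorm _ _).trans ?_
      gcongr
      exact (hball _ (ball_subset_ball (min_le_left _ _) hsK.2)).1.le
    have := norm_image_sub_le_of_norm_deriv_le_segment' hder hbd t ⟨ht.1, le_rfl⟩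
    rw [zero_smul, chartExp_zero] at this
    rw [mem_closedBall, dist_eq_norm]
    refine this.trans ?_
    have : t ≤ 1 := ht.2.le.trans ht0.1.2
    have h2 : 2 * ‖X‖ * (t - 0) ≤ 2 * ‖X‖ * 1 := by gcongr; linarith
    linarith
  have hsub : closedBall p0 (d / 2) ⊆ ball p0 d := closedBall_subset_ball (by linarith)
  have htgt : closedBall p0 (d / 2) ⊆ φ.target := fun p hp =>
    (hball p (ball_subset_ball (min_le_left _ _) (hsub hp))).2.1
  -- At the exit time `t0` the curve might have left the chart domain. The compact image of the
  -- smaller closed ball is closed in the Hausdorff group, so it still contains the limit point `γ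
  -- t0`.
  have hC : IsClosed (φ.symm '' closedBall p0 (d / 2)) :=
    ((isCompact_closedBall p0 (d / 2)).image_of_continuousOn
      ((continuousOn_extChartAt_symm (I := I) (1 : G)).mono htgt)).isClosed
  have hin : γ t0 ∈ φ.symm '' closedBall p0 (d / 2) := by
    have hcl : t0 ∈ closure (Ico 0 t0) := by
      rw [closure_Ico ht0pos.ne]; exact ⟨ht0pos.le, le_rfl⟩
    have := map_mem_closure hγc hcl (t := φ.symm '' closedBall p0 (d / 2))
      (fun t ht => ⟨φ (γ t), hmem t ht, φ.left_inv (hbefore t ht).1⟩)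
    rwa [hC.closure_eq] at this
  obtain ⟨p, hp, hpe⟩ := hin
  refine ht0.2 ⟨hpe ▸ φ.map_target (htgt hp), ?_⟩
  rw [mem_preimage, ← hpe, φ.right_inv (htgt hp)]
  exact hsub hp

/-- The difference `d t = exp (tX) - exp (tY) - t (X - Y)` satisfies `‖d'‖ ≤ ‖d‖ + (c / 2) ‖X - Y‖`
for small `X` and `Y`, and Grönwall's inequality at `t = 1` gives the strict estimate directly,
without smooth dependence of flows on parameters. -/
lemma hasStrictFDerivAt_chartExp :
    HasStrictFDerivAt (chartExp I G) (ContinuousLinearMap.id ℝ E) 0 := by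
  refine HasStrictFDerivAt.of_isLittleO ?_
  rw [Asymptotics.isLittleO_iff]
  intro c hc
  set p0 := chartOne I G with hp0
  obtain ⟨L, s, hs, hL⟩ := ((contDiffAt_leftField I G).of_le (m := 1)
    (by exact mod_cast le_top)).exists_lipschitzOnWith
  have hA : ∀ᶠ p in 𝓝 p0, ‖leftField I G p - ContinuousLinearMap.id ℝ E‖ < c / 4 := by
    have h := ((contDiffAt_leftField I G).continuousAt.sub
      (continuousAt_const (y := ContinuousLinearMap.id ℝ E))).norm
    refine h.eventually_lt continuousAt_const ?_
    simp only [Pi.sub_apply]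
    rw [leftField_chartOne, sub_self, norm_zero]
    positivity
  obtain ⟨δ, hδ, hball⟩ := Metric.eventually_nhds_iff_ball.1
    ((hA.and (eventually_hasDerivAt_chartExp I G)).and hs)
  obtain ⟨ρ, hρ, hexp⟩ := exists_forall_lexp_mem_source I G hδ
  -- With this radius `L * ‖Y‖ ≤ min 1 (c / 4)`: the bound `1` becomes the Grönwall constant, and `c
  -- / 4` is one half of the error term; the other half is the closeness of `leftField` to the
  -- identity.
  set ρ' := min ρ (min 1 (c / 4) / (L + 1)) with hρ'
  have hρ'0 : 0 < ρ' := by positivity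
  have hev : ∀ᶠ z in 𝓝 ((0 : E), (0 : E)), ‖z.1‖ < ρ' ∧ ‖z.2‖ < ρ' := by
    have h1 : ∀ᶠ z in 𝓝 ((0 : E), (0 : E)), ‖z.1‖ < ρ' :=
      (continuous_fst.norm.continuousAt).eventually_lt continuousAt_const (by simpa)
    have h2 : ∀ᶠ z in 𝓝 ((0 : E), (0 : E)), ‖z.2‖ < ρ' :=
      (continuous_snd.norm.continuousAt).eventually_lt continuousAt_const (by simpa)
    exact h1.and h2
  filter_upwards [hev] with ⟨X, Y⟩ ⟨hX, hY⟩
  simp only at hX hY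
  have hXb := hexp X (hX.trans_le (min_le_left _ _))
  have hYb := hexp Y (hY.trans_le (min_le_left _ _))
  have hLY : L * ‖Y‖ ≤ min 1 (c / 4) := by
    have h1 : ‖Y‖ ≤ min 1 (c / 4) / (L + 1) := hY.le.trans (min_le_right _ _)
    rw [le_div_iff₀ (by positivity)] at h1
    nlinarith [norm_nonneg Y]
  set d : ℝ → E := fun t => chartExp I G (t • X) - chartExp I G (t • Y) - t • (X - Y) with hd
  have hder : ∀ t ∈ Icc (0 : ℝ) 1, HasDerivAt d (leftField I G (chartExp I G (t • X)) X -
      leftField I G (chartExp I G (t • Y)) Y - (X - Y)) t := by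
    intro t ht
    have h1 := (hball _ (hXb t ht).2).1.2.2 X t (hXb t ht).1 rfl
    have h2 := (hball _ (hYb t ht).2).1.2.2 Y t (hYb t ht).1 rfl
    have h3 : HasDerivAt (fun t : ℝ => t • (X - Y)) (X - Y) t := by
      simpa using (hasDerivAt_id t).smul_const (X - Y)
    exact (h1.sub h2).sub h3
  have hbound : ∀ t ∈ Ico (0 : ℝ) 1, ‖leftField I G (chartExp I G (t • X)) X -
      leftField I G (chartExp I G (t • Y)) Y - (X - Y)‖ ≤ 1 * ‖d t‖ + c / 2 * ‖X - Y‖ := by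
    intro t ht
    have ht' : t ∈ Icc (0 : ℝ) 1 := ⟨ht.1, ht.2.le⟩
    set p := chartExp I G (t • X) with hp
    set q := chartExp I G (t • Y) with hq
    have hp' := hball p (hXb t ht').2
    have hq' := hball q (hYb t ht').2
    have e : leftField I G p X - leftField I G q Y - (X - Y) =
        (leftField I G p - ContinuousLinearMap.id ℝ E) (X - Y) +
          (leftField I G p - leftField I G q) Y := by
      simp only [sub_apply, map_sub, ContinuousLinearMap.id_apply]
      abel
    have hlip : ‖leftField I G p - leftField I G q‖ ≤ L * ‖p - q‖ := by
      have := hL.dist_le_mul p hp'.2 q hq'.2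
      rwa [dist_eq_norm, dist_eq_norm] at this
    have hpq : ‖p - q‖ ≤ ‖d t‖ + ‖X - Y‖ := by
      have : p - q = d t + t • (X - Y) := by simp [hd, hp, hq]
      rw [this]
      refine (norm_add_le _ _).trans ?_
      gcongr
      rw [norm_smul, Real.norm_of_nonneg ht.1]
      exact mul_le_of_le_one_left (norm_nonneg _) ht.2.le
    rw [e]
    calc _ ≤ c / 4 * ‖X - Y‖ + (L * ‖p - q‖) * ‖Y‖ := by
          refine (norm_add_le _ _).trans (add_le_add ?_ ?_)
          · refine (ContinuousLinearMap.le_opNorm _ _).trans ?_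
            gcongr
            exact hp'.1.1.le
          · refine (ContinuousLinearMap.le_opNorm _ _).trans ?_
            gcongr
      _ = c / 4 * ‖X - Y‖ + (L * ‖Y‖) * ‖p - q‖ := by ring
      _ ≤ c / 4 * ‖X - Y‖ + (L * ‖Y‖) * (‖d t‖ + ‖X - Y‖) := by gcongr
      _ = c / 4 * ‖X - Y‖ + ((L * ‖Y‖) * ‖d t‖ + (L * ‖Y‖) * ‖X - Y‖) := by ring
      _ ≤ c / 4 * ‖X - Y‖ + (1 * ‖d t‖ + c / 4 * ‖X - Y‖) := by
          gcongr
          · exact hLY.trans (min_le_left _ _)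
          · exact hLY.trans (min_le_right _ _)
      _ = _ := by ring
  have hgr := norm_le_gronwallBound_of_norm_deriv_right_le
    (f := d) (δ := 0) (K := 1) (ε := c / 2 * ‖X - Y‖) (a := 0) (b := 1)
    (fun t ht => (hder t ht).continuousAt.continuousWithinAt)
    (fun t ht => (hder t ⟨ht.1, ht.2.le⟩).hasDerivWithinAt)
    (by simp [hd, chartExp_zero]) hbound 1 ⟨zero_le_one, le_rfl⟩
  rw [gronwallBound_of_K_ne_0 one_ne_zero] at hgr
  have hd1 : d 1 = chartExp I G X - chartExp I G Y - (X - Y) := by simp [hd]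
  simp only [zero_mul, sub_zero, zero_add, one_mul, div_one, hd1] at hgr
  simp only [ContinuousLinearMap.id_apply]
  refine hgr.trans ?_
  -- The Grönwall factor `e - 1` is at most `2`, which turns `c / 2` into `c`.
  have he : Real.exp 1 - 1 ≤ 2 := by linarith [Real.exp_one_lt_d9]
  nlinarith [mul_nonneg hc.le (norm_nonneg (X - Y))]

end ExpChart

/-! ### The logarithm and the Lie product formula -/

section Log
open Set Filter Topology Metric

variable {E : Type*} [NormedAddCommGroup E] [NormedSpace ℝ E] [FiniteDimensional ℝ E]
  [CompleteSpace E]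
  {HM : Type*} [TopologicalSpace HM] (I : ModelWithCorners ℝ E HM) [I.Boundaryless]
  {G : Type*} [TopologicalSpace G] [ChartedSpace HM G] [Group G] [LieGroup I ∞ G] [T2Space G]

/-- The exponential map on the model space. -/
def mexp (X : E) : G := lexp I (G := G) X

variable (G) in
lemma hasStrictFDerivAt_chartExp_refl :
    HasStrictFDerivAt (chartExp I G) ((ContinuousLinearEquiv.refl ℝ E : E ≃L[ℝ] E) : E →L[ℝ] E) 0 :=
  hasStrictFDerivAt_chartExp I G

/-- The local inverse of the exponential map. -/
def mlog (g : G) : E :=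
  (hasStrictFDerivAt_chartExp_refl I G).localInverse _ _ _ (extChartAt I (1 : G) g)

lemma mexp_zero : mexp I (0 : E) = (1 : G) := lexp_zero I

lemma mexp_add_smul (X : E) (s t : ℝ) :
    (mexp I ((s + t) • X) : G) = mexp I (s • X) * mexp I (t • X) := lexp_add_smul I (G := G) X s t

lemma mexp_neg (X : E) : (mexp I (-X) : G) = (mexp I X)⁻¹ := lexp_neg I (G := G) X

lemma mexp_nsmul (X : E) (n : ℕ) : (mexp I ((n : ℝ) • X) : G) = mexp I X ^ n :=
  lexp_nsmul I (G := G) X n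

lemma mexp_zsmul (X : E) (n : ℤ) : (mexp I ((n : ℝ) • X) : G) = mexp I X ^ n := by
  obtain ⟨k, rfl | rfl⟩ := n.eq_nat_or_neg
  · simpa using mexp_nsmul I (G := G) X k
  · have := mexp_nsmul I (G := G) X k
    simp [mexp_neg, this]

lemma continuous_mexp_smul (X : E) : Continuous fun t : ℝ => (mexp I (t • X) : G) :=
  continuous_lexp_smul I (G := G) X

variable (G) in
lemma eventually_mexp_mem_source :
    ∀ᶠ X : E in 𝓝 0, (mexp I X : G) ∈ (extChartAt I (1 : G)).source := by
  obtain ⟨ρ, hρ, h⟩ := exists_forall_lexp_mem_source I G one_pos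
  filter_upwards [ball_mem_nhds (0 : E) hρ] with X hX
  have := (h X (by simpa using hX) 1 ⟨zero_le_one, le_rfl⟩).1
  rwa [one_smul] at this

variable (G) in
lemma eventually_symm_chartExp :
    ∀ᶠ X : E in 𝓝 0, (extChartAt I (1 : G)).symm (chartExp I G X) = mexp I X := by
  filter_upwards [eventually_mexp_mem_source I G] with X hX
  exact (extChartAt I (1 : G)).left_inv hX

variable (G) in
lemma eventually_mlog_mexp : ∀ᶠ X : E in 𝓝 0, mlog I (mexp I X : G) = X :=
  (hasStrictFDerivAt_chartExp_refl I G).eventually_left_inverse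

variable (G) in
lemma tendsto_localInverse :
    Tendsto ((hasStrictFDerivAt_chartExp_refl I G).localInverse _ _ _) (𝓝 (chartOne I G))
      (𝓝 (0 : E)) := by
  have := (hasStrictFDerivAt_chartExp_refl I G).localInverse_tendsto
  rwa [chartExp_zero] at this

variable (G) in
lemma tendsto_mlog : Tendsto (mlog I : G → E) (𝓝 1) (𝓝 0) :=
  (tendsto_localInverse I G).comp (continuousAt_extChartAt (I := I) (1 : G))

variable (G) in
lemma mlog_one : mlog I (1 : G) = (0 : E) := by
  have := (eventually_mlog_mexp I G).self_of_nhds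
  rwa [mexp_zero] at this

variable (G) in
lemma eventually_mexp_mlog : ∀ᶠ g : G in 𝓝 1, mexp I (mlog I g : E) = g := by
  have h1 := (hasStrictFDerivAt_chartExp_refl I G).eventually_right_inverse
  rw [chartExp_zero] at h1
  have h2 := (continuousAt_extChartAt (I := I) (1 : G)).eventually h1
  have h3 := (tendsto_mlog I G).eventually (eventually_mexp_mem_source I G)
  filter_upwards [h2, h3, extChartAt_source_mem_nhds (I := I) (1 : G)] with g h2 h3 h4
  exact (extChartAt I (1 : G)).injOn h3 h4 h2

variable (G) in
lemma eventually_continuousAt_mexp : ∀ᶠ X : E in 𝓝 0, ContinuousAt (mexp I : E → G) X := by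
  have hφ := hasStrictFDerivAt_chartExp_refl I G
  have h1 : ∀ᶠ X in 𝓝 (0 : E), ContinuousAt (chartExp I G) X := by
    filter_upwards [(hφ.toOpenPartialHomeomorph _).open_source.mem_nhds
      hφ.mem_toOpenPartialHomeomorph_source] with X hX
    exact (hφ.toOpenPartialHomeomorph _).continuousAt hX
  filter_upwards [h1, (eventually_symm_chartExp I G).eventually_nhds,
    eventually_mexp_mem_source I G] with X h1 h2 h3
  have h4 : ContinuousAt (extChartAt I (1 : G)).symm (chartExp I G X) :=
    continuousAt_extChartAt_symm' h3
  exact (ContinuousAt.comp (g := (extChartAt I (1 : G)).symm) h4 h1).congr h2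

/-- The identity `exp Y = exp (Y / (n + 1)) ^ (n + 1)` transports continuity from a neighbourhood of
the origin to any point. -/
lemma continuous_mexp : Continuous (mexp I : E → G) := by
  rw [continuous_iff_continuousAt]
  intro X
  have ht : Tendsto (fun n : ℕ => ((n : ℝ) + 1)⁻¹ • X) atTop (𝓝 0) := by
    have := (tendsto_one_div_add_atTop_nhds_zero_nat (𝕜 := ℝ)).smul_const X
    simpa using this
  obtain ⟨n, hn⟩ := (ht.eventually (eventually_continuousAt_mexp I G)).exists
  have h : (mexp I : E → G) = fun Y => (mexp I (((n : ℝ) + 1)⁻¹ • Y)) ^ (n + 1) := by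
    ext Y
    rw [← mexp_nsmul, smul_smul]
    have : ((n + 1 : ℕ) : ℝ) * ((n : ℝ) + 1)⁻¹ = 1 := by
      push_cast
      exact mul_inv_cancel₀ (by positivity)
    rw [this, one_smul]
  haveI : IsTopologicalGroup G := topologicalGroup_of_lieGroup I ∞
  rw [h]
  exact (ContinuousAt.comp (g := (mexp I : E → G)) hn (by fun_prop)).pow _

variable (G) in
/-- The product of two exponentials, to first order. -/
lemma hasStrictFDerivAt_mlog_mul :
    HasStrictFDerivAt (fun z : E × E => mlog I (mexp I z.1 * mexp I z.2 : G))
      (ContinuousLinearMap.fst ℝ E E + ContinuousLinearMap.snd ℝ E E) (0, 0) := by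
  have he1 : HasStrictFDerivAt (fun z : E × E => chartExp I G z.1)
      (ContinuousLinearMap.fst ℝ E E) (0, 0) :=
    HasStrictFDerivAt.comp (g := chartExp I G) (f := fun z : E × E => z.1) (0, 0)
      (hasStrictFDerivAt_chartExp I G) hasStrictFDerivAt_fst
  have he2 : HasStrictFDerivAt (fun z : E × E => chartExp I G z.2)
      (ContinuousLinearMap.snd ℝ E E) (0, 0) :=
    HasStrictFDerivAt.comp (g := chartExp I G) (f := fun z : E × E => z.2) (0, 0)
      (hasStrictFDerivAt_chartExp I G) hasStrictFDerivAt_snd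
  have hm : HasStrictFDerivAt (locMul I G)
      (ContinuousLinearMap.fst ℝ E E + ContinuousLinearMap.snd ℝ E E)
      (chartExp I G (0, 0).1, chartExp I G ((0 : E), (0 : E)).2) := by
    simp only [chartExp_zero]
    have h := (contDiffAt_locMul I G).hasStrictFDerivAt (by simp)
    refine h.congr_fderiv ?_
    ext v
    · exact congrArg (fun T : E →L[ℝ] E => T v) (rightField_chartOne I G) |>.trans (by simp)
    · exact congrArg (fun T : E →L[ℝ] E => T v) (leftField_chartOne I G) |>.trans (by simp)
  have hc := HasStrictFDerivAt.comp (g := locMul I G)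
    (f := fun z : E × E => (chartExp I G z.1, chartExp I G z.2)) (0, 0) hm (he1.prodMk he2)
  have hl : HasStrictFDerivAt ((hasStrictFDerivAt_chartExp_refl I G).localInverse _ _ _)
      (ContinuousLinearMap.id ℝ E)
      (locMul I G (chartExp I G (0, 0).1, chartExp I G ((0 : E), (0 : E)).2)) := by
    have := (hasStrictFDerivAt_chartExp_refl I G).to_localInverse
    simp only [chartExp_zero] at this ⊢
    rw [locMul_right_one I G (mem_of_mem_nhds (target_mem_nhds_chartOne I G))]
    exact this
  have hc2 := HasStrictFDerivAt.comp
    (g := ((hasStrictFDerivAt_chartExp_refl I G).localInverse _ _ _)) (0, 0) hl hc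
  refine (hc2.congr_of_eventuallyEq ?_).congr_fderiv ?_
  · have h1 : ∀ᶠ z in 𝓝 ((0 : E), (0 : E)),
        (extChartAt I (1 : G)).symm (chartExp I G z.1) = mexp I z.1 :=
      (continuous_fst.tendsto ((0 : E), (0 : E))).eventually (eventually_symm_chartExp I G)
    have h2 : ∀ᶠ z in 𝓝 ((0 : E), (0 : E)),
        (extChartAt I (1 : G)).symm (chartExp I G z.2) = mexp I z.2 :=
      (continuous_snd.tendsto ((0 : E), (0 : E))).eventually (eventually_symm_chartExp I G)
    filter_upwards [h1, h2] with z h1 h2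
    simp only [locMul, h1, h2, mlog]
  · ext v <;> simp

lemma tendsto_mexp_pow {Z : ℕ → E} {X : E} (h : Tendsto (fun n : ℕ => (n : ℝ) • Z n) atTop (𝓝 X)) :
    Tendsto (fun n : ℕ => (mexp I (Z n) : G) ^ n) atTop (𝓝 (mexp I X)) := by
  simp only [← mexp_nsmul]
  exact ((continuous_mexp I (G := G)).tendsto X).comp h

/-- The Lie product formula. -/
lemma tendsto_mexp_mul_pow (X Y : E) :
    Tendsto (fun n : ℕ => ((mexp I ((n : ℝ)⁻¹ • X) : G) * mexp I ((n : ℝ)⁻¹ • Y)) ^ n) atTop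
      (𝓝 (mexp I (X + Y))) := by
  haveI : IsTopologicalGroup G := topologicalGroup_of_lieGroup I ∞
  have hinv : Tendsto (fun n : ℕ => (n : ℝ)⁻¹) atTop (𝓝 0) := tendsto_inv_atTop_nhds_zero_nat
  have hX : Tendsto (fun n : ℕ => (n : ℝ)⁻¹ • X) atTop (𝓝 0) := by
    simpa using hinv.smul_const X
  have hY : Tendsto (fun n : ℕ => (n : ℝ)⁻¹ • Y) atTop (𝓝 0) := by
    simpa using hinv.smul_const Y
  set f : E × E → E := fun z => mlog I (mexp I z.1 * mexp I z.2 : G) with hf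
  have hd := (hasStrictFDerivAt_mlog_mul I G).hasFDerivAt
  have hline : HasDerivAt (fun t : ℝ => f (t • X, t • Y)) (X + Y) 0 := by
    have h1 : HasDerivAt (fun t : ℝ => (t • X, t • Y)) (X, Y) 0 := by
      simpa using ((hasDerivAt_id (0 : ℝ)).smul_const X).prodMk
        ((hasDerivAt_id (0 : ℝ)).smul_const Y)
    have h2 : HasFDerivAt f (ContinuousLinearMap.fst ℝ E E + ContinuousLinearMap.snd ℝ E E)
        ((0 : ℝ) • X, (0 : ℝ) • Y) := by simpa using hd
    simpa [Function.comp_def] using h2.comp_hasDerivAt 0 h1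
  have hf0 : f ((0 : ℝ) • X, (0 : ℝ) • Y) = 0 := by simp [hf, mexp_zero, mlog_one]
  -- The slopes at `0` of `t ↦ log (exp (tX) exp (tY))`, taken at `t = 1 / n`, tend to its
  -- derivative `X + Y`; exponentiating gives the `n`-th powers.
  have hlim : Tendsto (fun n : ℕ => (n : ℝ) • f ((n : ℝ)⁻¹ • X, (n : ℝ)⁻¹ • Y)) atTop
      (𝓝 (X + Y)) := by
    have h := hline.tendsto_slope_zero
    have hne : Tendsto (fun n : ℕ => (n : ℝ)⁻¹) atTop (𝓝[≠] 0) := by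
      refine tendsto_nhdsWithin_iff.2 ⟨hinv, ?_⟩
      filter_upwards [eventually_gt_atTop 0] with n hn
      exact inv_ne_zero (by exact_mod_cast hn.ne')
    have := h.comp hne
    simpa [Function.comp_def, hf0, mexp_zero, mlog_one, hf] using this
  refine (tendsto_mexp_pow I hlim).congr' ?_
  have h1 : Tendsto (fun n : ℕ => (mexp I ((n : ℝ)⁻¹ • X) : G) * mexp I ((n : ℝ)⁻¹ • Y)) atTop
      (𝓝 1) := by
    have := (((continuous_mexp I (G := G)).tendsto 0).comp hX).mul
      (((continuous_mexp I (G := G)).tendsto 0).comp hY)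
    simpa [mexp_zero, Function.comp_def] using this
  filter_upwards [h1.eventually (eventually_mexp_mlog I G)] with n hn
  simp only [hf]
  rw [hn]

end Log

/-! ### Cartan's closed subgroup theorem -/

section ClosedSubgroup
open Set Filter Topology Metric

variable {E : Type*} [NormedAddCommGroup E] [NormedSpace ℝ E] [FiniteDimensional ℝ E]
  [CompleteSpace E]
  {HM : Type*} [TopologicalSpace HM] (I : ModelWithCorners ℝ E HM) [I.Boundaryless]
  {G : Type*} [TopologicalSpace G] [ChartedSpace HM G] [Group G] [LieGroup I ∞ G] [T2Space G]

/-- The Lie algebra of a closed subgroup, in the model space. -/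
def closedLie (H : Subgroup G) (hH : IsClosed (H : Set G)) : Submodule ℝ E where
  carrier := {X | ∀ t : ℝ, (mexp I (t • X) : G) ∈ H}
  zero_mem' t := by simp [mexp_zero, H.one_mem]
  smul_mem' c X hX t := by
    rw [smul_smul]
    exact hX _
  add_mem' := by
    intro X Y hX hY t
    have h := tendsto_mexp_mul_pow I (G := G) (t • X) (t • Y)
    rw [← smul_add] at h
    refine hH.mem_of_tendsto h (Eventually.of_forall fun n => ?_)
    refine H.pow_mem (H.mul_mem ?_ ?_) n
    · rw [smul_smul]; exact hX _
    · rw [smul_smul]; exact hY _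

lemma isExpCurve_iff {X : GroupLieAlgebra I G} {γ : ℝ → G} :
    IsExpCurve I X γ ↔ γ = fun t => lexp I (t • X) :=
  ⟨fun h => funext fun t => h.eq_lexp I t, fun h => h ▸ isExpCurve_lexp I X⟩

lemma mem_lieAlg_iff {H : Subgroup G} (hH : IsClosed (H : Set G)) {X : GroupLieAlgebra I G} :
    X ∈ lieAlg I H ↔ ∀ t : ℝ, lexp I (t • X) ∈ H := by
  let S : Submodule ℝ (GroupLieAlgebra I G) := by
    exact (show Submodule ℝ E from closedLie I H hH)
  have h : {X : GroupLieAlgebra I G | ∃ γ : ℝ → G, IsExpCurve I X γ ∧ ∀ t, γ t ∈ H} =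
      (S : Set (GroupLieAlgebra I G)) := by
    ext X
    constructor
    · rintro ⟨γ, h, hγ⟩ t
      rw [isExpCurve_iff] at h
      subst h
      exact hγ t
    · intro h
      exact ⟨_, isExpCurve_lexp I X, h⟩
  rw [lieAlg, h, Submodule.span_eq S]
  rfl

lemma lieAlg_mono {H K : Subgroup G} (h : H ≤ K) : lieAlg I H ≤ lieAlg I K :=
  Submodule.span_mono fun _ ⟨γ, h1, h2⟩ => ⟨γ, h1, fun t => h (h2 t)⟩

/-- With `k n = ⌊t / ‖Z n‖⌋` the vectors `k n • Z n` tend to `t • X`, and their exponentials are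
powers of elements of `H`, hence so is the limit an element of the closed `H`. -/
lemma mem_closedLie_of_tendsto {H : Subgroup G} (hH : IsClosed (H : Set G)) {Z : ℕ → E} {X : E}
    (hZ0 : Tendsto Z atTop (𝓝 0)) (hZne : ∀ n, Z n ≠ 0) (hZH : ∀ n, (mexp I (Z n) : G) ∈ H)
    (hZ : Tendsto (fun n => ‖Z n‖⁻¹ • Z n) atTop (𝓝 X)) : X ∈ closedLie I H hH := by
  intro t
  set k : ℕ → ℤ := fun n => ⌊t / ‖Z n‖⌋ with hk
  have hnorm : Tendsto (fun n => ‖Z n‖) atTop (𝓝 0) := by simpa using hZ0.norm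
  have hk1 : Tendsto (fun n => (k n : ℝ) * ‖Z n‖) atTop (𝓝 t) := by
    have h1 : Tendsto (fun n => t - ‖Z n‖) atTop (𝓝 t) := by simpa using hnorm.const_sub t
    refine tendsto_of_tendsto_of_tendsto_of_le_of_le h1 tendsto_const_nhds (fun n => ?_)
      (fun n => ?_)
    · have hp : 0 < ‖Z n‖ := norm_pos_iff.2 (hZne n)
      have := (Int.sub_one_lt_floor (t / ‖Z n‖)).le
      have h2 := mul_le_mul_of_nonneg_right this hp.le
      rw [sub_mul, div_mul_cancel₀ _ hp.ne', one_mul] at h2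
      exact h2
    · have hp : 0 < ‖Z n‖ := norm_pos_iff.2 (hZne n)
      have h2 := mul_le_mul_of_nonneg_right (Int.floor_le (t / ‖Z n‖)) hp.le
      rwa [div_mul_cancel₀ _ hp.ne'] at h2
  have hlim : Tendsto (fun n => (k n : ℝ) • Z n) atTop (𝓝 (t • X)) := by
    refine (hk1.smul hZ).congr fun n => ?_
    have hp : ‖Z n‖ ≠ 0 := norm_ne_zero_iff.2 (hZne n)
    rw [smul_smul, mul_assoc, mul_inv_cancel₀ hp, mul_one]
  refine hH.mem_of_tendsto (((continuous_mexp I (G := G)).tendsto _).comp hlim)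
    (Eventually.of_forall fun n => ?_)
  simp only [Function.comp, mexp_zsmul]
  exact H.zpow_mem (hZH n) _

/-- A neighbourhood of the identity in a closed subgroup is covered by the exponential map. -/
lemma eventually_mem_image_mexp {H : Subgroup G} (hH : IsClosed (H : Set G)) :
    ∀ᶠ g : G in 𝓝 1, g ∈ H → g ∈ (mexp I) '' (closedLie I H hH : Set E) := by
  set 𝔥 := closedLie I H hH with h𝔥
  obtain ⟨𝔪, hm⟩ := 𝔥.exists_isCompl
  let e : (𝔥 × 𝔪) ≃L[ℝ] E := (Submodule.prodEquivOfIsCompl 𝔥 𝔪 hm).toContinuousLinearEquiv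
  have hinc : HasStrictFDerivAt (fun z : 𝔥 × 𝔪 => ((z.1 : E), (z.2 : E)))
      ((𝔥.subtypeL.comp (ContinuousLinearMap.fst ℝ 𝔥 𝔪)).prod
        (𝔪.subtypeL.comp (ContinuousLinearMap.snd ℝ 𝔥 𝔪))) 0 :=
    (𝔥.subtypeL.comp (ContinuousLinearMap.fst ℝ 𝔥 𝔪)).hasStrictFDerivAt.prodMk
      (𝔪.subtypeL.comp (ContinuousLinearMap.snd ℝ 𝔥 𝔪)).hasStrictFDerivAt
  set F : 𝔥 × 𝔪 → E := fun z => mlog I (mexp I (z.1 : E) * mexp I (z.2 : E) : G) with hF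
  -- The derivative of `(h, m) ↦ log (exp h exp m)` is addition `𝔥 × 𝔪 → 𝔤`, an isomorphism, so
  -- every small element is `exp h exp m` with coordinates given by `L`.
  have hFd : HasStrictFDerivAt F (e : (𝔥 × 𝔪) →L[ℝ] E) 0 := by
    refine (HasStrictFDerivAt.comp (g := fun z : E × E => mlog I (mexp I z.1 * mexp I z.2 : G))
      (0 : 𝔥 × 𝔪) (hasStrictFDerivAt_mlog_mul I G) hinc).congr_fderiv ?_
    ext z <;> simp [e]
  have hF0 : F 0 = 0 := by simp [hF, mexp_zero, mlog_one]
  set L := hFd.localInverse _ _ _ with hL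
  have hL0 : Tendsto L (𝓝 0) (𝓝 0) := by
    have := hFd.localInverse_tendsto
    rwa [hF0] at this
  have hFL : ∀ᶠ y in 𝓝 (0 : E), F (L y) = y := by
    have := hFd.eventually_right_inverse
    rwa [hF0] at this
  haveI : IsTopologicalGroup G := topologicalGroup_of_lieGroup I ∞
  have hprod : Tendsto (fun y : E => (mexp I ((L y).1 : E) : G) * mexp I ((L y).2 : E)) (𝓝 0)
      (𝓝 1) := by
    have hc : Continuous fun z : 𝔥 × 𝔪 => (mexp I (z.1 : E) : G) * mexp I (z.2 : E) :=
      ((continuous_mexp I).comp (by fun_prop)).mul ((continuous_mexp I).comp (by fun_prop))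
    have := (hc.tendsto 0).comp hL0
    simpa [mexp_zero, Function.comp_def] using this
  have hdec : ∀ᶠ y in 𝓝 (0 : E),
      (mexp I y : G) = mexp I ((L y).1 : E) * mexp I ((L y).2 : E) := by
    filter_upwards [hFL, hprod.eventually (eventually_mexp_mlog I G)] with y h1 h2
    rw [← h2]
    exact congrArg (mexp I) h1.symm
  -- Otherwise there are nonzero `Z n ∈ 𝔪` tending to `0` with `exp (Z n) ∈ H`; a limit of their
  -- directions is a unit vector in `𝔥 ∩ 𝔪`, which is zero.
  have hzero : ∀ᶠ y in 𝓝 (0 : E), (mexp I y : G) ∈ H → (L y).2 = 0 := by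
    by_contra hc
    rw [Filter.not_eventually] at hc
    have hc' := hc.and_eventually hdec
    obtain ⟨y, hy, hyp⟩ := exists_seq_forall_of_frequently hc'
    simp only [Classical.not_imp] at hyp
    set Z : ℕ → 𝔪 := fun n => (L (y n)).2 with hZ
    have hZne : ∀ n, Z n ≠ 0 := fun n => (hyp n).1.2
    have hZ0 : Tendsto Z atTop (𝓝 0) := (continuous_snd.tendsto (0 : 𝔥 × 𝔪)).comp (hL0.comp hy)
    have hZH : ∀ n, (mexp I (Z n : E) : G) ∈ H := by
      intro n
      have h1 := (hyp n).2
      have h2 : (mexp I (((L (y n)).1 : 𝔥) : E) : G) ∈ H := by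
        have := (L (y n)).1.2 1
        rwa [one_smul] at this
      have h3 : (mexp I (Z n : E) : G) = (mexp I (((L (y n)).1 : 𝔥) : E))⁻¹ * mexp I (y n) := by
        rw [h1]; simp [hZ]
      rw [h3]
      exact H.mul_mem (H.inv_mem h2) (hyp n).1.1
    have hsph : ∀ n, ‖Z n‖⁻¹ • Z n ∈ sphere (0 : 𝔪) 1 := by
      intro n
      simp [norm_smul, hZne n]
    obtain ⟨X, hX, φ, hφ, hlim⟩ := (isCompact_sphere (0 : 𝔪) 1).tendsto_subseq hsph
    have hXm : ((X : 𝔪) : E) ∈ 𝔥 := by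
      refine mem_closedLie_of_tendsto I hH (Z := fun n => ((Z (φ n) : 𝔪) : E)) ?_ ?_ ?_ ?_
      · exact (continuous_subtype_val.tendsto (0 : 𝔪)).comp (hZ0.comp hφ.tendsto_atTop)
      · intro n; simpa using hZne (φ n)
      · intro n; exact hZH _
      · exact (continuous_subtype_val.tendsto X).comp hlim
    have hX0 : ((X : 𝔪) : E) = 0 := (Submodule.disjoint_def.1 hm.disjoint) _ hXm X.2
    have : X = 0 := by simpa using hX0
    rw [this] at hX
    simp at hX
  filter_upwards [(tendsto_mlog I G).eventually hzero, (tendsto_mlog I G).eventually hdec,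
    eventually_mexp_mlog I G] with g h1 h2 h3 hg
  have h4 := h1 (h3.symm ▸ hg)
  rw [h3, h4] at h2
  exact ⟨_, (L (mlog I g)).1.2, by simpa [mexp_zero] using h2.symm⟩

/-- A connected closed subgroup is generated by the exponentials of its Lie algebra. -/
lemma le_of_forall_lexp_mem {H K : Subgroup G} (hH : IsClosed (H : Set G))
    (hHc : IsConnected (H : Set G)) (h : ∀ X ∈ lieAlg I H, lexp I X ∈ K) : H ≤ K := by
  haveI : IsTopologicalGroup G := topologicalGroup_of_lieGroup I ∞
  haveI : ConnectedSpace H := isConnected_iff_connectedSpace.1 hHc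
  have hmem : ((K.subgroupOf H : Subgroup H) : Set H) ∈ 𝓝 (1 : H) := by
    have := (continuous_subtype_val.tendsto (1 : H)).eventually (eventually_mem_image_mexp I hH)
    filter_upwards [this] with g hg
    obtain ⟨X, hX, hXg⟩ := hg g.2
    rw [SetLike.mem_coe, Subgroup.mem_subgroupOf, ← hXg]
    exact h X ((mem_lieAlg_iff I hH).2 hX)
  have hopen : IsOpen ((K.subgroupOf H : Subgroup H) : Set H) :=
    Subgroup.isOpen_of_mem_nhds _ hmem
  have huniv := IsClopen.eq_univ ⟨Subgroup.isClosed_of_isOpen _ hopen, hopen⟩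
    ⟨1, (K.subgroupOf H).one_mem⟩
  intro g hg
  have : (⟨g, hg⟩ : H) ∈ ((K.subgroupOf H : Subgroup H) : Set H) := huniv ▸ mem_univ _
  exact Subgroup.mem_subgroupOf.1 this

lemma lexp_mem {H : Subgroup G} (hH : IsClosed (H : Set G)) {X : GroupLieAlgebra I G}
    (hX : X ∈ lieAlg I H) : lexp I X ∈ H := by
  have := (mem_lieAlg_iff I hH).1 hX 1
  rwa [one_smul] at this

lemma le_of_lieAlg_le {H K : Subgroup G} (hH : IsClosed (H : Set G))
    (hHc : IsConnected (H : Set G)) (hK : IsClosed (K : Set G))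
    (h : lieAlg I H ≤ lieAlg I K) : H ≤ K :=
  le_of_forall_lexp_mem I hH hHc fun _ hX => lexp_mem I hK (h hX)

end ClosedSubgroup

/-! ### The adjoint representation and its derivative -/

section Adjoint
open Set Filter Topology Metric

variable {E : Type*} [NormedAddCommGroup E] [NormedSpace ℝ E] [FiniteDimensional ℝ E]
  [CompleteSpace E]
  {HM : Type*} [TopologicalSpace HM] (I : ModelWithCorners ℝ E HM) [I.Boundaryless]
  {G : Type*} [TopologicalSpace G] [ChartedSpace HM G] [Group G] [LieGroup I ∞ G] [T2Space G]

/-- The adjoint representation on the model space. -/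
def mAd (a : G) : E →L[ℝ] E := Ad I a

/-- The Lie bracket on the model space. -/
def mbracket (G : Type*) [TopologicalSpace G] [ChartedSpace HM G] [Group G] (X Y : E) : E :=
  Bracket.bracket (L := GroupLieAlgebra I G) (M := GroupLieAlgebra I G) X Y

lemma tendsto_smul_zero (Z : E) : Tendsto (fun t : ℝ => t • Z) (𝓝 0) (𝓝 0) := by
  simpa using (by fun_prop : Continuous fun t : ℝ => t • Z).tendsto 0

/-- One-parameter subgroups determine their generators, by the logarithm at small times. In this way
linear identities about `Ad` and projections are read off from identities in the group. -/
lemma mexp_smul_injective {X Y : E} (h : ∀ t : ℝ, (mexp I (t • X) : G) = mexp I (t • Y)) :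
    X = Y := by
  have hev : ∀ Z : E, ∀ᶠ t : ℝ in 𝓝 0, mlog I (mexp I (t • Z) : G) = t • Z := fun Z =>
    (tendsto_smul_zero Z).eventually (eventually_mlog_mexp I G)
  obtain ⟨t, ⟨hX, hY⟩, ht⟩ := ((((hev X).and (hev Y)).filter_mono nhdsWithin_le_nhds).and
    (self_mem_nhdsWithin : {0}ᶜ ∈ 𝓝[≠] (0 : ℝ))).exists
  rw [h t, hY] at hX
  exact (smul_right_injective E ht hX).symm

lemma lexp_smul_injective {X Y : GroupLieAlgebra I G}
    (h : ∀ t : ℝ, lexp I (t • X) = lexp I (t • Y)) : X = Y :=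
  mexp_smul_injective I h

lemma mfderiv_congr_arg (f : G → G) {z z' : G} (h : z = z') :
    (mfderiv I I f z : E →L[ℝ] E) = mfderiv I I f z' := by
  subst h; rfl

lemma mfderiv_congr_fun {f f' : G → G} (h : f = f') (z : G) :
    (mfderiv I I f z : E →L[ℝ] E) = mfderiv I I f' z := by
  subst h; rfl

lemma mdifferentiableAt_conj (a g : G) : MDifferentiableAt I I (fun x : G => a * x * a⁻¹) g :=
  MDifferentiableAt.comp (g := fun x : G => x * a⁻¹) (f := fun x : G => a * x) g
    (mdifferentiableAt_mul_right I a⁻¹ (a * g)) (mdifferentiableAt_mul_left I a g)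

lemma mfderiv_conj_mulInvariantVectorField (a g : G) (X : GroupLieAlgebra I G) :
    mfderiv I I (fun x : G => a * x * a⁻¹) g (mulInvariantVectorField X g) =
      mulInvariantVectorField (Ad I a X) (a * g * a⁻¹) := by
  have h : (fun x => a * x * a⁻¹) ∘ (fun x : G => g * x) =
      (fun x => (a * g * a⁻¹) * x) ∘ (fun x => a * x * a⁻¹) := by
    ext x; simp [mul_assoc]
  have h1 := mfderiv_comp_of_eq (I := I) (I' := I) (I'' := I) (x := (1 : G)) (y := g)
    (mdifferentiableAt_conj I a g) (mdifferentiableAt_mul_left I g 1) (mul_one g)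
  have h2 := mfderiv_comp_of_eq (I := I) (I' := I) (I'' := I) (x := (1 : G)) (y := 1)
    (mdifferentiableAt_mul_left I (a * g * a⁻¹) 1) (mdifferentiableAt_conj I a 1) (by simp)
  have e1 := mfderiv_congr_arg I (fun x : G => a * x * a⁻¹) (mul_one g)
  have e2 := mfderiv_congr_arg I (fun x : G => (a * g * a⁻¹) * x) (by simp : a * 1 * a⁻¹ = 1)
  have h3 := mfderiv_congr_fun I h 1
  have h4 : ((mfderiv I I (fun x : G => a * x * a⁻¹) g : E →L[ℝ] E).comp
      (mfderiv I I (fun x : G => g * x) 1 : E →L[ℝ] E)) =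
      (mfderiv I I (fun x : G => (a * g * a⁻¹) * x) 1 : E →L[ℝ] E).comp
      (mfderiv I I (fun x : G => a * x * a⁻¹) 1 : E →L[ℝ] E) := by
    rw [← e1, ← e2]
    exact h1.symm.trans (h3.trans h2)
  exact congrArg (fun T : E →L[ℝ] E => T X) h4

lemma lexp_Ad (a : G) (X : GroupLieAlgebra I G) : lexp I (Ad I a X) = a * lexp I X * a⁻¹ := by
  have h : IsExpCurve I (Ad I a X) (fun t => a * lexp I (t • X) * a⁻¹) := by
    refine ⟨by simp [lexp_zero], fun t => ?_⟩
    have := HasMFDerivAt.comp t (mdifferentiableAt_conj I a (lexp I (t • X))).hasMFDerivAt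
      ((isExpCurve_lexp I X).2 t)
    refine this.congr_mfderiv ?_
    ext
    change mfderiv I I (fun x : G => a * x * a⁻¹) (lexp I (t • X))
        ((1 : ℝ) • mulInvariantVectorField X _) =
      (1 : ℝ) • mulInvariantVectorField (Ad I a X) (a * lexp I (t • X) * a⁻¹)
    rw [one_smul, one_smul, mfderiv_conj_mulInvariantVectorField]
  have := h.eq_lexp I 1
  simpa using this.symm

lemma lexp_smul_Ad (a : G) (X : GroupLieAlgebra I G) (t : ℝ) :
    lexp I (t • Ad I a X) = a * lexp I (t • X) * a⁻¹ := by
  rw [← map_smul, lexp_Ad]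

lemma Ad_mul (a b : G) (X : GroupLieAlgebra I G) : Ad I (a * b) X = Ad I a (Ad I b X) := by
  refine lexp_smul_injective I fun t => ?_
  rw [lexp_smul_Ad, lexp_smul_Ad, lexp_smul_Ad]
  simp [mul_assoc]

lemma Ad_one (X : GroupLieAlgebra I G) : Ad I (1 : G) X = X := by
  refine lexp_smul_injective I fun t => ?_
  rw [lexp_smul_Ad]
  simp

lemma Ad_inv_apply_Ad (a : G) (X : GroupLieAlgebra I G) : Ad I a⁻¹ (Ad I a X) = X := by
  rw [← Ad_mul, inv_mul_cancel, Ad_one]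

lemma mfderiv_mul_right_mulInvariantVectorField (a g : G) (X : GroupLieAlgebra I G) :
    mfderiv I I (fun x : G => x * a) g (mulInvariantVectorField X g) =
      mulInvariantVectorField (Ad I a⁻¹ X) (g * a) := by
  have h : (fun x : G => x * a) = (fun x => a * x) ∘ (fun x => a⁻¹ * x * a⁻¹⁻¹) := by
    ext x; simp [mul_assoc]
  have h2 := mfderiv_comp (I := I) (I' := I) (I'' := I) g
    (mdifferentiableAt_mul_left I a (a⁻¹ * g * a⁻¹⁻¹)) (mdifferentiableAt_conj I a⁻¹ g)
  have h3 := (mfderiv_congr_fun I h g).trans h2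
  have h4 := congrArg (fun T : E →L[ℝ] E => T (mulInvariantVectorField X g)) h3
  refine h4.trans ?_
  have h5 := mfderiv_conj_mulInvariantVectorField I a⁻¹ g X
  have h6 := mfderiv_mul_left_mulInvariantVectorField I a (a⁻¹ * g * a⁻¹⁻¹) (Ad I a⁻¹ X)
  rw [← h5] at h6
  refine h6.trans ?_
  exact congrArg (fun z : G => (mulInvariantVectorField (Ad I a⁻¹ X) z : E)) (by simp [mul_assoc])

/-- The adjoint representation near the identity, in the chart at the identity. -/
lemma eventually_leftField_eq :
    ∀ᶠ g : G in 𝓝 1, ∀ Y : E, leftField I G (extChartAt I (1 : G) g) Y =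
      rightField I G (extChartAt I (1 : G) g) (mAd I g Y) := by
  have hd : ∀ᶠ z in 𝓝 (chartOne I G, chartOne I G), DifferentiableAt ℝ (locMul I G) z :=
    (((contDiffAt_locMul I G).of_le (m := 1) (by exact mod_cast le_top)).eventually
      (by simp)).mono fun z hz => hz.differentiableAt (by simp)
  have hφ : Tendsto (extChartAt I (1 : G)) (𝓝 1) (𝓝 (chartOne I G)) :=
    continuousAt_extChartAt (I := I) (1 : G)
  have h1 : ∀ᶠ g : G in 𝓝 1,
      DifferentiableAt ℝ (locMul I G) (extChartAt I (1 : G) g, chartOne I G) :=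
    (hφ.prodMk_nhds tendsto_const_nhds).eventually hd
  have h2 : ∀ᶠ g : G in 𝓝 1,
      DifferentiableAt ℝ (locMul I G) (chartOne I G, extChartAt I (1 : G) g) :=
    (tendsto_const_nhds.prodMk_nhds hφ).eventually hd
  filter_upwards [h1, h2, extChartAt_source_mem_nhds (I := I) (1 : G)] with g h1 h2 hg Y
  set φ := extChartAt I (1 : G)
  have hexp : ∀ Z : E, HasDerivAt (fun t : ℝ => chartExp I G (t • Z)) Z 0 := by
    intro Z
    have h := (hasStrictFDerivAt_chartExp I G).hasFDerivAt
    rw [← zero_smul ℝ Z] at h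
    simpa [Function.comp_def] using h.comp_hasDerivAt (0 : ℝ)
      ((hasDerivAt_id (0 : ℝ)).smul_const Z)
  have hexp0 : ∀ Z : E, chartExp I G ((0 : ℝ) • Z) = chartOne I G := by
    intro Z; rw [zero_smul, chartExp_zero]
  set W : E := mAd I g Y with hW
  have hl : HasDerivAt (fun t : ℝ => locMul I G (φ g, chartExp I G (t • Y)))
      (leftField I G (φ g) Y) 0 := by
    have h1' := h1.hasFDerivAt
    rw [← hexp0 Y] at h1'
    have := h1'.comp_hasDerivAt (0 : ℝ) ((hasDerivAt_const (0 : ℝ) (φ g)).prodMk (hexp Y))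
    refine this.congr_deriv ?_
    rw [hexp0 Y]
    simp [leftField]
  have hr : HasDerivAt (fun t : ℝ => locMul I G (chartExp I G (t • W), φ g))
      (rightField I G (φ g) W) 0 := by
    have h2' := h2.hasFDerivAt
    rw [← hexp0 W] at h2'
    have := h2'.comp_hasDerivAt (0 : ℝ) ((hexp W).prodMk (hasDerivAt_const (0 : ℝ) (φ g)))
    refine this.congr_deriv ?_
    rw [hexp0 W]
    simp [rightField]
  -- Both curves express `g exp (tY) = exp (t Ad(g) Y) g` in the chart; their derivatives at `t = 0`
  -- are the two sides.
  refine hl.unique (hr.congr_of_eventuallyEq ?_)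
  filter_upwards [(tendsto_smul_zero Y).eventually (eventually_symm_chartExp I G),
    (tendsto_smul_zero W).eventually (eventually_symm_chartExp I G)] with t e1 e2
  simp only [locMul]
  rw [e1, e2, φ.left_inv hg]
  congr 1
  have : (mexp I (t • W) : G) = g * mexp I (t • Y) * g⁻¹ :=
    lexp_smul_Ad I g (Y : GroupLieAlgebra I G) t
  rw [this]
  group

/-- The coordinate expression of the adjoint representation near the identity. -/
lemma exists_chartAd : ∃ D : E → E →L[ℝ] E,
    (∀ᶠ g : G in 𝓝 1, ∀ Y : E,
      mAd I g Y = D (extChartAt I (1 : G) g) Y) ∧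
    ∃ D' : E →L[ℝ] E →L[ℝ] E, HasFDerivAt D D' (chartOne I G) ∧ ∀ X Y,
      D' X Y = fderiv ℝ (leftField I G) (chartOne I G) X Y -
        fderiv ℝ (leftField I G) (chartOne I G) Y X := by
  set p0 := chartOne I G with hp0
  set A := leftField I G
  set B := rightField I G
  have hA : HasFDerivAt A (fderiv ℝ A p0) p0 :=
    ((contDiffAt_leftField I G).differentiableAt (by simp)).hasFDerivAt
  have hB : HasFDerivAt B (fderiv ℝ B p0) p0 :=
    ((contDiffAt_rightField I G).differentiableAt (by simp)).hasFDerivAt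
  have hA0 : A p0 = 1 := leftField_chartOne I G
  have hB0 : B p0 = 1 := rightField_chartOne I G
  have hunit : ∀ᶠ p in 𝓝 p0, IsUnit (B p) := by
    refine hB.continuousAt.eventually ?_
    rw [hB0]
    exact (1 : (E →L[ℝ] E)ˣ).nhds
  -- Solving `A = B ∘ Ad` for `Ad`, which is possible near the identity because `B` is the identity
  -- there.
  set D : E → E →L[ℝ] E := fun p => Ring.inverse (B p) * A p with hD
  have hDd : DifferentiableAt ℝ D p0 := by
    have h1 : DifferentiableAt ℝ (fun p => Ring.inverse (B p)) p0 := by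
      refine DifferentiableAt.comp (g := Ring.inverse) p0 ?_ hB.differentiableAt
      rw [hB0]
      exact differentiableAt_inverse isUnit_one
    exact h1.mul hA.differentiableAt
  have hD0 : D p0 = 1 := by simp [hD, hA0, hB0]
  refine ⟨D, ?_, fderiv ℝ D p0, hDd.hasFDerivAt, fun X Y => ?_⟩
  · have hφ : Tendsto (extChartAt I (1 : G)) (𝓝 1) (𝓝 p0) :=
      continuousAt_extChartAt (I := I) (1 : G)
    filter_upwards [eventually_leftField_eq I (G := G), hφ.eventually hunit] with g h1 h2 Y
    simp only [hD, mul_apply_eq_comp]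
    have h1Y : A (extChartAt I (1 : G) g) Y = B (extChartAt I (1 : G) g) (mAd I g Y) := h1 Y
    rw [h1Y, ← mul_apply_eq_comp, Ring.inverse_mul_cancel _ h2]
    rfl
  -- Differentiating `B D = A` at the identity gives `D' = A' - B'`, and by symmetry of second
  -- derivatives `B' X Y = A' Y X`.
  · have hprod : HasFDerivAt (fun p => (B p).comp (D p)) _ p0 := hB.clm_comp hDd.hasFDerivAt
    have heq : (fun p => (B p).comp (D p)) =ᶠ[𝓝 p0] A := by
      filter_upwards [hunit] with p hp
      change B p * (Ring.inverse (B p) * A p) = A p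
      rw [← mul_assoc, Ring.mul_inverse_cancel _ hp, one_mul]
    have h := hprod.unique (hA.congr_of_eventuallyEq heq)
    have h2 := congrArg (fun T : E →L[ℝ] E →L[ℝ] E => T X Y) h
    simp only [hB0, hD0] at h2
    simp at h2
    rw [fderiv_leftField_eq_fderiv_rightField I G X Y] at h2
    exact eq_sub_of_add_eq h2

/-- In the chart the left-invariant field of `X` is `p ↦ A(p) X`, with `A` equal to the identity at
the base point, so this is the coordinate formula for the bracket of vector fields. It agrees with
the derivative of `Ad` found in `exists_chartAd`. -/
lemma bracket_eq (X Y : E) :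
    mbracket I G X Y =
      fderiv ℝ (leftField I G) (chartOne I G) X Y -
        fderiv ℝ (leftField I G) (chartOne I G) Y X := by
  haveI : IsManifold I 1 G := IsManifold.of_le (n := ∞) (by exact mod_cast le_top)
  set p0 := chartOne I G with hp0
  set V : E → E → E := fun X => VectorField.mpullbackWithin 𝓘(ℝ, E) I (extChartAt I (1 : G)).symm
    (mulInvariantVectorField (X : GroupLieAlgebra I G)) (range I) with hV
  have hVe : ∀ X : E, V X =ᶠ[𝓝 p0] fun p => leftField I G p X := by
    intro X
    filter_upwards [eventually_mfderiv_extChartAt_mulInvariantVectorField I (G := G)]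
      with p ⟨hp, h⟩
    rw [← h X]
    simp only [hV, VectorField.mpullbackWithin]
    rw [ContinuousLinearMap.inverse_eq
      (mfderivWithin_extChartAt_symm_comp_mfderiv_extChartAt hp)
      (mfderiv_extChartAt_comp_mfderivWithin_extChartAt_symm hp)]
    rfl
  have hA : HasFDerivAt (leftField I G) (fderiv ℝ (leftField I G) p0) p0 :=
    ((contDiffAt_leftField I G).differentiableAt (by simp)).hasFDerivAt
  have hVd : ∀ X Z : E, fderiv ℝ (V X) p0 Z = fderiv ℝ (leftField I G) p0 Z X := by
    intro X Z
    rw [(hVe X).fderiv_eq, (hA.clm_apply (hasFDerivAt_const X p0)).fderiv]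
    simp
  have hV0 : ∀ X : E, V X p0 = X := by
    intro X
    refine (hVe X).self_of_nhds.trans ?_
    simp only [hp0, leftField_chartOne]
    rfl
  have key : ∀ X Y : GroupLieAlgebra I G, ⁅X, Y⁆ =
      (VectorField.lieBracketWithin ℝ (V X) (V Y)
        ((extChartAt I (1 : G)).symm ⁻¹' univ ∩ range I) p0 : E) := by
    intro X Y
    rw [GroupLieAlgebra.bracket_def, ← VectorField.mlieBracketWithin_univ,
      VectorField.mlieBracketWithin_apply, mfderiv_extChartAt_self]
    have hid : ∀ v : E, (ContinuousLinearMap.id ℝ E).inverse v = v := fun v => by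
      rw [ContinuousLinearMap.inverse_id]; rfl
    exact hid _
  have h : mbracket I G X Y = VectorField.lieBracketWithin ℝ (V X) (V Y)
        ((extChartAt I (1 : G)).symm ⁻¹' univ ∩ range I) p0 := key X Y
  rw [h, preimage_univ, univ_inter, I.range_eq_univ, VectorField.lieBracketWithin_univ,
    VectorField.lieBracket, hVd, hVd, hV0, hV0]

lemma continuousAt_Ad_one (Y : E) :
    ContinuousAt (fun g : G => mAd I g Y) 1 := by
  obtain ⟨D, hD, D', hD', -⟩ := exists_chartAd I (G := G)
  have h1 : ContinuousAt (fun g : G => D (extChartAt I (1 : G) g) Y) 1 := by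
    have h := ContinuousAt.comp (g := D) (f := extChartAt I (1 : G)) (x := (1 : G))
      hD'.continuousAt (continuousAt_extChartAt (I := I) (1 : G))
    exact h.clm_apply continuousAt_const
  exact h1.congr (hD.mono fun g hg => (hg Y).symm)

lemma continuous_Ad (Y : GroupLieAlgebra I G) : Continuous fun g : G => Ad I g Y := by
  haveI : IsTopologicalGroup G := topologicalGroup_of_lieGroup I ∞
  rw [continuous_iff_continuousAt]
  intro a
  have h1 : (fun g : G => Ad I g Y) = fun g => Ad I a (Ad I (a⁻¹ * g) Y) := by
    ext g
    rw [← Ad_mul, mul_inv_cancel_left]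
  rw [h1]
  refine (Ad I a).continuous.continuousAt.comp ?_
  have h2 : Tendsto (fun g : G => a⁻¹ * g) (𝓝 a) (𝓝 1) := by
    have : Continuous fun g : G => a⁻¹ * g := by fun_prop
    simpa using this.tendsto a
  have h3 : Tendsto (fun g : G => Ad I g Y) (𝓝 1) (𝓝 (Ad I 1 Y)) := continuousAt_Ad_one I Y
  have h4 := h3.comp h2
  rw [ContinuousAt, inv_mul_cancel]
  exact h4

lemma hasDerivAt_Ad_lexp_zero (X Y : E) :
    HasDerivAt (fun s : ℝ => mAd I (mexp I (s • X) : G) Y)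
      (mbracket I G X Y) 0 := by
  obtain ⟨D, hD, D', hD', hDD⟩ := exists_chartAd I (G := G)
  have e := (bracket_eq I (G := G) X Y).trans (hDD X Y).symm
  have hexp : HasDerivAt (fun t : ℝ => chartExp I G (t • X)) X 0 := by
    have h := (hasStrictFDerivAt_chartExp I G).hasFDerivAt
    rw [← zero_smul ℝ X] at h
    simpa [Function.comp_def] using h.comp_hasDerivAt (0 : ℝ)
      ((hasDerivAt_id (0 : ℝ)).smul_const X)
  have hD1 : HasDerivAt (fun s : ℝ => D (chartExp I G (s • X)) Y) (D' X Y) 0 := by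
    have h : HasFDerivAt D D' (chartExp I G ((0 : ℝ) • X)) := by
      rwa [zero_smul, chartExp_zero]
    have h2 := h.comp_hasDerivAt (0 : ℝ) hexp
    simpa using h2.clm_apply (hasDerivAt_const (0 : ℝ) Y)
  have e' : HasDerivAt (fun s : ℝ => D (chartExp I G (s • X)) Y)
    (mbracket I G X Y) 0 :=
    e ▸ hD1
  refine e'.congr_of_eventuallyEq ?_
  have h1 : Tendsto (fun s : ℝ => (mexp I (s • X) : G)) (𝓝 0) (𝓝 1) := by
    have := (continuous_mexp_smul I (G := G) X).tendsto 0
    simpa [mexp_zero] using this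
  filter_upwards [h1.eventually hD] with s hs
  exact hs Y

end Adjoint

/-! ### Passage between `ad` and `Ad` for invariant subspaces and fixed vectors -/

section AdjointInvariance
open Set Filter Topology Metric

variable {E : Type*} [NormedAddCommGroup E] [NormedSpace ℝ E] [FiniteDimensional ℝ E]
  [CompleteSpace E]
  {HM : Type*} [TopologicalSpace HM] (I : ModelWithCorners ℝ E HM) [I.Boundaryless]
  {G : Type*} [TopologicalSpace G] [ChartedSpace HM G] [Group G] [LieGroup I ∞ G] [T2Space G]

lemma mAd_mul (a b : G) (X : E) : mAd I (a * b) X = mAd I a (mAd I b X) := Ad_mul I a b X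

lemma hasDerivAt_mAd_mexp (X Y : E) (s : ℝ) :
    HasDerivAt (fun s : ℝ => mAd I (mexp I (s • X) : G) Y)
      (mAd I (mexp I (s • X) : G) (mbracket I G X Y)) s := by
  have h := hasDerivAt_Ad_lexp_zero I (G := G) X Y
  have h1 : HasDerivAt (fun r : ℝ => mAd I (mexp I ((r - s) • X) : G) Y) (mbracket I G X Y) s := by
    have h' : HasDerivAt (fun s : ℝ => mAd I (mexp I (s • X) : G) Y) (mbracket I G X Y) (s - s) := by
      rwa [sub_self]
    simpa [Function.comp_def] using h'.scomp (h := fun r => r - s) s ((hasDerivAt_id s).sub_const s)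
  have h2 := (mAd I (mexp I (s • X) : G)).hasFDerivAt.comp_hasDerivAt s h1
  refine h2.congr_of_eventuallyEq (Eventually.of_forall fun r => ?_)
  simp only [Function.comp]
  rw [← mAd_mul, ← mexp_add_smul, add_sub_cancel]

lemma mAd_mexp_eq_self {X Y : E} (h : mbracket I G X Y = 0) :
    mAd I (mexp I X : G) Y = Y := by
  have hd : ∀ s : ℝ, HasDerivAt (fun s : ℝ => mAd I (mexp I (s • X) : G) Y) 0 s := by
    intro s
    have := hasDerivAt_mAd_mexp I (G := G) X Y s
    rwa [h, map_zero] at this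
  have := is_const_of_deriv_eq_zero (fun s => (hd s).differentiableAt) (fun s => (hd s).deriv) 1 0
  simp only [one_smul, zero_smul, mexp_zero] at this
  rw [this]
  exact Ad_one I (G := G) Y

variable (G) in
/-- The adjoint representation of the Lie algebra on the model space. -/
def mad (X : E) : E →L[ℝ] E :=
  LinearMap.toContinuousLinearMap
    { toFun := mbracket I G X
      map_add' := lie_add (L := GroupLieAlgebra I G) (M := GroupLieAlgebra I G) X
      map_smul' := fun c Y => lie_smul (L := GroupLieAlgebra I G) (M := GroupLieAlgebra I G) c X Y }

lemma hasDerivAt_mAd_mexp_clm (X : E) (s : ℝ) :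
    HasDerivAt (fun s : ℝ => mAd I (mexp I (s • X) : G))
      ((mAd I (mexp I (s • X) : G)).comp (mad I G X)) s := by
  have hd : ∀ Y : E, Differentiable ℝ fun s : ℝ => mAd I (mexp I (s • X) : G) Y :=
    fun Y s => (hasDerivAt_mAd_mexp I (G := G) X Y s).differentiableAt
  have hC : ContDiff ℝ 1 (fun s : ℝ => mAd I (mexp I (s • X) : G)) := by
    rw [contDiff_clm_apply_iff]
    intro Y
    rw [contDiff_one_iff_deriv]
    refine ⟨hd Y, ?_⟩
    have : deriv (fun s : ℝ => mAd I (mexp I (s • X) : G) Y) =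
        fun s : ℝ => mAd I (mexp I (s • X) : G) (mbracket I G X Y) :=
      funext fun s => (hasDerivAt_mAd_mexp I (G := G) X Y s).deriv
    rw [this]
    exact (hd _).continuous
  have h := (hC.differentiable (by simp) s).hasDerivAt
  refine h.congr_deriv ?_
  ext Y
  have h2 := h.clm_apply (hasDerivAt_const s Y)
  rw [map_zero, add_zero] at h2
  exact h2.unique (hasDerivAt_mAd_mexp I (G := G) X Y s)

/-- Let `p` be a projection onto `W` and `C = ad X ∘ p`, which takes values in `W`. Then `s ↦ Ad
(exp sX) p exp (-sC)` has zero derivative, so `Ad (exp X) p = p exp C`, whose image lies in `W`. -/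
lemma mAd_mexp_mem {W : Submodule ℝ E} {X : E} (h : ∀ Y ∈ W, mbracket I G X Y ∈ W)
    {Y : E} (hY : Y ∈ W) : mAd I (mexp I X : G) Y ∈ W := by
  obtain ⟨W', hW'⟩ := W.exists_isCompl
  let p : E →L[ℝ] E := LinearMap.toContinuousLinearMap
    (W.subtype ∘ₗ W.projectionOnto W' hW')
  have hpW : ∀ v, p v ∈ W := fun v => (W.projectionOnto W' hW' v).2
  have hpe : ∀ v ∈ W, p v = v := fun v hv => by
    have := Submodule.projectionOnto_apply_left hW' ⟨v, hv⟩
    exact congrArg Subtype.val this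
  set C : E →L[ℝ] E := (mad I G X).comp p with hC
  have hpC : ∀ v, p (C v) = C v := fun v => hpe _ (h _ (hpW v))
  have hconst : ∀ s : ℝ, HasDerivAt
      (fun s : ℝ => ((mAd I (mexp I (s • X) : G)).comp p) * NormedSpace.exp (s • (-C))) 0 s := by
    intro s
    have h1 := (hasDerivAt_mAd_mexp_clm I (G := G) X s).clm_comp (hasDerivAt_const s p)
    have h2 := h1.mul (hasDerivAt_exp_smul_const' (𝕂 := ℝ) (-C) s)
    refine h2.congr_deriv ?_
    ext v
    simp only [hC, ContinuousLinearMap.comp_zero, add_zero]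
    have := hpC (NormedSpace.exp (s • (-C)) v)
    simp only [add_apply, mul_apply_eq_comp, ContinuousLinearMap.comp_apply, neg_apply, map_neg,
      zero_apply] at this ⊢
    rw [hC] at this
    simp only [ContinuousLinearMap.comp_apply] at this
    rw [this]
    simp
  have h3 := is_const_of_deriv_eq_zero (fun s => (hconst s).differentiableAt)
    (fun s => (hconst s).deriv) 1 0
  have h0 : mAd I (1 : G) = ContinuousLinearMap.id ℝ E := by
    ext v; exact Ad_one I (G := G) v
  simp only [one_smul, zero_smul, mexp_zero, NormedSpace.exp_zero, mul_one, h0] at h3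
  letI : NormedAlgebra ℚ (E →L[ℝ] E) := NormedAlgebra.restrictScalars ℚ ℝ _
  have h4 : NormedSpace.exp (-C) * NormedSpace.exp C = 1 := by
    rw [← NormedSpace.exp_add_of_commute (Commute.neg_left (Commute.refl C)), neg_add_cancel,
      NormedSpace.exp_zero]
  have h5 : (mAd I (mexp I X : G)).comp p = p * NormedSpace.exp C := by
    have := congrArg (fun T : E →L[ℝ] E => T * NormedSpace.exp C) h3
    simpa only [mul_assoc, h4, mul_one, ContinuousLinearMap.id_comp] using this
  have h6 := congrArg (fun T : E →L[ℝ] E => T Y) h5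
  simp only [ContinuousLinearMap.comp_apply, hpe Y hY] at h6
  rw [h6]
  exact hpW _

lemma mbracket_mem_of_forall_mAd_mem {W : Submodule ℝ E} {X Y : E}
    (hY : ∀ s : ℝ, mAd I (mexp I (s • X) : G) Y ∈ W) : mbracket I G X Y ∈ W := by
  have h := (hasDerivAt_Ad_lexp_zero I (G := G) X Y).tendsto_slope_zero
  refine (Submodule.closed_of_finiteDimensional W).mem_of_tendsto h (Eventually.of_forall ?_)
  intro t
  exact W.smul_mem _ (W.sub_mem (hY _) (hY _))

/-- The subgroup of elements whose adjoint action preserves a subspace. -/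
def adStab (W : Submodule ℝ (GroupLieAlgebra I G)) : Subgroup G where
  carrier := {a | (∀ Y ∈ W, Ad I a Y ∈ W) ∧ ∀ Y ∈ W, Ad I a⁻¹ Y ∈ W}
  one_mem' := by simp [Ad_one]
  mul_mem' := by
    rintro a b ⟨ha, ha'⟩ ⟨hb, hb'⟩
    refine ⟨fun Y hY => ?_, fun Y hY => ?_⟩
    · rw [Ad_mul]; exact ha _ (hb _ hY)
    · rw [mul_inv_rev, Ad_mul]; exact hb' _ (ha' _ hY)
  inv_mem' := by
    rintro a ⟨ha, ha'⟩
    exact ⟨ha', by simpa using ha⟩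

/-- The subgroup of elements whose adjoint action fixes a vector. -/
def adFix (t : GroupLieAlgebra I G) : Subgroup G where
  carrier := {a | Ad I a t = t}
  one_mem' := Ad_one I t
  mul_mem' := by
    intro a b ha hb
    change Ad I (a * b) t = t
    rw [Ad_mul, show Ad I b t = t from hb, show Ad I a t = t from ha]
  inv_mem' := by
    intro a ha
    change Ad I a⁻¹ t = t
    have ha : Ad I a t = t := ha
    rw [← ha, Ad_inv_apply_Ad, ha]

instance t2Space_groupLieAlgebra : T2Space (GroupLieAlgebra I G) := inferInstanceAs (T2Space E)

instance finiteDimensional_groupLieAlgebra : FiniteDimensional ℝ (GroupLieAlgebra I G) :=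
  inferInstanceAs (FiniteDimensional ℝ E)

lemma isClosed_adFix (t : GroupLieAlgebra I G) : IsClosed (adFix I t : Set G) :=
  isClosed_eq (continuous_Ad I t) continuous_const

/-- This is where connectedness enters: the stabilizer of `W` contains the exponentials that
generate `H`. -/
lemma Ad_mem_of_bracket_mem {H : Subgroup G} (hH : IsClosed (H : Set G))
    (hHc : IsConnected (H : Set G)) {W : Submodule ℝ (GroupLieAlgebra I G)}
    (h : ∀ X ∈ lieAlg I H, ∀ Y ∈ W, ⁅X, Y⁆ ∈ W) {a : G} (ha : a ∈ H)
    {Y : GroupLieAlgebra I G} (hY : Y ∈ W) : Ad I a Y ∈ W := by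
  have hle : H ≤ adStab I W := by
    refine le_of_forall_lexp_mem I hH hHc fun X hX => ⟨fun Y hY => ?_, fun Y hY => ?_⟩
    · exact mAd_mexp_mem I (G := G) (W := W) (h X hX) hY
    · rw [← lexp_neg]
      exact mAd_mexp_mem I (G := G) (W := W) (h (-X) ((lieAlg I H).neg_mem hX)) hY
  exact (hle ha).1 Y hY

lemma bracket_mem_of_Ad_mem {H : Subgroup G} (hH : IsClosed (H : Set G))
    {W : Submodule ℝ (GroupLieAlgebra I G)} {Y : GroupLieAlgebra I G}
    (h : ∀ a ∈ H, Ad I a Y ∈ W) {X : GroupLieAlgebra I G} (hX : X ∈ lieAlg I H) :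
    ⁅X, Y⁆ ∈ W :=
  mbracket_mem_of_forall_mAd_mem I (G := G) (W := W) fun s => h _ ((mem_lieAlg_iff I hH).1 hX s)

lemma bracket_eq_zero_iff {X Y : GroupLieAlgebra I G} :
    ⁅X, Y⁆ = 0 ↔ ∀ s : ℝ, lexp I (s • X) ∈ adFix I Y := by
  constructor
  · intro h s
    refine mAd_mexp_eq_self I (G := G) ?_
    have : ⁅s • X, Y⁆ = 0 := by rw [smul_lie, h, smul_zero]
    exact this
  · intro h
    have key : ∀ X Y : E, (∀ s : ℝ, mAd I (mexp I (s • X) : G) Y = Y) → mbracket I G X Y = 0 := by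
      intro X Y h
      have h1 := hasDerivAt_Ad_lexp_zero I (G := G) X Y
      simp only [h] at h1
      exact h1.unique (hasDerivAt_const _ _)
    exact key X Y h

/-- A vector commutes with `t` exactly when its one-parameter subgroup fixes `t`. Hence centralizers
in `𝔨` are Lie algebras of closed subgroups of `K`, to which the group-level arguments apply. -/
lemma mem_centralizerIn_iff {K : Subgroup G} (hK : IsClosed (K : Set G))
    {t X : GroupLieAlgebra I G} :
    X ∈ centralizerIn I (lieAlg I K) t ↔ X ∈ lieAlg I (K ⊓ adFix I t) := by
  have hcl : IsClosed ((K ⊓ adFix I t : Subgroup G) : Set G) := hK.inter (isClosed_adFix I t)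
  rw [mem_lieAlg_iff I hcl, centralizerIn, Submodule.mem_inf, mem_lieAlg_iff I hK,
    LinearMap.mem_ker, LieAlgebra.ad_apply, ← lie_skew, neg_eq_zero, bracket_eq_zero_iff]
  exact ⟨fun h s => ⟨h.1 s, h.2 s⟩, fun h => ⟨fun s => (h s).1, fun s => (h s).2⟩⟩

end AdjointInvariance

/-! ### Haar averages -/

section Averaging
open MeasureTheory

/-- Averaging a vector over the orbit of a compact group. -/
lemma exists_average {K : Type*} [TopologicalSpace K] [Group K] [IsTopologicalGroup K]
    [CompactSpace K] {F : Type*} [AddCommGroup F] [Module ℝ F] [FiniteDimensional ℝ F]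
    (ρ : K → F →ₗ[ℝ] F) (hρ : ∀ a b v, ρ (a * b) v = ρ a (ρ b v)) (v : F)
    (hc : ∀ ℓ : F →ₗ[ℝ] ℝ, Continuous fun k => ℓ (ρ k v)) :
    ∃ w : F, (∀ k, ρ k w = w) ∧ (∀ ℓ : F →ₗ[ℝ] ℝ, (∀ k, 0 < ℓ (ρ k v)) → 0 < ℓ w) ∧
      ∀ (ℓ : F →ₗ[ℝ] ℝ) (c : ℝ), (∀ k, ℓ (ρ k v) = c) → ℓ w = c := by
  letI : MeasurableSpace K := borel K
  haveI : BorelSpace K := ⟨rfl⟩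
  set μ : Measure K := Measure.haarMeasure (⊤ : TopologicalSpace.PositiveCompacts K) with hμ
  have hμ1 : μ Set.univ = 1 := by
    have := Measure.haarMeasure_self (K₀ := (⊤ : TopologicalSpace.PositiveCompacts K))
    simpa using this
  haveI : IsProbabilityMeasure μ := ⟨hμ1⟩
  have hint : ∀ ℓ : F →ₗ[ℝ] ℝ, Integrable (fun k => ℓ (ρ k v)) μ := fun ℓ =>
    (hc ℓ).integrable_of_hasCompactSupport (HasCompactSupport.of_compactSpace _)
  let b := Module.finBasis ℝ F
  -- The integral of the orbit is taken coordinatewise, so `F` needs no topology. Everything follows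
  -- from `ℓ w = ∫ ℓ (ρ k v)` for all functionals `ℓ`; invariance of `w` is left invariance of Haar
  -- measure.
  set w : F := ∑ i, (∫ k, b.coord i (ρ k v) ∂μ) • b i with hw
  have hℓ : ∀ ℓ : F →ₗ[ℝ] ℝ, ℓ w = ∫ k, ℓ (ρ k v) ∂μ := by
    intro ℓ
    have h1 : ∀ k, ℓ (ρ k v) = ∑ i, b.coord i (ρ k v) * ℓ (b i) := by
      intro k
      have h2 := congrArg ℓ (b.sum_repr (ρ k v))
      rw [map_sum] at h2
      simpa only [map_smul, smul_eq_mul, Module.Basis.coord_apply] using h2.symm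
    simp only [h1]
    rw [integral_finsetSum _ fun i _ => (hint (b.coord i)).mul_const _]
    simp [hw, integral_mul_const]
  refine ⟨w, fun a => ?_, fun ℓ hpos => ?_, fun ℓ c h => ?_⟩
  · refine b.ext_elem fun i => ?_
    change b.coord i (ρ a w) = b.coord i w
    have h1 := hℓ (b.coord i ∘ₗ ρ a)
    simp only [LinearMap.comp_apply, ← hρ] at h1
    rw [h1, hℓ, integral_mul_left_eq_self (fun k => b.coord i (ρ k v)) a]
  · rw [hℓ]
    refine (integral_pos_iff_support_of_nonneg (fun k => (hpos k).le) (hint ℓ)).2 ?_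
    have : Function.support (fun k => ℓ (ρ k v)) = Set.univ :=
      Set.eq_univ_of_forall fun k => (hpos k).ne'
    rw [this, hμ1]
    exact one_pos
  · rw [hℓ]
    simp [h]

end Averaging

/-! ### Differentials of homomorphisms -/

section Hom
variable {E : Type*} [NormedAddCommGroup E] [NormedSpace ℝ E] [FiniteDimensional ℝ E]
  [CompleteSpace E]
  {HM : Type*} [TopologicalSpace HM] (I : ModelWithCorners ℝ E HM) [I.Boundaryless]
  {G : Type*} [TopologicalSpace G] [ChartedSpace HM G] [Group G] [LieGroup I ∞ G] [T2Space G]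
  {E' : Type*} [NormedAddCommGroup E'] [NormedSpace ℝ E'] [FiniteDimensional ℝ E']
  [CompleteSpace E']
  {HM' : Type*} [TopologicalSpace HM'] (I' : ModelWithCorners ℝ E' HM') [I'.Boundaryless]
  {G' : Type*} [TopologicalSpace G'] [ChartedSpace HM' G'] [Group G'] [LieGroup I' ∞ G']
  [T2Space G']

/-- The differential at the identity of a homomorphism. -/
def lieMap (f : G →* G') : GroupLieAlgebra I G →L[ℝ] GroupLieAlgebra I' G' :=
  (mfderiv I I' f 1 : E →L[ℝ] E')

lemma mfderiv_hom_mulInvariantVectorField (f : G →* G') (hf : MDifferentiable I I' f)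
    (g : G) (X : GroupLieAlgebra I G) :
    (mfderiv I I' f g (mulInvariantVectorField X g) : E') =
      mulInvariantVectorField (I := I') (lieMap I I' f X) (f g) := by
  have h : f ∘ (fun x : G => g * x) = (fun x => f g * x) ∘ f := by
    ext x; simp
  have h1 := mfderiv_comp_of_eq (I := I) (I' := I) (I'' := I') (x := (1 : G)) (y := g)
    (hf g) (mdifferentiableAt_mul_left I g 1) (mul_one g)
  have h2 := mfderiv_comp_of_eq (I := I) (I' := I') (I'' := I') (x := (1 : G)) (y := 1)
    (mdifferentiableAt_mul_left I' (f g) 1) (hf 1) (map_one f)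
  have e0 : ∀ (F : G → G') {z z' : G}, z = z' →
      (mfderiv I I' F z : E →L[ℝ] E') = mfderiv I I' F z' := by rintro F z _ rfl; rfl
  have e1 := e0 f (mul_one g)
  have e2 := mfderiv_congr_arg I' (fun x : G' => f g * x) (map_one f)
  have e3 : ∀ F F' : G → G', F = F' →
      (mfderiv I I' F 1 : E →L[ℝ] E') = mfderiv I I' F' 1 := by rintro F _ rfl; rfl
  have h4 : ((mfderiv I I' f g : E →L[ℝ] E').comp
      (mfderiv I I (fun x : G => g * x) 1 : E →L[ℝ] E)) =
      (mfderiv I' I' (fun x : G' => f g * x) 1 : E' →L[ℝ] E').comp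
      (mfderiv I I' f 1 : E →L[ℝ] E') := by
    rw [← e1, ← e2]
    exact h1.symm.trans ((e3 _ _ h).trans h2)
  exact congrArg (fun T : E →L[ℝ] E' => T X) h4

lemma lexp_lieMap (f : G →* G') (hf : MDifferentiable I I' f) (X : GroupLieAlgebra I G) :
    lexp I' (lieMap I I' f X) = f (lexp I X) := by
  have h : IsExpCurve I' (lieMap I I' f X) (fun t => f (lexp I (t • X))) := by
    refine ⟨by simp [lexp_zero], fun t => ?_⟩
    have := HasMFDerivAt.comp t (hf (lexp I (t • X))).hasMFDerivAt ((isExpCurve_lexp I X).2 t)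
    refine this.congr_mfderiv ?_
    ext
    change (mfderiv I I' f (lexp I (t • X)) ((1 : ℝ) • mulInvariantVectorField X _) : E') =
      (1 : ℝ) • mulInvariantVectorField (I := I') (lieMap I I' f X) (f (lexp I (t • X)))
    rw [one_smul, one_smul, ← mfderiv_hom_mulInvariantVectorField I I' f hf]
  have := h.eq_lexp I' 1
  simpa using this.symm

end Hom

/-! ### The Lie algebra of a product group -/

section Product
variable {E₁ : Type*} [NormedAddCommGroup E₁] [NormedSpace ℝ E₁] [FiniteDimensional ℝ E₁]
  [CompleteSpace E₁]
  {E₂ : Type*} [NormedAddCommGroup E₂] [NormedSpace ℝ E₂] [FiniteDimensional ℝ E₂]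
  [CompleteSpace E₂]
  {HM₁ : Type*} [TopologicalSpace HM₁] (I₁ : ModelWithCorners ℝ E₁ HM₁) [I₁.Boundaryless]
  {HM₂ : Type*} [TopologicalSpace HM₂] (I₂ : ModelWithCorners ℝ E₂ HM₂) [I₂.Boundaryless]
  (G₁ : Type*) [TopologicalSpace G₁] [ChartedSpace HM₁ G₁] [Group G₁] [LieGroup I₁ ∞ G₁]
  [T2Space G₁]
  (G₂ : Type*) [TopologicalSpace G₂] [ChartedSpace HM₂ G₂] [Group G₂] [LieGroup I₂ ∞ G₂]
  [T2Space G₂]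

/-- The projection of the Lie algebra of a product to the first factor. -/
def proj₁ : GroupLieAlgebra (I₁.prod I₂) (G₁ × G₂) →L[ℝ] GroupLieAlgebra I₁ G₁ :=
  ContinuousLinearMap.fst ℝ E₁ E₂

/-- The projection of the Lie algebra of a product to the second factor. -/
def proj₂ : GroupLieAlgebra (I₁.prod I₂) (G₁ × G₂) →L[ℝ] GroupLieAlgebra I₂ G₂ :=
  ContinuousLinearMap.snd ℝ E₁ E₂

lemma incl₁_eq : (incl₁ I₁ I₂ G₁ G₂ : E₁ →L[ℝ] E₁ × E₂) = ContinuousLinearMap.inl ℝ E₁ E₂ := by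
  have h := (hasMFDerivAt_id (I := I₁) (1 : G₁)).prodMk (hasMFDerivAt_const (I' := I₂) (1 : G₂) (1 : G₁))
  exact h.mfderiv

lemma incl₂_eq : (incl₂ I₁ I₂ G₁ G₂ : E₂ →L[ℝ] E₁ × E₂) = ContinuousLinearMap.inr ℝ E₁ E₂ := by
  have h := (hasMFDerivAt_const (I' := I₁) (1 : G₁) (1 : G₂)).prodMk (hasMFDerivAt_id (I := I₂) (1 : G₂))
  exact h.mfderiv

lemma lieMap_fst : lieMap (I₁.prod I₂) I₁ (MonoidHom.fst G₁ G₂) = proj₁ I₁ I₂ G₁ G₂ :=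
  mfderiv_fst (x := (1 : G₁ × G₂))

lemma lieMap_snd : lieMap (I₁.prod I₂) I₂ (MonoidHom.snd G₁ G₂) = proj₂ I₁ I₂ G₁ G₂ :=
  mfderiv_snd (x := (1 : G₁ × G₂))

lemma proj₁_incl₁ (X : GroupLieAlgebra I₁ G₁) : proj₁ I₁ I₂ G₁ G₂ (incl₁ I₁ I₂ G₁ G₂ X) = X :=
  congrArg (fun T : E₁ →L[ℝ] E₁ × E₂ => (T X).1) (incl₁_eq I₁ I₂ G₁ G₂)

lemma proj₂_incl₁ (X : GroupLieAlgebra I₁ G₁) : proj₂ I₁ I₂ G₁ G₂ (incl₁ I₁ I₂ G₁ G₂ X) = 0 :=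
  congrArg (fun T : E₁ →L[ℝ] E₁ × E₂ => (T X).2) (incl₁_eq I₁ I₂ G₁ G₂)

lemma proj₁_incl₂ (X : GroupLieAlgebra I₂ G₂) : proj₁ I₁ I₂ G₁ G₂ (incl₂ I₁ I₂ G₁ G₂ X) = 0 :=
  congrArg (fun T : E₂ →L[ℝ] E₁ × E₂ => (T X).1) (incl₂_eq I₁ I₂ G₁ G₂)

lemma proj₂_incl₂ (X : GroupLieAlgebra I₂ G₂) : proj₂ I₁ I₂ G₁ G₂ (incl₂ I₁ I₂ G₁ G₂ X) = X :=
  congrArg (fun T : E₂ →L[ℝ] E₁ × E₂ => (T X).2) (incl₂_eq I₁ I₂ G₁ G₂)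

variable {G₁ G₂}

lemma ext_proj {X Y : GroupLieAlgebra (I₁.prod I₂) (G₁ × G₂)}
    (h1 : proj₁ I₁ I₂ G₁ G₂ X = proj₁ I₁ I₂ G₁ G₂ Y)
    (h2 : proj₂ I₁ I₂ G₁ G₂ X = proj₂ I₁ I₂ G₁ G₂ Y) : X = Y :=
  Prod.ext (α := E₁) (β := E₂) h1 h2

lemma incl_add_incl (X : GroupLieAlgebra (I₁.prod I₂) (G₁ × G₂)) :
    incl₁ I₁ I₂ G₁ G₂ (proj₁ I₁ I₂ G₁ G₂ X) + incl₂ I₁ I₂ G₁ G₂ (proj₂ I₁ I₂ G₁ G₂ X) = X := by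
  refine ext_proj I₁ I₂ ?_ ?_
  · rw [map_add, proj₁_incl₁, proj₁_incl₂, add_zero]
  · rw [map_add, proj₂_incl₁, proj₂_incl₂, zero_add]

lemma lexp_proj₁ (X : GroupLieAlgebra (I₁.prod I₂) (G₁ × G₂)) :
    lexp I₁ (proj₁ I₁ I₂ G₁ G₂ X) = (lexp (I₁.prod I₂) X).1 := by
  rw [← lieMap_fst]
  exact lexp_lieMap (I₁.prod I₂) I₁ (MonoidHom.fst G₁ G₂)
    (fun x => mdifferentiableAt_fst (x := x)) X

lemma lexp_proj₂ (X : GroupLieAlgebra (I₁.prod I₂) (G₁ × G₂)) :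
    lexp I₂ (proj₂ I₁ I₂ G₁ G₂ X) = (lexp (I₁.prod I₂) X).2 := by
  rw [← lieMap_snd]
  exact lexp_lieMap (I₁.prod I₂) I₂ (MonoidHom.snd G₁ G₂)
    (fun x => mdifferentiableAt_snd (x := x)) X

lemma proj₁_Ad (a : G₁ × G₂) (X : GroupLieAlgebra (I₁.prod I₂) (G₁ × G₂)) :
    proj₁ I₁ I₂ G₁ G₂ (Ad (I₁.prod I₂) a X) = Ad I₁ a.1 (proj₁ I₁ I₂ G₁ G₂ X) := by
  refine lexp_smul_injective I₁ fun t => ?_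
  rw [← map_smul, lexp_proj₁, lexp_smul_Ad, lexp_smul_Ad, ← map_smul, lexp_proj₁]
  rfl

lemma proj₂_Ad (a : G₁ × G₂) (X : GroupLieAlgebra (I₁.prod I₂) (G₁ × G₂)) :
    proj₂ I₁ I₂ G₁ G₂ (Ad (I₁.prod I₂) a X) = Ad I₂ a.2 (proj₂ I₁ I₂ G₁ G₂ X) := by
  refine lexp_smul_injective I₂ fun t => ?_
  rw [← map_smul, lexp_proj₂, lexp_smul_Ad, lexp_smul_Ad, ← map_smul, lexp_proj₂]
  rfl

lemma Ad_incl₁ (a : G₁ × G₂) (X : GroupLieAlgebra I₁ G₁) :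
    Ad (I₁.prod I₂) a (incl₁ I₁ I₂ G₁ G₂ X) = incl₁ I₁ I₂ G₁ G₂ (Ad I₁ a.1 X) := by
  refine ext_proj I₁ I₂ ?_ ?_
  · rw [proj₁_Ad, proj₁_incl₁, proj₁_incl₁]
  · rw [proj₂_Ad, proj₂_incl₁, proj₂_incl₁, map_zero]

lemma Ad_incl₂ (a : G₁ × G₂) (X : GroupLieAlgebra I₂ G₂) :
    Ad (I₁.prod I₂) a (incl₂ I₁ I₂ G₁ G₂ X) = incl₂ I₁ I₂ G₁ G₂ (Ad I₂ a.2 X) := by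
  refine ext_proj I₁ I₂ ?_ ?_
  · rw [proj₁_Ad, proj₁_incl₂, proj₁_incl₂, map_zero]
  · rw [proj₂_Ad, proj₂_incl₂, proj₂_incl₂]

lemma mem_lieAlg_prod {H₁ : Subgroup G₁} {H₂ : Subgroup G₂} (h1 : IsClosed (H₁ : Set G₁))
    (h2 : IsClosed (H₂ : Set G₂)) {X : GroupLieAlgebra (I₁.prod I₂) (G₁ × G₂)} :
    X ∈ lieAlg (I₁.prod I₂) (H₁.prod H₂) ↔
      proj₁ I₁ I₂ G₁ G₂ X ∈ lieAlg I₁ H₁ ∧ proj₂ I₁ I₂ G₁ G₂ X ∈ lieAlg I₂ H₂ := by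
  have hcl : IsClosed ((H₁.prod H₂ : Subgroup (G₁ × G₂)) : Set (G₁ × G₂)) := by
    rw [Subgroup.coe_prod]; exact h1.prod h2
  rw [mem_lieAlg_iff _ hcl, mem_lieAlg_iff _ h1, mem_lieAlg_iff _ h2, ← forall_and]
  refine forall_congr' fun t => ?_
  rw [← map_smul, ← map_smul, lexp_proj₁, lexp_proj₂, Subgroup.mem_prod]

lemma incl₁_mem_lieAlg_iff {H : Subgroup (G₁ × G₂)} (hH : IsClosed (H : Set (G₁ × G₂)))
    {X : GroupLieAlgebra I₁ G₁} : incl₁ I₁ I₂ G₁ G₂ X ∈ lieAlg (I₁.prod I₂) H ↔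
      ∀ t : ℝ, (lexp I₁ (t • X), (1 : G₂)) ∈ H := by
  rw [mem_lieAlg_iff _ hH]
  refine forall_congr' fun t => ?_
  have : lexp (I₁.prod I₂) (t • incl₁ I₁ I₂ G₁ G₂ X) = (lexp I₁ (t • X), (1 : G₂)) := by
    refine Prod.ext ?_ ?_
    · rw [← lexp_proj₁, map_smul, proj₁_incl₁]
    · rw [← lexp_proj₂, map_smul, proj₂_incl₁, smul_zero, lexp_zero]
  rw [this]

lemma incl₂_mem_lieAlg_iff {H : Subgroup (G₁ × G₂)} (hH : IsClosed (H : Set (G₁ × G₂)))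
    {X : GroupLieAlgebra I₂ G₂} : incl₂ I₁ I₂ G₁ G₂ X ∈ lieAlg (I₁.prod I₂) H ↔
      ∀ t : ℝ, ((1 : G₁), lexp I₂ (t • X)) ∈ H := by
  rw [mem_lieAlg_iff _ hH]
  refine forall_congr' fun t => ?_
  have : lexp (I₁.prod I₂) (t • incl₂ I₁ I₂ G₁ G₂ X) = ((1 : G₁), lexp I₂ (t • X)) := by
    refine Prod.ext ?_ ?_
    · rw [← lexp_proj₁, map_smul, proj₁_incl₂, smul_zero, lexp_zero]
    · rw [← lexp_proj₂, map_smul, proj₂_incl₂]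
  rw [this]

end Product

/-! ### Characters from finite-dimensional unitary representations -/

section Representation
variable {A : Type*} [TopologicalSpace A] [Group A]
  {V : Type*} [NormedAddCommGroup V] [InnerProductSpace ℂ V]

/-- The determinant of a finite-dimensional unitary representation on an invariant subspace, as a
continuous character. -/
lemma exists_det_character (U : A →* (V →ₗᵢ[ℂ] V)) (hU : ∀ v, Continuous fun a => U a v)
    (W : Submodule ℂ V) [FiniteDimensional ℂ W] (hW : ∀ a, ∀ v ∈ W, U a v ∈ W) :
    ∃ χ : A →* Circle, Continuous χ ∧ ∀ (a : A) (z : ℂ), (∀ v ∈ W, U a v = z • v) →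
      (χ a : ℂ) = z ^ Module.finrank ℂ W := by
  let ρ : A →* Module.End ℂ W :=
    { toFun := fun a => (U a).toLinearMap.restrict (hW a)
      map_one' := by ext v; simp
      map_mul' := fun a b => by ext v; simp }
  have hρ : ∀ a (v : W), ((ρ a v : W) : V) = U a v := fun a v => rfl
  have hnorm : ∀ a, ‖LinearMap.det (ρ a)‖ = 1 := by
    intro a
    let L : W →ₗᵢ[ℂ] W := ⟨ρ a, fun v => (U a).norm_map v⟩
    have := LinearMap.normDet_eq_norm_det (ρ a)
    rw [← this]
    exact L.normDet_eq_one
  have hcont : Continuous fun a => LinearMap.det (ρ a) := by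
    let b := Module.finBasis ℂ W
    have : ∀ a, LinearMap.det (ρ a) = (LinearMap.toMatrix b b (ρ a)).det := fun a =>
      (LinearMap.det_toMatrix b (ρ a)).symm
    simp only [this]
    refine Continuous.matrix_det ?_
    refine continuous_matrix fun i j => ?_
    simp only [LinearMap.toMatrix_apply]
    have h1 : Continuous fun w : W => b.repr w i := (b.coord i).continuous_of_finiteDimensional
    exact h1.comp (continuous_induced_rng.2 (hU (b j)))
  let χ : A →* Circle :=
    { toFun := fun a => ⟨LinearMap.det (ρ a), by simpa [Submonoid.unitSphere] using hnorm a⟩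
      map_one' := by ext; simp
      map_mul' := fun a b => Circle.ext
        ((congrArg LinearMap.det (map_mul ρ a b)).trans (LinearMap.det.map_mul _ _)) }
  refine ⟨χ, continuous_induced_rng.2 hcont, fun a z h => ?_⟩
  have : ρ a = z • 1 := by
    ext v
    exact h v v.2
  change LinearMap.det (ρ a) = _
  rw [this, LinearMap.det_smul]
  simp

/-- If every `c s` is scalar on `W`, the determinant is the required character. Otherwise some
central `c s` has a proper nonzero eigenspace; it and its orthogonal complement are invariant of
smaller dimension, and `c` acts nontrivially on one of them. -/
lemma exists_character_of_representation (U : A →* (V →ₗᵢ[ℂ] V))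
    (hU : ∀ v, Continuous fun a => U a v) (c : ℝ → A) (hc : ∀ s t, c (s + t) = c s * c t)
    (hcen : ∀ s a, c s * a = a * c s) (W : Submodule ℂ V) [hfd : FiniteDimensional ℂ W]
    (hW : ∀ a, ∀ v ∈ W, U a v ∈ W) (hne : ∃ s, ∃ v ∈ W, U (c s) v ≠ v) :
    ∃ χ : A →* Circle, Continuous χ ∧ ∃ s, χ (c s) ≠ 1 := by
  have hmul : ∀ a b v, U (a * b) v = U a (U b v) := fun a b v => by rw [map_mul]; rfl
  induction hn : Module.finrank ℂ W using Nat.strong_induction_on generalizing W with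
  | _ n ih =>
  by_cases hs : ∀ s, ∃ z : ℂ, ∀ v ∈ W, U (c s) v = z • v
  · choose z hz using hs
    obtain ⟨χ, hχ, hdet⟩ := exists_det_character U hU W hW
    refine ⟨χ, hχ, ?_⟩
    by_contra! hall
    obtain ⟨s, v, hv, hne⟩ := hne
    have hd : Module.finrank ℂ W ≠ 0 := by
      intro h0
      have : W = ⊥ := Submodule.finrank_eq_zero.1 h0
      rw [this, Submodule.mem_bot] at hv
      exact hne (by rw [hv, map_zero])
    set d := Module.finrank ℂ W with hd'
    have hpow : ∀ (t : ℝ) (k : ℕ), c (k * t) = c t ^ k := by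
      intro t k
      induction k with
      | zero =>
        have := hc 0 0
        rw [add_zero] at this
        simpa using (mul_eq_left.1 this.symm)
      | succ k ih => rw [pow_succ, ← ih, ← hc]; push_cast; ring_nf
    have h1 : ∀ t (k : ℕ), U (c t ^ k) v = z t ^ k • v := by
      intro t k
      induction k with
      | zero => simp
      | succ k ih =>
        rw [pow_succ', map_mul, LinearIsometry.coe_mul, Function.comp_apply, ih, map_smul, hz t v hv, smul_smul,
          pow_succ]
    -- The determinant only sees `z ^ d`. Evaluating at `s / d` makes this the scalar by which `c s
    -- = c (s / d) ^ d` acts.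
    have h2 := h1 (s / d) d
    rw [← hpow, mul_div_cancel₀ s (by exact_mod_cast hd), ← hdet _ _ (hz (s / d)), hall] at h2
    exact hne (by simpa using h2)
  · push Not at hs
    obtain ⟨s, hs⟩ := hs
    haveI : Nontrivial W := by
      obtain ⟨t, v, hv, hne⟩ := hne
      refine ⟨⟨v, hv⟩, 0, fun h => hne ?_⟩
      have : v = 0 := congrArg Subtype.val h
      rw [this, map_zero]
    obtain ⟨z, hz⟩ := Module.End.exists_eigenvalue ((U (c s)).toLinearMap.restrict (hW (c s)))
    obtain ⟨e, he⟩ := hz.exists_hasEigenvector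
    have he1 : U (c s) e = z • (e : V) := congrArg Subtype.val he.apply_eq_smul
    have he0 : (e : V) ≠ 0 := fun h => he.2 (Subtype.ext h)
    set F : Submodule ℂ V := W ⊓ LinearMap.eqLocus (U (c s)).toLinearMap (z • LinearMap.id) with hF
    have hmemF : ∀ v, v ∈ F ↔ v ∈ W ∧ U (c s) v = z • v := fun v => Iff.rfl
    have hFW : F ≤ W := inf_le_left
    haveI : FiniteDimensional ℂ F := Submodule.finiteDimensional_of_le hFW
    have hFinv : ∀ a, ∀ v ∈ F, U a v ∈ F := by
      intro a v hv
      rw [hmemF] at hv ⊢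
      refine ⟨hW a v hv.1, ?_⟩
      rw [← hmul, hcen, hmul, hv.2, map_smul]
    set F' : Submodule ℂ V := Fᗮ ⊓ W with hF'
    haveI : FiniteDimensional ℂ F' := Submodule.finiteDimensional_of_le (inf_le_right : F' ≤ W)
    have hF'inv : ∀ a, ∀ v ∈ F', U a v ∈ F' := by
      intro a v hv
      refine ⟨?_, hW a v hv.2⟩
      rw [SetLike.mem_coe, Submodule.mem_orthogonal]
      intro w hw
      have h1 : U a (U a⁻¹ w) = w := by
        rw [← hmul, mul_inv_cancel, map_one]; rfl
      rw [← h1, LinearIsometry.inner_map_map]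
      exact (Submodule.mem_orthogonal _ _).1 hv.1 _ (hFinv _ _ hw)
    have hlt : Module.finrank ℂ F < n := by
      rw [← hn]
      refine Submodule.finrank_lt_finrank_of_lt (lt_of_le_of_ne hFW fun h => ?_)
      obtain ⟨v, hv, hvne⟩ := hs z
      rw [← h] at hv
      exact hvne ((hmemF v).1 hv).2
    have hlt' : Module.finrank ℂ F' < n := by
      rw [← hn]
      refine Submodule.finrank_lt_finrank_of_lt (lt_of_le_of_ne inf_le_right fun h => ?_)
      have h1 : (e : V) ∈ F' := by rw [h]; exact e.2
      have h2 := (Submodule.mem_orthogonal _ _).1 h1.1 e ((hmemF _).2 ⟨e.2, he1⟩)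
      exact he0 (inner_self_eq_zero.1 h2)
    by_cases h1 : ∃ t, ∃ v ∈ F, U (c t) v ≠ v
    · exact ih _ hlt F hFinv h1 rfl
    by_cases h2 : ∃ t, ∃ v ∈ F', U (c t) v ≠ v
    · exact ih _ hlt' F' hF'inv h2 rfl
    push Not at h1 h2
    obtain ⟨t, v, hv, hvne⟩ := hne
    rw [← Submodule.sup_orthogonal_inf_of_hasOrthogonalProjection hFW, Submodule.mem_sup] at hv
    obtain ⟨x, hx, y, hy, rfl⟩ := hv
    exact absurd (by rw [map_add, h1 t x hx, h2 t y hy]) hvne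

end Representation

/-! ### Compactness of coefficient operators -/

section CompactOperator
open scoped BoundedContinuousFunction
variable {A : Type*} [TopologicalSpace A] [CompactSpace A]
  {V : Type*} [NormedAddCommGroup V] [InnerProductSpace ℂ V]

/-- The operator sending a vector to its coefficients along a continuous family of vectors. -/
def coeffOp (κ : C(A, V)) : V →L[ℂ] (A →ᵇ ℂ) :=
  LinearMap.mkContinuous
    { toFun := fun f => BoundedContinuousFunction.mkOfCompact
        ⟨fun x => inner ℂ (κ x) f, κ.continuous.inner continuous_const⟩
      map_add' := fun f g => by ext x; simp
      map_smul' := fun z f => by ext x; simp } ‖κ‖ (by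
    intro f
    refine (BoundedContinuousFunction.norm_le (by positivity)).2 fun x => ?_
    exact (norm_inner_le_norm _ _).trans
      (mul_le_mul_of_nonneg_right (κ.norm_coe_le_norm x) (norm_nonneg _)))

/-- Arzelà–Ascoli: for `‖f‖ ≤ 1` the coefficients `x ↦ ⟪κ x, f⟫` are bounded by `‖κ‖` and inherit
the modulus of continuity of `κ`. -/
lemma isCompactOperator_coeffOp (κ : C(A, V)) : IsCompactOperator (coeffOp κ) := by
  refine (isCompactOperator_iff_isCompact_closure_image_closedBall (coeffOp κ).toLinearMap
    one_pos).2 ?_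
  refine BoundedContinuousFunction.arzela_ascoli (Metric.closedBall (0 : ℂ) ‖κ‖)
    (isCompact_closedBall _ _) _ ?_ ?_
  · rintro _ x ⟨f, hf, rfl⟩
    rw [mem_closedBall_zero_iff] at hf ⊢
    refine (norm_inner_le_norm _ _).trans ?_
    calc ‖κ x‖ * ‖f‖ ≤ ‖κ‖ * 1 := mul_le_mul (κ.norm_coe_le_norm x) hf (norm_nonneg _)
          (norm_nonneg _)
      _ = ‖κ‖ := mul_one _
  · intro x
    rw [Metric.equicontinuousAt_iff_right]
    intro ε hε
    have := Metric.tendsto_nhds.1 (κ.continuous.tendsto x) ε hε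
    filter_upwards [this] with y hy
    rintro ⟨_, f, hf, rfl⟩
    rw [mem_closedBall_zero_iff] at hf
    refine lt_of_le_of_lt ?_ hy
    rw [dist_comm (κ y), dist_eq_norm, dist_eq_norm]
    change ‖inner ℂ (κ x) f - inner ℂ (κ y) f‖ ≤ _
    rw [← inner_sub_left]
    refine (norm_inner_le_norm _ _).trans ?_
    exact mul_le_of_le_one_right (norm_nonneg _) hf

end CompactOperator

/-! ### Peter–Weyl: characters detect central one-parameter subgroups -/

section PeterWeyl
open MeasureTheory
open scoped BoundedContinuousFunction ENNReal
variable {V : Type*} [NormedAddCommGroup V] [InnerProductSpace ℂ V] [CompleteSpace V]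

/-- An isometry commuting with `S† S` for a compact operator `S` and fixing all the eigenvectors
with nonzero eigenvalues does not change the values of `S`. -/
lemma apply_eq_of_forall_eigenspace {S : V →L[ℂ] V} (hS : IsCompactOperator S) {U : V →L[ℂ] V}
    (hU : ∀ z : ℂ, z ≠ 0 → ∀ v, (S.adjoint ∘L S) v = z • v → U v = v)
    (hcomm : ∀ v, (S.adjoint ∘L S) (U v) = U ((S.adjoint ∘L S) v)) (f : V) : S (U f) = S f := by
  set T := S.adjoint ∘L S with hT
  have hTc : IsCompactOperator T := hS.clm_comp (ContinuousLinearMap.adjoint S)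
  have hTs : T.IsSymmetric := by
    intro x y
    change inner ℂ (S.adjoint (S x)) y = inner ℂ x (S.adjoint (S y))
    rw [ContinuousLinearMap.adjoint_inner_left, ContinuousLinearMap.adjoint_inner_right]
  have h1 := ContinuousLinearMap.orthogonalComplement_iSup_eigenspaces_eq_bot hTc hTs
  -- `U T = T` holds on each eigenspace, trivially on the kernel of `T`, hence everywhere by
  -- density. Then `T (U f - f) = 0`, and `‖S (U f - f)‖² = ⟪T (U f - f), U f - f⟫` vanishes.
  have h2 : (⨆ z, Module.End.eigenspace (T : Module.End ℂ V) z) ≤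
      LinearMap.eqLocus (U ∘L T).toLinearMap T.toLinearMap := by
    refine iSup_le fun z v hv => ?_
    have hv' : T v = z • v := Module.End.mem_eigenspace_iff.1 hv
    change U (T v) = T v
    rw [hv', map_smul]
    by_cases hz : z = 0
    · rw [hz, zero_smul, zero_smul]
    · rw [hU z hz v hv']
  have h3 : U (T f) = T f := by
    have hd : (⨆ z, Module.End.eigenspace (T : Module.End ℂ V) z).topologicalClosure = ⊤ :=
      (Submodule.topologicalClosure_eq_top_iff).2 h1
    have hcl : IsClosed (LinearMap.eqLocus (U ∘L T).toLinearMap T.toLinearMap : Set V) :=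
      isClosed_eq (U ∘L T).continuous T.continuous
    have := Submodule.topologicalClosure_minimal _ h2 hcl
    rw [hd] at this
    exact this (Submodule.mem_top : f ∈ ⊤)
  have h4 : T (U f - f) = 0 := by rw [map_sub, hcomm, h3, sub_self]
  have h5 : inner ℂ (S (U f - f)) (S (U f - f)) = (0 : ℂ) := by
    rw [← ContinuousLinearMap.adjoint_inner_left]
    change inner ℂ (T (U f - f)) _ = _
    rw [h4, inner_zero_left]
  rw [inner_self_eq_zero, map_sub, sub_eq_zero] at h5
  exact h5

variable {A : Type*} [TopologicalSpace A] [Group A] [IsTopologicalGroup A] [CompactSpace A]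

/-- A unitary representation of a compact group which contains the continuous functions on the
group detects central one-parameter subgroups by characters. -/
lemma exists_character_of_regular (U : A →* (V →ₗᵢ[ℂ] V)) (hU : ∀ v, Continuous fun a => U a v)
    (J : (A →ᵇ ℂ) →L[ℂ] V) (hJ : Function.Injective J)
    (hJU : ∀ (a : A) (F F' : A →ᵇ ℂ), (∀ x, F' x = F (a⁻¹ * x)) → J F' = U a (J F))
    (c : ℝ → A) (hc : ∀ s t, c (s + t) = c s * c t) (hcen : ∀ s a, c s * a = a * c s)
    (hne : ∃ s f, U (c s) f ≠ f) : ∃ χ : A →* Circle, Continuous χ ∧ ∃ s, χ (c s) ≠ 1 := by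
  have hmul : ∀ a b v, U (a * b) v = U a (U b v) := fun a b v => by rw [map_mul]; rfl
  have hone : ∀ v, U 1 v = v := fun v => by rw [map_one]; rfl
  have hinv : ∀ a v, U a (U a⁻¹ v) = v := fun a v => by rw [← hmul, mul_inv_cancel, hone]
  have hin : ∀ a v w, inner ℂ (U a v) w = inner ℂ v (U a⁻¹ w) := fun a v w => by
    rw [← (U a).inner_map_map v, hinv]
  obtain ⟨s, f, hf⟩ := hne
  by_contra! hno
  -- For each `φ` the operator `S f = J (x ↦ ⟪U x φ, f⟫)` is compact and equivariant, so the nonzero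
  -- eigenspaces of `S† S` are finite-dimensional subrepresentations. If no character sees `c`, then
  -- `U (c s)` is the identity on all of them and `S (U (c s) f) = S f`; evaluation at `x = 1` gives
  -- equality of the inner products with `φ`.
  refine hf (ext_inner_left ℂ fun φ => ?_)
  set κ : C(A, V) := ⟨fun x => U x φ, hU φ⟩ with hκ
  set S : V →L[ℂ] V := J ∘L coeffOp κ with hS
  have hSc : IsCompactOperator S := (isCompactOperator_coeffOp κ).clm_comp J
  have hSU : ∀ a v, S (U a v) = U a (S v) := by
    intro a v
    refine hJU a _ _ fun x => ?_
    change inner ℂ (U x φ) (U a v) = inner ℂ (U (a⁻¹ * x) φ) v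
    rw [hmul, hin a⁻¹, inv_inv]
  have hTU : ∀ a v, (S.adjoint ∘L S) (U a v) = U a ((S.adjoint ∘L S) v) := by
    intro a v
    refine ext_inner_right ℂ fun w => ?_
    change inner ℂ (S.adjoint (S (U a v))) w = inner ℂ (U a (S.adjoint (S v))) w
    rw [hSU, hin, ContinuousLinearMap.adjoint_inner_left, ContinuousLinearMap.adjoint_inner_left,
      hin, hSU]
  have h1 : S (U (c s) f) = S f := by
    refine apply_eq_of_forall_eigenspace (U := (U (c s)).toContinuousLinearMap) hSc
      (fun z hz v hv => ?_) (hTU (c s)) f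
    by_contra hvne
    haveI : FiniteDimensional ℂ (Module.End.eigenspace (S.adjoint ∘L S).toLinearMap z) :=
      ContinuousLinearMap.finite_dimensional_eigenspace
        (hSc.clm_comp (ContinuousLinearMap.adjoint S)) z hz
    obtain ⟨χ, hχ, t, ht⟩ := exists_character_of_representation U hU c hc hcen
      (Module.End.eigenspace (S.adjoint ∘L S).toLinearMap z) (fun a w hw => by
        rw [Module.End.mem_eigenspace_iff] at hw ⊢
        exact (hTU a w).trans ((congrArg (U a) hw).trans (map_smul _ _ _)))
      ⟨s, v, Module.End.mem_eigenspace_iff.2 hv, hvne⟩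
    exact ht (hno χ hχ t)
  have h2 := congrArg (fun F : A →ᵇ ℂ => F 1) (hJ h1)
  have h3 : inner ℂ (U 1 φ) (U (c s) f) = inner ℂ (U 1 φ) f := h2
  rwa [hone] at h3

/-- A nontrivial central one-parameter subgroup of a compact group is detected by a character. -/
theorem exists_character_ne_one [T2Space A] (c : ℝ → A) (hc : ∀ s t, c (s + t) = c s * c t)
    (hcen : ∀ s a, c s * a = a * c s) (hne : ∃ s, c s ≠ 1) :
    ∃ χ : A →* Circle, Continuous χ ∧ ∃ s, χ (c s) ≠ 1 := by
  letI : MeasurableSpace A := borel A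
  haveI : BorelSpace A := ⟨rfl⟩
  set μ : Measure A := Measure.haarMeasure (⊤ : TopologicalSpace.PositiveCompacts A) with hμ
  haveI : Fact ((2 : ℝ≥0∞) ≠ ⊤) := ⟨by norm_num⟩
  let U : A →* (Lp ℂ 2 μ →ₗᵢ[ℂ] Lp ℂ 2 μ) :=
    { toFun := fun a =>
        { toFun := fun f => DomMulAct.mk a⁻¹ • f
          map_add' := smul_add _
          map_smul' := fun z f => smul_comm _ _ _
          norm_map' := DomMulAct.norm_smul_Lp _ }
      map_one' := by
        ext1 f
        change DomMulAct.mk (1 : A)⁻¹ • f = f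
        rw [inv_one, DomMulAct.mk_one, one_smul]
      map_mul' := fun a b => by
        ext1 f
        change DomMulAct.mk (a * b)⁻¹ • f = DomMulAct.mk a⁻¹ • DomMulAct.mk b⁻¹ • f
        rw [smul_smul, mul_inv_rev, DomMulAct.mk_mul] }
  have hUdef : ∀ a f, U a f = DomMulAct.mk a⁻¹ • f := fun a f => rfl
  have hJU : ∀ (a : A) (F F' : A →ᵇ ℂ), (∀ x, F' x = F (a⁻¹ * x)) →
      BoundedContinuousFunction.toLp 2 μ ℂ F' = U a (BoundedContinuousFunction.toLp 2 μ ℂ F) := by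
    intro a F F' h
    refine Lp.ext ?_
    refine (BoundedContinuousFunction.coeFn_toLp (p := 2) μ ℂ F').trans ?_
    refine Filter.EventuallyEq.trans ?_
      (DomMulAct.smul_Lp_ae_eq (DomMulAct.mk a⁻¹) (BoundedContinuousFunction.toLp 2 μ ℂ F)).symm
    have h1 := (measurePreserving_mul_left μ a⁻¹).quasiMeasurePreserving.ae_eq_comp
      (BoundedContinuousFunction.coeFn_toLp (p := 2) μ ℂ F)
    refine Filter.EventuallyEq.trans ?_ h1.symm
    exact Filter.Eventually.of_forall h
  refine exists_character_of_regular U (fun v => ?_) (BoundedContinuousFunction.toLp 2 μ ℂ)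
    (BoundedContinuousFunction.toLp_injective μ) hJU c hc hcen ?_
  · simp only [hUdef]
    exact (DomMulAct.continuous_mk.comp continuous_inv).smul continuous_const
  · obtain ⟨s, hs⟩ := hne
    -- An Urysohn function equal to `0` at `(c s)⁻¹` and `1` at the identity is moved by `c s` in
    -- the regular representation, as the two functions differ at the identity.
    obtain ⟨k, hk0, hk1, -⟩ := exists_continuous_zero_one_of_isClosed
      (isClosed_singleton (x := (c s)⁻¹)) (isClosed_singleton (x := (1 : A)))
      (Set.disjoint_singleton.2 (inv_ne_one.2 hs))
    let F : A →ᵇ ℂ := BoundedContinuousFunction.mkOfCompact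
      ⟨fun x => (k x : ℂ), Complex.continuous_ofReal.comp k.continuous⟩
    let F' : A →ᵇ ℂ := BoundedContinuousFunction.mkOfCompact
      ⟨fun x => (k ((c s)⁻¹ * x) : ℂ),
        Complex.continuous_ofReal.comp (k.continuous.comp (continuous_const.mul continuous_id))⟩
    refine ⟨s, BoundedContinuousFunction.toLp 2 μ ℂ F, fun h => ?_⟩
    rw [← hJU (c s) F F' fun x => rfl] at h
    have h2 := congrArg (fun F : A →ᵇ ℂ => F 1) (BoundedContinuousFunction.toLp_injective μ h)
    have h3 : (k ((c s)⁻¹ * 1) : ℂ) = k 1 := h2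
    rw [mul_one, hk0 rfl, hk1 rfl] at h3
    simp at h3

end PeterWeyl

/-! ### Invariant inner products -/

section InnerForm
variable {V : Type*} [AddCommGroup V] [Module ℝ V]

/-- Positive definite symmetric bilinear forms. -/
structure IsInnerForm (B : LinearMap.BilinForm ℝ V) : Prop where
  symm : ∀ x y, B x y = B y x
  pos : ∀ x, x ≠ 0 → 0 < B x x

namespace IsInnerForm
variable {B : LinearMap.BilinForm ℝ V} (hB : IsInnerForm B)
include hB

lemma eq_zero {x : V} (h : B x x = 0) : x = 0 := by
  by_contra hx
  exact (hB.pos x hx).ne' h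

lemma mem_orthogonal {W : Submodule ℝ V} {x : V} : x ∈ B.orthogonal W ↔ ∀ y ∈ W, B x y = 0 := by
  rw [LinearMap.BilinForm.mem_orthogonal_iff]
  exact forall₂_congr fun y _ => by rw [hB.symm x y]

lemma isCompl_orthogonal [FiniteDimensional ℝ V] (W : Submodule ℝ V) :
    IsCompl W (B.orthogonal W) := by
  refine (LinearMap.BilinForm.isCompl_orthogonal_iff_disjoint ?_).2 ?_
  · intro x y h
    rw [hB.symm, h]
  · rw [Submodule.disjoint_def]
    intro x hx hx'
    exact hB.eq_zero (hB.mem_orthogonal.1 hx' x hx)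

lemma exists_decomp [FiniteDimensional ℝ V] (W : Submodule ℝ V) (x : V) :
    ∃ y ∈ W, x - y ∈ B.orthogonal W := by
  have hx : x ∈ W ⊔ B.orthogonal W := by
    rw [(hB.isCompl_orthogonal W).sup_eq_top]; exact Submodule.mem_top
  obtain ⟨y, hy, z, hz, rfl⟩ := Submodule.mem_sup.1 hx
  exact ⟨y, hy, by rwa [add_sub_cancel_left]⟩

/-- A map preserving the form and a subspace preserves the orthogonal complement. -/
lemma map_mem_orthogonal {f g : V →ₗ[ℝ] V} (hfg : ∀ x y, B (f x) y = B x (g y))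
    {W : Submodule ℝ V} (hg : ∀ y ∈ W, g y ∈ W) {x : V} (hx : x ∈ B.orthogonal W) :
    f x ∈ B.orthogonal W := by
  rw [hB.mem_orthogonal] at hx ⊢
  intro y hy
  rw [hfg]
  exact hx _ (hg y hy)

end IsInnerForm

lemma exists_isInnerForm [FiniteDimensional ℝ V] : ∃ B : LinearMap.BilinForm ℝ V, IsInnerForm B := by
  let b := Module.finBasis ℝ V
  let B : LinearMap.BilinForm ℝ V :=
    ∑ i, (LinearMap.mul ℝ ℝ).compl₁₂ (b.coord i) (b.coord i)
  have hB : ∀ x y, B x y = ∑ i, b.repr x i * b.repr y i := fun x y => by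
    simp [B, LinearMap.sum_apply]
  refine ⟨B, fun x y => ?_, fun x hx => ?_⟩
  · rw [hB, hB]
    exact Finset.sum_congr rfl fun i _ => mul_comm _ _
  · rw [hB]
    obtain ⟨i, hi⟩ : ∃ i, b.repr x i ≠ 0 := by
      by_contra! h
      exact hx (b.ext_elem fun i => by simp [h i])
    exact Finset.sum_pos' (fun i _ => mul_self_nonneg _) ⟨i, Finset.mem_univ i, mul_self_pos.2 hi⟩

/-- A representation of a compact group preserves a positive definite form. -/
lemma exists_invariant_isInnerForm {K : Type*} [TopologicalSpace K] [Group K]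
    [IsTopologicalGroup K] [CompactSpace K] [FiniteDimensional ℝ V] (R : K → V →ₗ[ℝ] V)
    (hR : ∀ a b v, R (a * b) v = R a (R b v)) (hR1 : ∀ v, R 1 v = v)
    (hc : ∀ (ℓ : V →ₗ[ℝ] ℝ) v, Continuous fun k => ℓ (R k v)) :
    ∃ B : LinearMap.BilinForm ℝ V, IsInnerForm B ∧ ∀ k x y, B (R k x) (R k y) = B x y := by
  obtain ⟨B₀, hB₀⟩ := exists_isInnerForm (V := V)
  let b := Module.finBasis ℝ V
  -- The action on bilinear forms; averaging `B₀` keeps symmetry, a linear equation, and positivity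
  -- at each vector, a strict linear inequality.
  let ρ : K → LinearMap.BilinForm ℝ V →ₗ[ℝ] LinearMap.BilinForm ℝ V := fun k =>
    { toFun := fun β => β.compl₁₂ (R k⁻¹) (R k⁻¹)
      map_add' := fun β β' => rfl
      map_smul' := fun c β => rfl }
  have hρ : ∀ k β x y, ρ k β x y = β (R k⁻¹ x) (R k⁻¹ y) := fun k β x y => rfl
  have hexp : ∀ (β : LinearMap.BilinForm ℝ V),
      β = ∑ i, ∑ j, β (b i) (b j) • (LinearMap.mul ℝ ℝ).compl₁₂ (b.coord i) (b.coord j) := by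
    intro β
    refine b.ext fun i => b.ext fun j => ?_
    simp [LinearMap.sum_apply, Finsupp.single_apply]
  have hcont : ∀ ℓ : LinearMap.BilinForm ℝ V →ₗ[ℝ] ℝ, Continuous fun k => ℓ (ρ k B₀) := by
    intro ℓ
    have h1 : ∀ k, ℓ (ρ k B₀) = ∑ i, ∑ j, B₀ (R k⁻¹ (b i)) (R k⁻¹ (b j)) *
        ℓ ((LinearMap.mul ℝ ℝ).compl₁₂ (b.coord i) (b.coord j)) := by
      intro k
      conv_lhs => rw [hexp (ρ k B₀)]
      simp only [map_sum, map_smul, smul_eq_mul, hρ]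
    simp only [h1]
    refine continuous_finsetSum _ fun i _ => continuous_finsetSum _ fun j _ =>
      Continuous.mul ?_ continuous_const
    have h2 : ∀ v w, B₀ v w = ∑ i, ∑ j, B₀ (b i) (b j) * (b.coord i v * b.coord j w) := by
      intro v w
      conv_lhs => rw [hexp B₀]
      simp [LinearMap.sum_apply]
    simp only [h2 (R _ _)]
    have h3 : ∀ i v, Continuous fun k : K => b.coord i (R k⁻¹ v) := fun i v =>
      (hc (b.coord i) v).comp continuous_inv
    exact continuous_finsetSum _ fun i _ => continuous_finsetSum _ fun j _ =>
      continuous_const.mul ((h3 _ _).mul (h3 _ _))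
  obtain ⟨B, hBfix, hBpos, hBeq⟩ := exists_average ρ (fun a a' β => by
    refine LinearMap.ext₂ fun x y => ?_
    rw [hρ, hρ, hρ, mul_inv_rev, hR, hR]) B₀ hcont
  refine ⟨B, ⟨fun x y => ?_, fun x hx => ?_⟩, fun k x y => ?_⟩
  · let ℓ : LinearMap.BilinForm ℝ V →ₗ[ℝ] ℝ :=
      { toFun := fun β => β x y - β y x
        map_add' := fun β β' => by simp only [LinearMap.add_apply]; ring
        map_smul' := fun c β => by simp only [LinearMap.smul_apply, smul_eq_mul, RingHom.id_apply]; ring }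
    exact sub_eq_zero.1 (hBeq ℓ 0 fun k => sub_eq_zero.2 (hB₀.symm _ _))
  · let ℓ : LinearMap.BilinForm ℝ V →ₗ[ℝ] ℝ :=
      { toFun := fun β => β x x
        map_add' := fun β β' => rfl
        map_smul' := fun c β => rfl }
    refine hBpos ℓ fun k => hB₀.pos _ fun h => hx ?_
    rw [← hR1 x, ← mul_inv_cancel k, hR, h, map_zero]
  · conv_rhs => rw [← hBfix k⁻¹, hρ, inv_inv]

end InnerForm

/-! ### `Ad`-invariant forms and averages in the Lie algebra -/

section AdInvariant
variable {E : Type*} [NormedAddCommGroup E] [NormedSpace ℝ E] [FiniteDimensional ℝ E]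
  [CompleteSpace E]
  {HM : Type*} [TopologicalSpace HM] (I : ModelWithCorners ℝ E HM) [I.Boundaryless]
  {G : Type*} [TopologicalSpace G] [ChartedSpace HM G] [Group G] [LieGroup I ∞ G] [T2Space G]

/-- Invariance of a bilinear form under the adjoint action of a subgroup. -/
def AdInvariant (K : Subgroup G) (B : LinearMap.BilinForm ℝ (GroupLieAlgebra I G)) : Prop :=
  ∀ a ∈ K, ∀ x y, B (Ad I a x) (Ad I a y) = B x y

lemma continuous_linearForm (ℓ : E →ₗ[ℝ] ℝ) : Continuous ℓ := ℓ.continuous_of_finiteDimensional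

lemma exists_adInvariant {K : Subgroup G} (hK : IsCompact (K : Set G)) :
    ∃ B : LinearMap.BilinForm ℝ (GroupLieAlgebra I G), IsInnerForm B ∧ AdInvariant I K B := by
  haveI : IsTopologicalGroup G := topologicalGroup_of_lieGroup I ∞
  haveI : CompactSpace K := isCompact_iff_compactSpace.1 hK
  obtain ⟨B, hB, hinv⟩ := exists_invariant_isInnerForm
    (fun k : K => (Ad I (k : G)).toLinearMap) (fun a b v => Ad_mul I (a : G) b v)
    (fun v => Ad_one I v) (fun ℓ v => by
      have h : Continuous ℓ := continuous_linearForm (E := E) ℓ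
      exact h.comp ((continuous_Ad I v).comp continuous_subtype_val))
  exact ⟨B, hB, fun a ha x y => hinv ⟨a, ha⟩ x y⟩

/-- The two conditions on functionals say that the average stays in every open half-space through
the origin and in every affine hyperplane that contains the orbit. -/
lemma exists_fixed_average {K : Subgroup G} (hK : IsCompact (K : Set G))
    (v : GroupLieAlgebra I G) : ∃ w : GroupLieAlgebra I G, (∀ a ∈ K, Ad I a w = w) ∧
      (∀ ℓ : GroupLieAlgebra I G →ₗ[ℝ] ℝ, (∀ a ∈ K, 0 < ℓ (Ad I a v)) → 0 < ℓ w) ∧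
      ∀ (ℓ : GroupLieAlgebra I G →ₗ[ℝ] ℝ) (c : ℝ), (∀ a ∈ K, ℓ (Ad I a v) = c) → ℓ w = c := by
  haveI : IsTopologicalGroup G := topologicalGroup_of_lieGroup I ∞
  haveI : CompactSpace K := isCompact_iff_compactSpace.1 hK
  obtain ⟨w, h1, h2, h3⟩ := exists_average
    (fun k : K => (Ad I (k : G)).toLinearMap) (fun a b v => Ad_mul I (a : G) b v) v (fun ℓ => by
      have h : Continuous ℓ := continuous_linearForm (E := E) ℓ
      exact h.comp ((continuous_Ad I v).comp continuous_subtype_val))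
  exact ⟨w, fun a ha => h1 ⟨a, ha⟩, fun ℓ h => h2 ℓ fun k => h k k.2,
    fun ℓ c h => h3 ℓ c fun k => h k k.2⟩

variable {I}

lemma AdInvariant.mono {K K' : Subgroup G} {B : LinearMap.BilinForm ℝ (GroupLieAlgebra I G)}
    (h : AdInvariant I K B) (hle : K' ≤ K) : AdInvariant I K' B := fun a ha => h a (hle ha)

lemma AdInvariant.apply_left {K : Subgroup G} {B : LinearMap.BilinForm ℝ (GroupLieAlgebra I G)}
    (h : AdInvariant I K B) {a : G} (ha : a ∈ K) (x y : GroupLieAlgebra I G) :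
    B (Ad I a x) y = B x (Ad I a⁻¹ y) := by
  rw [← h a⁻¹ (K.inv_mem ha), Ad_inv_apply_Ad]

lemma AdInvariant.Ad_mem_orthogonal {K : Subgroup G}
    {B : LinearMap.BilinForm ℝ (GroupLieAlgebra I G)} (hB : IsInnerForm B)
    (h : AdInvariant I K B) {W : Submodule ℝ (GroupLieAlgebra I G)}
    (hW : ∀ a ∈ K, ∀ y ∈ W, Ad I a y ∈ W) {a : G} (ha : a ∈ K) {x : GroupLieAlgebra I G}
    (hx : x ∈ B.orthogonal W) : Ad I a x ∈ B.orthogonal W :=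
  hB.map_mem_orthogonal (f := (Ad I a).toLinearMap) (g := (Ad I a⁻¹).toLinearMap)
    (h.apply_left ha) (hW _ (K.inv_mem ha)) hx

variable (I)

lemma Ad_mem_lieAlg {H : Subgroup G} (hH : IsClosed (H : Set G)) {a : G} (ha : a ∈ H)
    {X : GroupLieAlgebra I G} (hX : X ∈ lieAlg I H) : Ad I a X ∈ lieAlg I H := by
  rw [mem_lieAlg_iff I hH] at hX ⊢
  intro t
  rw [lexp_smul_Ad]
  exact H.mul_mem (H.mul_mem ha (hX t)) (H.inv_mem ha)

end AdInvariant

/-! ### Admissibility as the existence of a fixed vector off the Lie algebra -/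

section Admissible
variable {E : Type*} [NormedAddCommGroup E] [NormedSpace ℝ E] [FiniteDimensional ℝ E]
  [CompleteSpace E]
  {HM : Type*} [TopologicalSpace HM] (I : ModelWithCorners ℝ E HM) [I.Boundaryless]
  {G : Type*} [TopologicalSpace G] [ChartedSpace HM G] [Group G] [LieGroup I ∞ G] [T2Space G]

/-- The value of a tensor field on vectors of the model space. -/
def tensorEval (β : ∀ a : G, TangentSpace I a →L[ℝ] TangentSpace I a →L[ℝ] ℝ) (a : G) (x y : E) :
    ℝ := β a x y

lemma mem_vertical_one {H : Subgroup G} {X : GroupLieAlgebra I G} :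
    X ∈ vertical I H (1 : G) ↔ X ∈ lieAlg I H := by
  have h : {u : GroupLieAlgebra I G | ∃ X ∈ lieAlg I H, u = mulInvariantVectorField (I := I) X (1 : G)} =
      (lieAlg I H : Set (GroupLieAlgebra I G)) := by
    ext u
    constructor
    · rintro ⟨X, hX, rfl⟩
      rwa [mulInvariantVectorField_one]
    · intro hu
      exact ⟨u, hu, (mulInvariantVectorField_one I u).symm⟩
  unfold vertical
  change X ∈ Submodule.span ℝ {u : GroupLieAlgebra I G |
    ∃ X ∈ lieAlg I H, u = mulInvariantVectorField (I := I) X (1 : G)} ↔ _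
  rw [h, Submodule.span_eq]

/-- An invariant Lorentzian metric is preserved at the base point by the isotropy representation. -/
lemma IsInvariant.apply_Ad {H : Subgroup G}
    {β : ∀ a : G, TangentSpace I a →L[ℝ] TangentSpace I a →L[ℝ] ℝ}
    (hβ : IsLorentzMetric I H β) (hinv : IsInvariant I β) {h : G} (hh : h ∈ H)
    (X Y : GroupLieAlgebra I G) : β 1 (Ad I h X) (Ad I h Y) = β 1 X Y := by
  have e1 : ∀ X : GroupLieAlgebra I G, (mfderiv I I (fun x : G => x * h) 1 (Ad I h X) : E) =
      mulInvariantVectorField (I := I) X h := by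
    intro X
    have h1 := mfderiv_mul_right_mulInvariantVectorField I h 1 (Ad I h X)
    rw [mulInvariantVectorField_one, Ad_inv_apply_Ad] at h1
    have h2 : ∀ z z' : G, z = z' → (mulInvariantVectorField (I := I) X z : E) =
        mulInvariantVectorField (I := I) X z' := by rintro z _ rfl; rfl
    exact h1.trans (h2 _ _ (one_mul h))
  have e2 : ∀ X : GroupLieAlgebra I G, (mfderiv I I (fun x : G => h * x) 1 X : E) =
      mulInvariantVectorField (I := I) X h := fun X => rfl
  have h1 : tensorEval I β (1 * h) (mfderiv I I (fun x : G => x * h) 1 (Ad I h X))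
      (mfderiv I I (fun x : G => x * h) 1 (Ad I h Y)) = β 1 (Ad I h X) (Ad I h Y) :=
    hβ.right_translation 1 h hh (Ad I h X) (Ad I h Y)
  have h2 : tensorEval I β (h * 1) (mfderiv I I (fun x : G => h * x) 1 X)
      (mfderiv I I (fun x : G => h * x) 1 Y) = β 1 X Y := hinv h 1 X Y
  rw [← h1, ← h2, e1 X, e1 Y, e2 X, e2 Y, one_mul, mul_one]

/-- Take `v` timelike. Vectors orthogonal to `v` and not vertical are spacelike, while `Ad h v` is
timelike, so the two are never orthogonal; by connectedness of `H` their pairing stays negative. The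
averaged orbit therefore pairs negatively with `v` and cannot be vertical. -/
lemma exists_fixed_of_isAdmissible {H : Subgroup G} (hH : IsAdmissible I H) :
    ∃ t ∉ lieAlg I H, ∀ a ∈ H, Ad I a t = t := by
  obtain ⟨⟨hcpt, hconn⟩, β, hβ, hinv⟩ := hH
  obtain ⟨v, hv, hpos⟩ := hβ.index_one 1
  have hAd := fun {h : G} (hh : h ∈ H) => IsInvariant.apply_Ad I hβ hinv hh
  have hne : ∀ h ∈ H, β 1 v (Ad I h v) ≠ 0 := by
    intro h hh h0
    have h1 : β 1 (Ad I h v) (Ad I h v) < 0 := by rw [hAd hh]; exact hv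
    refine lt_asymm h1 (hpos (Ad I h v) h0 fun hvert => ?_)
    rw [hβ.vertical_eq_zero 1 _ hvert] at h1
    exact lt_irrefl _ h1
  have hcont : Continuous fun h : G => β 1 v (Ad I h v) := by
    have h1 : Continuous fun x : E => tensorEval I β 1 v x := (β 1 v : E →L[ℝ] ℝ).continuous
    exact h1.comp (continuous_Ad I v)
  have hneg : ∀ h ∈ H, β 1 v (Ad I h v) < 0 := by
    intro h hh
    by_contra hge
    push Not at hge
    have h1 := hconn.isPreconnected.intermediate_value H.one_mem hh hcont.continuousOn
    have h2 : (0 : ℝ) ∈ Set.Icc (β 1 v (Ad I (1 : G) v)) (β 1 v (Ad I h v)) := by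
      rw [Ad_one]
      exact ⟨hv.le, hge⟩
    obtain ⟨k, hk, hk0⟩ := h1 h2
    exact hne k hk hk0
  obtain ⟨t, hfix, ht, -⟩ := exists_fixed_average I hcpt v
  let ℓ : GroupLieAlgebra I G →ₗ[ℝ] ℝ := -(β 1 v).toLinearMap
  have h1 : 0 < -(β 1 v t) := ht ℓ fun a ha => neg_pos.2 (hneg a ha)
  refine ⟨t, fun htm => ?_, hfix⟩
  rw [hβ.symm, hβ.vertical_eq_zero 1 t ((mem_vertical_one I).2 htm), neg_zero] at h1
  exact lt_irrefl _ h1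

lemma exists_mulInvariantVectorField_eq (a : G) (u : TangentSpace I a) :
    ∃ X : GroupLieAlgebra I G, mulInvariantVectorField (I := I) X a = u := by
  have h : (fun x : G => a * x) ∘ (fun x : G => a⁻¹ * x) = id := by ext x; simp
  have h1 := mfderiv_comp_of_eq (I := I) (I' := I) (I'' := I) (x := a) (y := (1 : G))
    (mdifferentiableAt_mul_left I a 1) (mdifferentiableAt_mul_left I a⁻¹ a) (inv_mul_cancel a)
  have h2 : (mfderiv I I ((fun x : G => a * x) ∘ (fun x : G => a⁻¹ * x)) a : E →L[ℝ] E) =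
      ContinuousLinearMap.id ℝ E := (mfderiv_congr_fun I h a).trans mfderiv_id
  refine ⟨(mfderiv I I (fun x : G => a⁻¹ * x) a u : E), ?_⟩
  have h3 : ((mfderiv I I (fun x : G => a * x) 1 : E →L[ℝ] E).comp
      (mfderiv I I (fun x : G => a⁻¹ * x) a : E →L[ℝ] E)) = ContinuousLinearMap.id ℝ E := by
    rw [← mfderiv_congr_arg I (fun x : G => a * x) (inv_mul_cancel a)]
    exact h1.symm.trans h2
  exact congrArg (fun T : E →L[ℝ] E => T u) h3

/-- The left-invariant bilinear tensor field defined by a form on the Lie algebra. -/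
def invariantTensor (b : E →L[ℝ] E →L[ℝ] ℝ) (a : G) :
    TangentSpace I a →L[ℝ] TangentSpace I a →L[ℝ] ℝ :=
  (b.bilinearComp (mfderiv I I (fun x : G => a⁻¹ * x) a : E →L[ℝ] E)
    (mfderiv I I (fun x : G => a⁻¹ * x) a : E →L[ℝ] E) : E →L[ℝ] E →L[ℝ] ℝ)

lemma invariantTensor_apply (b : E →L[ℝ] E →L[ℝ] ℝ) (a : G) (X Y : GroupLieAlgebra I G) :
    invariantTensor I b a (mulInvariantVectorField X a) (mulInvariantVectorField Y a) = b X Y := by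
  have h : ∀ X : GroupLieAlgebra I G,
      (mfderiv I I (fun x : G => a⁻¹ * x) a (mulInvariantVectorField X a) : E) = X := by
    intro X
    have h2 : ∀ z : G, z = 1 → (mulInvariantVectorField (I := I) X z : E) = X := by
      rintro z rfl; exact mulInvariantVectorField_one I X
    exact (mfderiv_mul_left_mulInvariantVectorField I a⁻¹ a X).trans (h2 _ (inv_mul_cancel a))
  have h1 : invariantTensor I b a (mulInvariantVectorField X a) (mulInvariantVectorField Y a) =
    b (mfderiv I I (fun x : G => a⁻¹ * x) a (mulInvariantVectorField X a))
      (mfderiv I I (fun x : G => a⁻¹ * x) a (mulInvariantVectorField Y a)) := rfl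
  rw [h1, h X, h Y]

lemma mulInvariantVectorField_mem_vertical {H : Subgroup G} {a : G} {X : GroupLieAlgebra I G}
    (hX : X ∈ lieAlg I H) : mulInvariantVectorField X a ∈ vertical I H a :=
  Submodule.subset_span ⟨X, hX, rfl⟩

/-- Left translation spreads a form on `𝔤` over the group. Invariance under right translation by `H`
then amounts to `Ad H`-invariance of the form, and smoothness is automatic because the coefficients
in the left-invariant frame are constant. -/
lemma exists_lorentzMetric {H : Subgroup G} (b : E →L[ℝ] E →L[ℝ] ℝ)
    (hsymm : ∀ x y, b x y = b y x)
    (hAd : ∀ h ∈ H, ∀ X Y : GroupLieAlgebra I G, b (Ad I h X) (Ad I h Y) = b X Y)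
    (hker : ∀ X ∈ lieAlg I H, ∀ Y : GroupLieAlgebra I G, b X Y = 0)
    (hidx : ∃ v : GroupLieAlgebra I G, b v v < 0 ∧ ∀ w : GroupLieAlgebra I G, b v w = 0 → w ∉ lieAlg I H → 0 < b w w) :
    ∃ β : ∀ a : G, TangentSpace I a →L[ℝ] TangentSpace I a →L[ℝ] ℝ,
      IsLorentzMetric I H β ∧ IsInvariant I β := by
  refine ⟨invariantTensor I b, ⟨fun a u v => ?_, fun X Y => ?_, fun a h hh u v => ?_,
    fun a u hu v => ?_, fun a => ?_⟩, fun c a u v => ?_⟩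
  · obtain ⟨X, rfl⟩ := exists_mulInvariantVectorField_eq I a u
    obtain ⟨Y, rfl⟩ := exists_mulInvariantVectorField_eq I a v
    rw [invariantTensor_apply, invariantTensor_apply]
    exact hsymm X Y
  · simp only [invariantTensor_apply]
    exact contMDiff_const
  · obtain ⟨X, rfl⟩ := exists_mulInvariantVectorField_eq I a u
    obtain ⟨Y, rfl⟩ := exists_mulInvariantVectorField_eq I a v
    rw [mfderiv_mul_right_mulInvariantVectorField, mfderiv_mul_right_mulInvariantVectorField,
      invariantTensor_apply, invariantTensor_apply, hAd _ (H.inv_mem hh)]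
  · obtain ⟨Y, rfl⟩ := exists_mulInvariantVectorField_eq I a v
    induction hu using Submodule.span_induction with
    | mem u hu =>
      obtain ⟨X, hX, rfl⟩ := hu
      rw [invariantTensor_apply, hker X hX]
    | zero => rw [map_zero]; rfl
    | add u u' _ _ h h' =>
      rw [map_add]
      exact (congrArg₂ (· + ·) h h').trans (add_zero 0)
    | smul c u _ h =>
      rw [map_smul]
      exact (congrArg (c • ·) h).trans (smul_zero c)
  · obtain ⟨v, hv, hpos⟩ := hidx
    refine ⟨mulInvariantVectorField (I := I) v a, ?_, fun w hw hwn => ?_⟩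
    · rw [invariantTensor_apply]; exact hv
    · obtain ⟨W, rfl⟩ := exists_mulInvariantVectorField_eq I a w
      rw [invariantTensor_apply] at hw ⊢
      exact hpos W hw fun h => hwn (mulInvariantVectorField_mem_vertical I h)
  · obtain ⟨X, rfl⟩ := exists_mulInvariantVectorField_eq I a u
    obtain ⟨Y, rfl⟩ := exists_mulInvariantVectorField_eq I a v
    rw [mfderiv_mul_left_mulInvariantVectorField, mfderiv_mul_left_mulInvariantVectorField,
      invariantTensor_apply, invariantTensor_apply]

/-- A linear form vanishing on `W` and a vector off `W` give a degenerate Lorentzian form. -/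
lemma exists_lorentzForm {V : Type*} [AddCommGroup V] [Module ℝ V] [FiniteDimensional ℝ V]
    {B : LinearMap.BilinForm ℝ V} (hB : IsInnerForm B) (W : Submodule ℝ V) {t : V} (ht : t ∉ W) :
    ∃ b : LinearMap.BilinForm ℝ V, (∀ x y, b x y = b y x) ∧ (∀ x ∈ W, ∀ y, b x y = 0) ∧
      (∃ v, b v v < 0 ∧ ∀ w, b v w = 0 → w ∉ W → 0 < b w w) ∧
      ∀ R : V →ₗ[ℝ] V, (∀ x y, B (R x) (R y) = B x y) → (∀ x ∈ W, R x ∈ W) →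
        (∀ x ∈ B.orthogonal W, R x ∈ B.orthogonal W) → R t = t →
        ∀ x y, b (R x) (R y) = b x y := by
  have hc := hB.isCompl_orthogonal W
  let P : V →ₗ[ℝ] V := (B.orthogonal W).subtype ∘ₗ (B.orthogonal W).projectionOnto W hc.symm
  have hPmem : ∀ x, P x ∈ B.orthogonal W := fun x => Subtype.property _
  have hPW : ∀ x ∈ W, P x = 0 := fun x hx => by
    have := Submodule.projectionOnto_apply_right hc.symm ⟨x, hx⟩
    simpa [P] using this
  have hPO : ∀ x ∈ B.orthogonal W, P x = x := fun x hx => by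
    have := Submodule.projectionOnto_apply_left hc.symm ⟨x, hx⟩
    simpa [P] using congrArg Subtype.val this
  have hker : ∀ x, P x = 0 → x ∈ W := fun x hx => by
    obtain ⟨y, hy, hz⟩ := hB.exists_decomp W x
    have h1 : P (x - y) = x - y := hPO _ hz
    rw [map_sub, hx, hPW y hy, sub_zero] at h1
    rwa [sub_eq_zero.1 h1.symm]
  set u := P t with hu
  have hu0 : u ≠ 0 := fun h => ht (hker t h)
  have huu : 0 < B u u := hB.pos u hu0
  have hPu : P u = u := hPO u (hPmem t)
  let ℓ : V →ₗ[ℝ] ℝ := (B u) ∘ₗ P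
  -- The form `B`, made degenerate along `W`, with the sign reversed on the line of `u`: the factor
  -- `2 / B u u` gives `b u u = -B u u` and leaves the orthogonal complement of `u` unchanged.
  let b : LinearMap.BilinForm ℝ V :=
    B.compl₁₂ P P - (2 / B u u) • (LinearMap.mul ℝ ℝ).compl₁₂ ℓ ℓ
  have hb : ∀ x y, b x y = B (P x) (P y) - 2 / B u u * (B u (P x) * B u (P y)) := fun x y => rfl
  refine ⟨b, fun x y => ?_, fun x hx y => ?_, ⟨u, ?_, fun w hw hwW => ?_⟩, fun R hR hRW hRO ht x y => ?_⟩
  · rw [hb, hb, hB.symm, mul_comm (B u (P x))]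
  · rw [hb, hPW x hx]
    simp
  · rw [hb, hPu]
    have : 2 / B u u * (B u u * B u u) = 2 * B u u := by field_simp
    rw [this]
    linarith
  · rw [hb, hPu] at hw
    have h1 : 2 / B u u * (B u u * B u (P w)) = 2 * B u (P w) := by field_simp
    rw [h1] at hw
    have h2 : B u (P w) = 0 := by linarith
    rw [hb, h2]
    simpa using hB.pos (P w) fun h => hwW (hker w h)
  · have hRP : ∀ x, P (R x) = R (P x) := by
      intro x
      obtain ⟨y, hy, hz⟩ := hB.exists_decomp W x
      have h1 : P x = x - y := by
        have := hPO _ hz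
        rwa [map_sub, hPW y hy, sub_zero] at this
      have h2 := hPO _ (hRO _ hz)
      rw [map_sub, map_sub, hPW _ (hRW y hy), sub_zero] at h2
      rw [h1, h2, map_sub]
    have hRu : R u = u := by rw [hu, ← hRP, ht]
    have h3 : ∀ z, B u (R z) = B u z := fun z => by rw [← hR u z, hRu]
    rw [hb, hb, hRP, hRP, hR, h3, h3]

lemma isAdmissible_of_fixed {H : Subgroup G} (hH : IsConnectedCompact H)
    {t : GroupLieAlgebra I G} (ht : t ∉ lieAlg I H) (hfix : ∀ a ∈ H, Ad I a t = t) :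
    IsAdmissible I H := by
  refine ⟨hH, ?_⟩
  have hcl : IsClosed (H : Set G) := hH.1.isClosed
  obtain ⟨B, hB, hinv⟩ := exists_adInvariant I hH.1
  obtain ⟨b, hsymm, hker, hidx, hR⟩ := exists_lorentzForm hB (lieAlg I H) ht
  let b' : E →L[ℝ] E →L[ℝ] ℝ := LinearMap.toContinuousLinearMap
    (LinearMap.toContinuousLinearMap.toLinearMap ∘ₗ (b : E →ₗ[ℝ] E →ₗ[ℝ] ℝ))
  exact exists_lorentzMetric I b' hsymm (fun h hh => hR (Ad I h).toLinearMap (hinv h hh)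
    (fun x hx => Ad_mem_lieAlg I hcl hh hx)
    (fun x hx => hinv.Ad_mem_orthogonal hB (fun a ha y hy => Ad_mem_lieAlg I hcl ha hy) hh hx)
    (hfix h hh)) hker hidx

end Admissible

/-! ### Continuous homomorphisms from the line to the circle -/

section CircleHom

/-- Continuous homomorphisms from the real line to the circle are exponentials. -/
lemma exists_eq_circleExp {φ : ℝ → Circle} (hφ : Continuous φ)
    (hadd : ∀ s t, φ (s + t) = φ s * φ t) : ∃ d : ℝ, ∀ s, φ s = Circle.exp (s * d) := by
  have h0 : φ 0 = 1 := by
    have := hadd 0 0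
    rw [add_zero] at this
    exact mul_eq_left.1 this.symm
  obtain ⟨F, ⟨hF0, hF⟩, -⟩ := Circle.isCoveringMap_exp.existsUnique_continuousMap_lifts ⟨φ, hφ⟩ 0 0
    (by simp [h0])
  have hF' : ∀ s, Circle.exp (F s) = φ s := fun s => congrFun hF s
  have hFadd : ∀ s t, F (s + t) = F s + F t := by
    intro s t
    -- Additivity of the lift `F` is uniqueness of lifts: both functions of `s` lift the same path
    -- and agree at `s = 0`.
    have h := Circle.isCoveringMap_exp.eq_of_comp_eq (g₁ := fun s => F (s + t))
      (g₂ := fun s => F s + F t) (F.continuous.comp (continuous_add_const t))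
      (F.continuous.add continuous_const) (by
        ext1 s
        change Circle.exp (F (s + t)) = Circle.exp (F s + F t)
        rw [Circle.exp_add, hF', hF', hF', hadd]) 0 (by simp [hF0])
    exact congrFun h s
  let L : ℝ →L[ℝ] ℝ := (AddMonoidHom.mk' F hFadd).toRealLinearMap F.continuous
  refine ⟨F 1, fun s => ?_⟩
  rw [← hF']
  have : L (s • 1) = s • L 1 := map_smul _ _ _
  rw [smul_eq_mul, mul_one] at this
  exact congrArg Circle.exp this

lemma circleExp_smul_injective {d d' : ℝ} (h : ∀ s : ℝ, Circle.exp (s * d) = Circle.exp (s * d')) :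
    d = d' := by
  have h1 : (fun s : ℝ => s * d) = fun s => s * d' :=
    Circle.isCoveringMap_exp.eq_of_comp_eq (g₁ := fun s : ℝ => s * d)
      (g₂ := fun s => s * d') (continuous_mul_const d) (continuous_mul_const d')
      (funext h) 0 (by simp)
  simpa using congrFun h1 1

end CircleHom

/-! ### Identity components -/

section IdentityComponent
variable {G : Type*} [TopologicalSpace G] [Group G] [IsTopologicalGroup G] [T2Space G]

/-- The identity component of a subgroup. -/
def idComp (L : Subgroup G) : Subgroup G := (Subgroup.connectedComponentOfOne L).map L.subtype

lemma idComp_le (L : Subgroup G) : idComp L ≤ L := by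
  rintro _ ⟨x, -, rfl⟩
  exact x.2

lemma coe_idComp (L : Subgroup G) : (idComp L : Set G) = connectedComponentIn (L : Set G) 1 := by
  rw [connectedComponentIn_eq_image L.one_mem]
  rfl

lemma isConnectedCompact_idComp {L : Subgroup G} (hL : IsCompact (L : Set G)) :
    IsConnectedCompact (idComp L) := by
  haveI : CompactSpace L := isCompact_iff_compactSpace.1 hL
  refine ⟨?_, ?_⟩
  · change IsCompact (Subtype.val '' (connectedComponent (1 : L)))
    exact isClosed_connectedComponent.isCompact.image continuous_subtype_val
  · change IsConnected (Subtype.val '' (connectedComponent (1 : L)))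
    exact isConnected_connectedComponent.image _ continuous_subtype_val.continuousOn

lemma subset_idComp {L : Subgroup G} {S : Set G} (hS : IsPreconnected S) (h1 : (1 : G) ∈ S)
    (hSL : S ⊆ L) : S ⊆ idComp L := by
  rw [coe_idComp]
  exact hS.subset_connectedComponentIn h1 hSL

lemma le_idComp {L H : Subgroup G} (hH : IsConnected (H : Set G)) (hHL : H ≤ L) :
    H ≤ idComp L :=
  subset_idComp hH.isPreconnected H.one_mem hHL

end IdentityComponent

/-! ### Existence of maximal compact subgroups -/

section MaximalCompact
variable {E : Type*} [NormedAddCommGroup E] [NormedSpace ℝ E] [FiniteDimensional ℝ E]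
  [CompleteSpace E]
  {HM : Type*} [TopologicalSpace HM] (I : ModelWithCorners ℝ E HM) [I.Boundaryless]
  {G : Type*} [TopologicalSpace G] [ChartedSpace HM G] [Group G] [LieGroup I ∞ G] [T2Space G]

/-- One-parameter subgroups are connected sets through the identity, so they never leave the
identity component. -/
lemma lieAlg_idComp [IsTopologicalGroup G] {L : Subgroup G} (hL : IsCompact (L : Set G)) :
    lieAlg I (idComp L) = lieAlg I L := by
  refine le_antisymm (lieAlg_mono I (idComp_le L)) fun X hX => ?_
  rw [mem_lieAlg_iff I hL.isClosed] at hX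
  rw [mem_lieAlg_iff I (isConnectedCompact_idComp hL).1.isClosed]
  intro t
  refine subset_idComp (S := Set.range fun t : ℝ => lexp I (t • X)) ?_ ⟨0, by simp [lexp_zero]⟩ ?_
    ⟨t, rfl⟩
  · exact isPreconnected_range (continuous_lexp_smul I X)
  · rintro _ ⟨s, rfl⟩
    exact hX s

lemma eq_of_le_of_lieAlg_le {H K : Subgroup G} (hK : IsConnectedCompact K)
    (hH : IsConnectedCompact H) (hle : K ≤ H) (h : lieAlg I H ≤ lieAlg I K) : H = K :=
  le_antisymm (le_of_lieAlg_le I hH.1.isClosed hH.2 hK.1.isClosed h) hle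

/-- A connected compact subgroup is contained in a maximal one. -/
lemma exists_isMaximalCompact (I : ModelWithCorners ℝ E HM) [I.Boundaryless] [LieGroup I ∞ G]
    {P : Subgroup G} (hP : IsConnectedCompact P) :
    ∃ K : Subgroup G, IsMaximalCompact K ∧ P ≤ K := by
  -- A subgroup of largest dimension is maximal, because a larger connected compact subgroup has the
  -- same Lie algebra and is therefore equal to it.
  let S : Set ℕ := {n | ∃ K : Subgroup G, IsConnectedCompact K ∧ P ≤ K ∧
    Module.finrank ℝ (lieAlg I K) = n}
  have hne : S.Nonempty := ⟨_, P, hP, le_rfl, rfl⟩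
  have hbdd : BddAbove S := by
    refine ⟨Module.finrank ℝ (GroupLieAlgebra I G), ?_⟩
    rintro _ ⟨K, -, -, rfl⟩
    exact Submodule.finrank_le _
  obtain ⟨K, hK, hPK, hn⟩ := Nat.sSup_mem hne hbdd
  refine ⟨K, ⟨hK, fun K' hK' hle => ?_⟩, hPK⟩
  have h1 : Module.finrank ℝ (lieAlg I K') ≤ Module.finrank ℝ (lieAlg I K) := by
    rw [hn]
    exact le_csSup hbdd ⟨K', hK', hPK.trans hle, rfl⟩
  have h2 := Submodule.eq_of_le_of_finrank_le (lieAlg_mono I hle) h1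
  exact eq_of_le_of_lieAlg_le I hK hK' hle h2.ge

end MaximalCompact

/-! ### Derivatives of characters of a closed subgroup -/

section Characters
open Filter Topology
variable {E : Type*} [NormedAddCommGroup E] [NormedSpace ℝ E] [FiniteDimensional ℝ E]
  [CompleteSpace E]
  {HM : Type*} [TopologicalSpace HM] (I : ModelWithCorners ℝ E HM) [I.Boundaryless]
  {G : Type*} [TopologicalSpace G] [ChartedSpace HM G] [Group G] [LieGroup I ∞ G] [T2Space G]

/-- The exponential map of a closed subgroup. -/
def subExp {Q : Subgroup G} (hQ : IsClosed (Q : Set G)) (X : lieAlg I Q) : Q :=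
  ⟨lexp I (X : GroupLieAlgebra I G), lexp_mem I hQ X.2⟩

variable {Q : Subgroup G} (hQ : IsClosed (Q : Set G))

lemma subExp_add_smul (X : lieAlg I Q) (s t : ℝ) :
    subExp I hQ ((s + t) • X) = subExp I hQ (s • X) * subExp I hQ (t • X) :=
  Subtype.ext (lexp_add_smul I (X : GroupLieAlgebra I G) s t)

lemma continuous_subExp_smul (X : lieAlg I Q) : Continuous fun s : ℝ => subExp I hQ (s • X) :=
  continuous_induced_rng.2 (continuous_lexp_smul I (X : GroupLieAlgebra I G))

lemma tendsto_subExp_mul_pow (X Y : lieAlg I Q) :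
    Tendsto (fun n : ℕ => (subExp I hQ ((n : ℝ)⁻¹ • X) * subExp I hQ ((n : ℝ)⁻¹ • Y)) ^ n) atTop
      (𝓝 (subExp I hQ (X + Y))) := by
  rw [tendsto_subtype_rng]
  exact tendsto_mexp_mul_pow I (G := G) (X : GroupLieAlgebra I G) (Y : GroupLieAlgebra I G)

/-- Each one-parameter subgroup yields a continuous homomorphism from the line to the circle, hence
a number. Additivity comes from applying the character to the Lie product formula, where the
sequence becomes eventually constant. -/
lemma exists_charDeriv {χ : Q →* Circle} (hχ : Continuous χ) :
    ∃ d : lieAlg I Q →ₗ[ℝ] ℝ, ∀ X, χ (subExp I hQ X) = Circle.exp (d X) := by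
  have h1 : ∀ X : lieAlg I Q, ∃ d : ℝ, ∀ s : ℝ, χ (subExp I hQ (s • X)) = Circle.exp (s * d) :=
    fun X => exists_eq_circleExp (hχ.comp (continuous_subExp_smul I hQ X)) fun s t => by
      rw [subExp_add_smul, map_mul]
  choose d hd using h1
  have hd1 : ∀ X, χ (subExp I hQ X) = Circle.exp (d X) := fun X => by
    have := hd X 1
    rwa [one_smul, one_mul] at this
  have hsmul : ∀ (c : ℝ) X, d (c • X) = c * d X := by
    intro c X
    refine circleExp_smul_injective fun s => ?_
    rw [← hd, smul_smul, hd, mul_assoc]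
  have hexp : ∀ X Y, Circle.exp (d (X + Y)) = Circle.exp (d X + d Y) := by
    intro X Y
    have h2 := (hχ.tendsto _).comp (tendsto_subExp_mul_pow I hQ X Y)
    rw [hd1] at h2
    refine tendsto_nhds_unique h2 (tendsto_const_nhds.congr' ?_)
    filter_upwards [eventually_ne_atTop 0] with n hn
    have hn' : (n : ℝ) ≠ 0 := Nat.cast_ne_zero.2 hn
    simp only [Function.comp_apply]
    rw [map_pow, map_mul, hd, hd, ← Circle.exp_add, ← mul_add]
    have h3 : ∀ (m : ℕ) (x : ℝ), Circle.exp x ^ m = Circle.exp (m * x) := by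
      intro m x
      induction m with
      | zero => simp
      | succ m ih => rw [pow_succ, ih, ← Circle.exp_add]; push_cast; ring_nf
    rw [h3, mul_inv_cancel_left₀ hn']
  refine ⟨{ toFun := d, map_add' := fun X Y => ?_, map_smul' := fun c X => hsmul c X }, hd1⟩
  -- `hexp` gives additivity only modulo `2π`; having it for all multiples `s • X`, `s • Y` removes
  -- the ambiguity.
  refine circleExp_smul_injective fun s => ?_
  rw [← hsmul, smul_add, hexp, hsmul, hsmul, mul_add]

/-- The derivative of a character. -/
def charDeriv {χ : Q →* Circle} (hχ : Continuous χ) : lieAlg I Q →ₗ[ℝ] ℝ :=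
  (exists_charDeriv I hQ hχ).choose

lemma apply_subExp {χ : Q →* Circle} (hχ : Continuous χ) (X : lieAlg I Q) :
    χ (subExp I hQ X) = Circle.exp (charDeriv I hQ hχ X) :=
  (exists_charDeriv I hQ hχ).choose_spec X

/-- The derivatives of all the characters. -/
def charDerivs : Set (lieAlg I Q →ₗ[ℝ] ℝ) :=
  {d | ∃ (χ : Q →* Circle) (hχ : Continuous χ), d = charDeriv I hQ hχ}

variable {I}

lemma charDeriv_Ad {χ : Q →* Circle} (hχ : Continuous χ) {a : G} (ha : a ∈ Q) (X : lieAlg I Q) :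
    charDeriv I hQ hχ ⟨Ad I a X, Ad_mem_lieAlg I hQ ha X.2⟩ = charDeriv I hQ hχ X := by
  refine circleExp_smul_injective fun s => ?_
  rw [← smul_eq_mul, ← smul_eq_mul, ← map_smul, ← map_smul, ← apply_subExp, ← apply_subExp]
  have h : subExp I hQ (s • ⟨Ad I a X, Ad_mem_lieAlg I hQ ha X.2⟩) =
      ⟨a, ha⟩ * subExp I hQ (s • X) * ⟨a, ha⟩⁻¹ :=
    Subtype.ext (lexp_smul_Ad I a X s)
  rw [h, map_mul, map_mul, map_inv, mul_inv_cancel_comm]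

end Characters

/-! ### Subgroups of codimension one cut out by characters -/

section CharacterSeparation
open Filter Topology
variable {E : Type*} [NormedAddCommGroup E] [NormedSpace ℝ E] [FiniteDimensional ℝ E]
  [CompleteSpace E]
  {HM : Type*} [TopologicalSpace HM] {I : ModelWithCorners ℝ E HM} [I.Boundaryless]
  {G : Type*} [TopologicalSpace G] [ChartedSpace HM G] [Group G] [LieGroup I ∞ G] [T2Space G]
  {Q : Subgroup G} (hQ : IsClosed (Q : Set G))

lemma subExp_central {w : lieAlg I Q} (hw : ∀ a ∈ Q, Ad I a (w : GroupLieAlgebra I G) = w) (s : ℝ)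
    (a : Q) : subExp I hQ (s • w) * a = a * subExp I hQ (s • w) := by
  refine Subtype.ext ?_
  have h := lexp_smul_Ad I (a : G) (w : GroupLieAlgebra I G) s
  rw [hw a a.2] at h
  change lexp I (s • (w : GroupLieAlgebra I G)) * (a : G) = a * lexp I (s • (w : GroupLieAlgebra I G))
  nth_rewrite 1 [h]
  group

lemma exists_subExp_ne_one {w : lieAlg I Q} (hw : w ≠ 0) : ∃ s : ℝ, subExp I hQ (s • w) ≠ 1 := by
  by_contra! h
  refine hw (Subtype.ext (lexp_smul_injective I fun s => ?_))
  have := congrArg Subtype.val (h s)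
  change lexp I (s • (w : GroupLieAlgebra I G)) = 1 at this
  rw [this, Submodule.coe_zero, smul_zero, lexp_zero]

/-- A vector of the Lie algebra of a compact group on which the derivatives of all the characters
vanish is orthogonal to the fixed vectors. -/
lemma apply_eq_zero_of_charDerivs {B : LinearMap.BilinForm ℝ (GroupLieAlgebra I G)}
    (hBQ : AdInvariant I Q B) (hQc : IsCompact (Q : Set G)) {u : GroupLieAlgebra I G}
    (hu : ∀ a ∈ Q, Ad I a u = u) {x : lieAlg I Q} (hx : ∀ d ∈ charDerivs I hQ, d x = 0) :
    B u x = 0 := by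
  haveI : IsTopologicalGroup G := topologicalGroup_of_lieGroup I ∞
  haveI : CompactSpace Q := isCompact_iff_compactSpace.1 hQc
  -- Averaging makes `x` fixed without changing its pairing with the fixed `u` or the values of the
  -- `Ad`-invariant character derivatives. If `w ≠ 0`, then `exp (ℝ w)` is a nontrivial central
  -- one-parameter subgroup on which all characters are trivial.
  obtain ⟨w, hwfix, -, hw⟩ := exists_fixed_average I hQc (x : GroupLieAlgebra I G)
  have hwQ : w ∈ lieAlg I Q := by
    by_contra hn
    obtain ⟨ℓ, hℓ, hle⟩ := Submodule.exists_le_ker_of_notMem hn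
    exact hℓ (hw ℓ 0 fun a ha => hle (Ad_mem_lieAlg I hQ ha x.2))
  have hBw : B u w = B u x := hw (B u) _ fun a ha => by
    have h := hBQ a ha u x
    rwa [hu a ha] at h
  have hd : ∀ d ∈ charDerivs I hQ, d ⟨w, hwQ⟩ = 0 := by
    rintro d ⟨χ, hχ, rfl⟩
    obtain ⟨ℓ, hℓ⟩ := (charDeriv I hQ hχ).exists_extend
    have hℓ' : ∀ X : lieAlg I Q, ℓ X = charDeriv I hQ hχ X := fun X => congrArg (· X) hℓ
    rw [← hℓ']
    refine hw ℓ 0 fun a ha => ?_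
    have := charDeriv_Ad hQ hχ ha x
    rw [← hℓ', hx _ ⟨χ, hχ, rfl⟩] at this
    exact this
  by_contra hne
  have hw0 : (⟨w, hwQ⟩ : lieAlg I Q) ≠ 0 := by
    intro h
    have h' : w = 0 := congrArg Subtype.val h
    rw [h', map_zero] at hBw
    exact hne hBw.symm
  obtain ⟨χ, hχ, s, hs⟩ := exists_character_ne_one
    (fun s : ℝ => subExp I hQ (s • (⟨w, hwQ⟩ : lieAlg I Q))) (subExp_add_smul I hQ _)
    (subExp_central hQ hwfix) (exists_subExp_ne_one hQ hw0)
  refine hs ?_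
  rw [apply_subExp I hQ hχ, map_smul, hd _ ⟨χ, hχ, rfl⟩, smul_zero, Circle.exp_zero]

/-- By finite-dimensional duality, a functional vanishing on the common kernel of the character
derivatives belongs to their span. -/
lemma mem_span_charDerivs {B : LinearMap.BilinForm ℝ (GroupLieAlgebra I G)}
    (hBQ : AdInvariant I Q B) (hQc : IsCompact (Q : Set G)) {u : GroupLieAlgebra I G}
    (hu : ∀ a ∈ Q, Ad I a u = u) :
    B u ∘ₗ (lieAlg I Q).subtype ∈ Submodule.span ℝ (charDerivs I hQ) := by
  rw [← Subspace.dualCoannihilator_dualAnnihilator_eq (W := Submodule.span ℝ (charDerivs I hQ)),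
    Submodule.mem_dualAnnihilator]
  intro x hx
  rw [Submodule.mem_dualCoannihilator] at hx
  exact apply_eq_zero_of_charDerivs hQ hBQ hQc hu fun d hd => hx d (Submodule.subset_span hd)

/-- On a connected closed subgroup, finitely many characters are exponentials simultaneously. -/
lemma exists_apply_eq_circleExp {ι : Type*} (χ : ι → Q →* Circle) (hχ : ∀ i, Continuous (χ i))
    {H : Subgroup G} (hH : IsClosed (H : Set G)) (hHc : IsConnected (H : Set G)) (hle : H ≤ Q)
    {h : G} (hh : h ∈ H) : ∃ y : lieAlg I Q, (y : GroupLieAlgebra I G) ∈ lieAlg I H ∧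
      ∀ i, χ i ⟨h, hle hh⟩ = Circle.exp (charDeriv I hQ (hχ i) y) := by
  -- The elements with the required logarithms form a subgroup because the circle is commutative; it
  -- contains the exponentials of `𝔥`, which generate `H`.
  let K : Subgroup G :=
    { carrier := {g | ∃ hg : g ∈ Q, ∃ y : lieAlg I Q, (y : GroupLieAlgebra I G) ∈ lieAlg I H ∧
        ∀ i, χ i ⟨g, hg⟩ = Circle.exp (charDeriv I hQ (hχ i) y)}
      one_mem' := ⟨Q.one_mem, 0, Submodule.zero_mem _, fun i => by
        rw [map_zero, Circle.exp_zero]; exact map_one (χ i)⟩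
      mul_mem' := by
        rintro a b ⟨ha, y, hy, hay⟩ ⟨hb, z, hz, hbz⟩
        refine ⟨Q.mul_mem ha hb, y + z, Submodule.add_mem _ hy hz, fun i => ?_⟩
        rw [map_add, Circle.exp_add, ← hay, ← hbz]
        exact map_mul (χ i) ⟨a, ha⟩ ⟨b, hb⟩
      inv_mem' := by
        rintro a ⟨ha, y, hy, hay⟩
        refine ⟨Q.inv_mem ha, -y, Submodule.neg_mem _ hy, fun i => ?_⟩
        rw [map_neg, Circle.exp_neg, ← hay]
        exact map_inv (χ i) ⟨a, ha⟩ }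
  have hK : H ≤ K := le_of_forall_lexp_mem I hH hHc fun X hX =>
    ⟨hle (lexp_mem I hH hX), ⟨X, lieAlg_mono I hle hX⟩, hX, fun i =>
      apply_subExp I hQ (hχ i) ⟨X, lieAlg_mono I hle hX⟩⟩
  obtain ⟨_, h2⟩ := hK hh
  exact h2

/-- A nonzero fixed vector orthogonal to a connected closed subgroup is detected by a character
which is trivial on the subgroup. -/
lemma exists_character_of_orthogonal {B : LinearMap.BilinForm ℝ (GroupLieAlgebra I G)}
    (hB : IsInnerForm B) (hBQ : AdInvariant I Q B) (hQc : IsCompact (Q : Set G))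
    {H : Subgroup G} (hH : IsClosed (H : Set G)) (hHc : IsConnected (H : Set G)) (hle : H ≤ Q)
    {u : lieAlg I Q} (hu : ∀ a ∈ Q, Ad I a (u : GroupLieAlgebra I G) = u) (hu0 : u ≠ 0)
    (horth : ∀ y ∈ lieAlg I H, B u y = 0) :
    ∃ χ : Q →* Circle, Continuous χ ∧ (∀ h (hh : h ∈ H), χ ⟨h, hle hh⟩ = 1) ∧
      ∃ s : ℝ, χ (subExp I hQ (s • u)) ≠ 1 := by
  haveI : IsTopologicalGroup G := topologicalGroup_of_lieGroup I ∞
  haveI : CompactSpace Q := isCompact_iff_compactSpace.1 hQc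
  obtain ⟨n, c, g, hg⟩ := Submodule.mem_span_set'.1 (mem_span_charDerivs hQ hBQ hQc hu)
  choose χ hχ hgχ using fun i => (g i).2
  have hf : ∀ X : lieAlg I Q, ∑ i, c i * charDeriv I hQ (hχ i) X = B u X := by
    intro X
    have h1 := congrArg (fun f : lieAlg I Q →ₗ[ℝ] ℝ => f X) hg
    simp only [hgχ, LinearMap.sum_apply, LinearMap.smul_apply, smul_eq_mul] at h1
    exact h1
  let Φ : Q →* (Fin n → Circle) := MonoidHom.pi χ
  have hΦ : Continuous Φ := continuous_pi hχ
  -- `N = Φ⁻¹(Φ(H))` is closed by compactness, and normal because the torus is commutative, so `Q/N`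
  -- is a compact Hausdorff group. If `exp (ℝ u)` is not inside `N`, its image is a nontrivial
  -- central one-parameter subgroup of `Q/N`, and a character detecting it is trivial on `H`.
  let N : Subgroup Q := ((H.subgroupOf Q).map Φ).comap Φ
  haveI : N.Normal := inferInstance
  have hNcl : IsClosed (N : Set Q) := by
    have h1 : IsClosed ((H.subgroupOf Q : Subgroup Q) : Set Q) := hH.preimage continuous_subtype_val
    exact (h1.isCompact.image hΦ).isClosed.preimage hΦ
  by_cases hex : ∃ s : ℝ, subExp I hQ (s • u) ∉ N
  · obtain ⟨s, hs⟩ := hex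
    haveI : IsClosed (N : Set Q) := hNcl
    obtain ⟨χ', hχ', t, ht⟩ := exists_character_ne_one
      (fun s : ℝ => (QuotientGroup.mk' N) (subExp I hQ (s • u)))
      (fun s t => by rw [subExp_add_smul, map_mul])
      (fun s a => by
        obtain ⟨a, rfl⟩ := QuotientGroup.mk'_surjective N a
        rw [← map_mul, ← map_mul, subExp_central hQ hu])
      ⟨s, fun h => hs ((QuotientGroup.eq_one_iff _).1 h)⟩
    refine ⟨χ'.comp (QuotientGroup.mk' N), hχ'.comp QuotientGroup.continuous_mk, fun h hh => ?_,
      t, ht⟩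
    have h1 : (QuotientGroup.mk' N) ⟨h, hle hh⟩ = 1 :=
      (QuotientGroup.eq_one_iff _).2 ⟨⟨h, hle hh⟩, hh, rfl⟩
    rw [MonoidHom.comp_apply, h1, map_one]
  · exfalso
    push Not at hex
    have h1 : ∀ s : ℝ, ∃ (y : lieAlg I Q) (m : Fin n → ℤ), (y : GroupLieAlgebra I G) ∈ lieAlg I H ∧
        ∀ i, charDeriv I hQ (hχ i) (s • u) = charDeriv I hQ (hχ i) y + m i * (2 * Real.pi) := by
      intro s
      obtain ⟨h, hh, hΦh⟩ := hex s
      obtain ⟨y, hy, hexp⟩ := exists_apply_eq_circleExp (I := I) hQ χ hχ hH hHc hle hh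
      have h2 : ∀ i, ∃ m : ℤ, charDeriv I hQ (hχ i) (s • u) =
          charDeriv I hQ (hχ i) y + m * (2 * Real.pi) := by
        intro i
        rw [← Circle.exp_eq_exp, ← apply_subExp I hQ, ← hexp]
        exact (congrFun hΦh i).symm
      choose m hm using h2
      exact ⟨y, m, hy, hm⟩
    choose y m hy hm using h1
    -- If `exp (ℝ u) ⊆ N`, then for each `s` the vector `s u` agrees with some `y s ∈ 𝔥` under all
    -- `dχᵢ` up to `2π m(s)`, `m(s) ∈ ℤⁿ`. By uncountability of `ℝ` two parameters share the same
    -- `m`, and subtraction gives `B(u, (s - t) u) = B(u, y s - y t) = 0`.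
    have hinj : ¬ Function.Injective m := fun h =>
      not_countable (α := ℝ) h.countable
    obtain ⟨s, t, hst, hne⟩ : ∃ s t, m s = m t ∧ s ≠ t := by
      simpa [Function.Injective] using hinj
    have h2 : ∀ i, charDeriv I hQ (hχ i) ((s - t) • u) = charDeriv I hQ (hχ i) (y s - y t) := by
      intro i
      rw [sub_smul, map_sub, map_sub, hm s, hm t, hst]
      ring
    have h3 : B u ((s - t) • u : lieAlg I Q) = B u (y s - y t : lieAlg I Q) := by
      rw [← hf, ← hf]
      exact Finset.sum_congr rfl fun i _ => by rw [h2]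
    rw [Submodule.coe_sub, horth _ (Submodule.sub_mem _ (hy s) (hy t))] at h3
    have h4 : (s - t) * B u u = 0 := by
      rw [← h3, Submodule.coe_smul, map_smul, smul_eq_mul]
    have h5 := hB.pos u fun h => hu0 (Subtype.ext h)
    rcases mul_eq_zero.1 h4 with h | h
    · exact hne (sub_eq_zero.1 h)
    · exact h5.ne' h

/-- A compact connected group with a fixed vector orthogonal to a connected closed subgroup has a
subgroup of codimension one containing that subgroup and not the vector. -/
theorem exists_codim_one_subgroup {B : LinearMap.BilinForm ℝ (GroupLieAlgebra I G)}
    (hB : IsInnerForm B) (hBQ : AdInvariant I Q B) (hQc : IsCompact (Q : Set G))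
    {H : Subgroup G} (hH : IsClosed (H : Set G)) (hHc : IsConnected (H : Set G)) (hle : H ≤ Q)
    {u : GroupLieAlgebra I G} (huQ : u ∈ lieAlg I Q) (hu : ∀ a ∈ Q, Ad I a u = u) (hu0 : u ≠ 0)
    (horth : ∀ y ∈ lieAlg I H, B u y = 0) :
    ∃ H' : Subgroup G, IsConnectedCompact H' ∧ H ≤ H' ∧ H' ≤ Q ∧ u ∉ lieAlg I H' ∧
      ∃ d : GroupLieAlgebra I G →ₗ[ℝ] ℝ, ∀ X ∈ lieAlg I Q, d X = 0 → X ∈ lieAlg I H' := by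
  haveI : IsTopologicalGroup G := topologicalGroup_of_lieGroup I ∞
  have hQ : IsClosed (Q : Set G) := hQc.isClosed
  haveI : CompactSpace Q := isCompact_iff_compactSpace.1 hQc
  obtain ⟨χ, hχ, hχH, s, hs⟩ := exists_character_of_orthogonal hQ hB hBQ hQc hH hHc hle
    (u := ⟨u, huQ⟩) hu (fun h => hu0 (congrArg Subtype.val h)) horth
  set L : Subgroup G := χ.ker.map Q.subtype with hL
  have hLc : IsCompact (L : Set G) := by
    have h1 : IsClosed (χ.ker : Set Q) := isClosed_singleton.preimage hχ
    exact h1.isCompact.image continuous_subtype_val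
  have hLQ : L ≤ Q := by
    rintro _ ⟨x, -, rfl⟩
    exact x.2
  -- The codimension bound: vectors of `𝔮` on which the derivative of `χ` vanishes exponentiate into
  -- its kernel.
  obtain ⟨d, hd⟩ := (charDeriv I hQ hχ).exists_extend
  refine ⟨idComp L, isConnectedCompact_idComp hLc, le_idComp hHc fun h hh =>
    ⟨⟨h, hle hh⟩, hχH h hh, rfl⟩, (idComp_le L).trans hLQ, ?_, d, fun X hX hdX => ?_⟩
  · rw [lieAlg_idComp I hLc, mem_lieAlg_iff I hLc.isClosed]
    intro h
    obtain ⟨x, hx, hxu⟩ := h s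
    have : x = subExp I hQ (s • ⟨u, huQ⟩) := Subtype.ext hxu
    rw [this] at hx
    exact hs hx
  · rw [lieAlg_idComp I hLc, mem_lieAlg_iff I hLc.isClosed]
    intro t
    refine ⟨subExp I hQ (t • ⟨X, hX⟩), ?_, rfl⟩
    have h1 : d X = charDeriv I hQ hχ ⟨X, hX⟩ := congrArg (· ⟨X, hX⟩) hd
    rw [SetLike.mem_coe, MonoidHom.mem_ker, apply_subExp I hQ hχ, map_smul, ← h1, hdX, smul_zero,
      Circle.exp_zero]

end CharacterSeparation

/-! ### Product subgroups -/

section ProductSubgroups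
variable {G₁ G₂ : Type*} [TopologicalSpace G₁] [Group G₁] [TopologicalSpace G₂] [Group G₂]

lemma IsConnectedCompact.prod {H₁ : Subgroup G₁} {H₂ : Subgroup G₂} (h1 : IsConnectedCompact H₁)
    (h2 : IsConnectedCompact H₂) : IsConnectedCompact (H₁.prod H₂) := by
  unfold IsConnectedCompact
  rw [Subgroup.coe_prod]
  exact ⟨h1.1.prod h2.1, h1.2.prod h2.2⟩

lemma IsConnectedCompact.map {H : Subgroup G₁} (h : IsConnectedCompact H) {f : G₁ →* G₂}
    (hf : Continuous f) : IsConnectedCompact (H.map f) := by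
  unfold IsConnectedCompact
  rw [Subgroup.coe_map]
  exact ⟨h.1.image hf, h.2.image f hf.continuousOn⟩

lemma map_fst_prod (H₁ : Subgroup G₁) (H₂ : Subgroup G₂) :
    (H₁.prod H₂).map (MonoidHom.fst G₁ G₂) = H₁ := by
  ext x
  constructor
  · rintro ⟨y, hy, rfl⟩; exact hy.1
  · intro hx; exact ⟨(x, 1), ⟨hx, H₂.one_mem⟩, rfl⟩

lemma map_snd_prod (H₁ : Subgroup G₁) (H₂ : Subgroup G₂) :
    (H₁.prod H₂).map (MonoidHom.snd G₁ G₂) = H₂ := by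
  ext x
  constructor
  · rintro ⟨y, hy, rfl⟩; exact hy.2
  · intro hx; exact ⟨(1, x), ⟨H₁.one_mem, hx⟩, rfl⟩

lemma le_prod_map (H : Subgroup (G₁ × G₂)) :
    H ≤ (H.map (MonoidHom.fst G₁ G₂)).prod (H.map (MonoidHom.snd G₁ G₂)) :=
  fun x hx => ⟨⟨x, hx, rfl⟩, ⟨x, hx, rfl⟩⟩

end ProductSubgroups

/-! ### The product case, and forms on product groups -/

section Product
variable {E₁ : Type*} [NormedAddCommGroup E₁] [NormedSpace ℝ E₁] [FiniteDimensional ℝ E₁]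
  [CompleteSpace E₁]
  {E₂ : Type*} [NormedAddCommGroup E₂] [NormedSpace ℝ E₂] [FiniteDimensional ℝ E₂]
  [CompleteSpace E₂]
  {HM₁ : Type*} [TopologicalSpace HM₁] (I₁ : ModelWithCorners ℝ E₁ HM₁) [I₁.Boundaryless]
  {HM₂ : Type*} [TopologicalSpace HM₂] (I₂ : ModelWithCorners ℝ E₂ HM₂) [I₂.Boundaryless]
  {G₁ : Type*} [TopologicalSpace G₁] [ChartedSpace HM₁ G₁] [Group G₁] [LieGroup I₁ ∞ G₁]
  [T2Space G₁]
  {G₂ : Type*} [TopologicalSpace G₂] [ChartedSpace HM₂ G₂] [Group G₂] [LieGroup I₂ ∞ G₂]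
  [T2Space G₂]

lemma Ad_prod_eq_self_iff {a : G₁ × G₂} {t : GroupLieAlgebra (I₁.prod I₂) (G₁ × G₂)} :
    Ad (I₁.prod I₂) a t = t ↔ Ad I₁ a.1 (proj₁ I₁ I₂ G₁ G₂ t) = proj₁ I₁ I₂ G₁ G₂ t ∧
      Ad I₂ a.2 (proj₂ I₁ I₂ G₁ G₂ t) = proj₂ I₁ I₂ G₁ G₂ t := by
  rw [← proj₁_Ad, ← proj₂_Ad]
  exact ⟨fun h => by rw [h]; exact ⟨rfl, rfl⟩, fun h => ext_proj I₁ I₂ h.1 h.2⟩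

lemma isAdmissible_prod_left {H₁ : Subgroup G₁} {H₂ : Subgroup G₂} (h1 : IsConnectedCompact H₁)
    (h2 : IsConnectedCompact H₂) {t : GroupLieAlgebra I₁ G₁} (ht : t ∉ lieAlg I₁ H₁)
    (hfix : ∀ a ∈ H₁, Ad I₁ a t = t) : IsAdmissible (I₁.prod I₂) (H₁.prod H₂) := by
  refine isAdmissible_of_fixed _ (h1.prod h2) (t := incl₁ I₁ I₂ G₁ G₂ t) (fun h => ht ?_)
    fun a ha => by rw [Ad_incl₁, hfix _ ha.1]
  have := ((mem_lieAlg_prod I₁ I₂ h1.1.isClosed h2.1.isClosed).1 h).1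
  rwa [proj₁_incl₁] at this

lemma isAdmissible_prod_right {H₁ : Subgroup G₁} {H₂ : Subgroup G₂} (h1 : IsConnectedCompact H₁)
    (h2 : IsConnectedCompact H₂) {t : GroupLieAlgebra I₂ G₂} (ht : t ∉ lieAlg I₂ H₂)
    (hfix : ∀ a ∈ H₂, Ad I₂ a t = t) : IsAdmissible (I₁.prod I₂) (H₁.prod H₂) := by
  refine isAdmissible_of_fixed _ (h1.prod h2) (t := incl₂ I₁ I₂ G₁ G₂ t) (fun h => ht ?_)
    fun a ha => by rw [Ad_incl₂, hfix _ ha.2]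
  have := ((mem_lieAlg_prod I₁ I₂ h1.1.isClosed h2.1.isClosed).1 h).2
  rwa [proj₂_incl₂] at this

lemma prod_injective {H₁ H₁' : Subgroup G₁} {H₂ H₂' : Subgroup G₂}
    (h : H₁.prod H₂ = H₁'.prod H₂') : H₁ = H₁' ∧ H₂ = H₂' := by
  constructor
  · rw [← map_fst_prod H₁ H₂, h, map_fst_prod]
  · rw [← map_snd_prod H₁ H₂, h, map_snd_prod]

/-- The maximal admissible subgroups which are products. -/
theorem maximalAdmissible_prod {H₁ : Subgroup G₁} {H₂ : Subgroup G₂}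
    (hH : IsMaximalAdmissible (I₁.prod I₂) (H₁.prod H₂)) :
    (IsMaximalAdmissible I₁ H₁ ∧ IsMaximalCompact H₂) ∨
      (IsMaximalCompact H₁ ∧ IsMaximalAdmissible I₂ H₂) := by
  obtain ⟨hadm, hmax⟩ := hH
  have h1 : IsConnectedCompact H₁ := by
    have := hadm.1.map (f := MonoidHom.fst G₁ G₂) continuous_fst
    rwa [map_fst_prod] at this
  have h2 : IsConnectedCompact H₂ := by
    have := hadm.1.map (f := MonoidHom.snd G₁ G₂) continuous_snd
    rwa [map_snd_prod] at this
  obtain ⟨t, ht, hfix⟩ := exists_fixed_of_isAdmissible _ hadm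
  rw [mem_lieAlg_prod I₁ I₂ h1.1.isClosed h2.1.isClosed, not_and_or] at ht
  -- The component of `t` outside its factor is fixed by that factor alone. It therefore remains a
  -- witness when the other factor is enlarged, and the other factor can be retained when this one
  -- is enlarged within admissible groups.
  rcases ht with ht | ht
  · left
    have hf : ∀ a ∈ H₁, Ad I₁ a (proj₁ I₁ I₂ G₁ G₂ t) = proj₁ I₁ I₂ G₁ G₂ t := fun a ha =>
      ((Ad_prod_eq_self_iff I₁ I₂).1 (hfix (a, 1) ⟨ha, H₂.one_mem⟩)).1
    refine ⟨⟨isAdmissible_of_fixed I₁ h1 ht hf, fun H' hH' hle => ?_⟩, h2, fun K hK hle => ?_⟩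
    · obtain ⟨t', ht', hf'⟩ := exists_fixed_of_isAdmissible _ hH'
      exact (prod_injective (hmax _ (isAdmissible_prod_left I₁ I₂ hH'.1 h2 ht' hf')
        (Subgroup.prod_mono hle le_rfl))).1
    · exact (prod_injective (hmax _ (isAdmissible_prod_left I₁ I₂ h1 hK ht hf)
        (Subgroup.prod_mono le_rfl hle))).2
  · right
    have hf : ∀ a ∈ H₂, Ad I₂ a (proj₂ I₁ I₂ G₁ G₂ t) = proj₂ I₁ I₂ G₁ G₂ t := fun a ha =>
      ((Ad_prod_eq_self_iff I₁ I₂).1 (hfix (1, a) ⟨H₁.one_mem, ha⟩)).2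
    refine ⟨⟨h1, fun K hK hle => ?_⟩, isAdmissible_of_fixed I₂ h2 ht hf, fun H' hH' hle => ?_⟩
    · exact (prod_injective (hmax _ (isAdmissible_prod_right I₁ I₂ hK h2 ht hf)
        (Subgroup.prod_mono hle le_rfl))).1
    · obtain ⟨t', ht', hf'⟩ := exists_fixed_of_isAdmissible _ hH'
      exact (prod_injective (hmax _ (isAdmissible_prod_right I₁ I₂ h1 hH'.1 ht' hf')
        (Subgroup.prod_mono le_rfl hle))).2

/-- The orthogonal sum of two forms. -/
def prodForm (B₁ : LinearMap.BilinForm ℝ (GroupLieAlgebra I₁ G₁))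
    (B₂ : LinearMap.BilinForm ℝ (GroupLieAlgebra I₂ G₂)) :
    LinearMap.BilinForm ℝ (GroupLieAlgebra (I₁.prod I₂) (G₁ × G₂)) :=
  B₁.compl₁₂ (proj₁ I₁ I₂ G₁ G₂).toLinearMap (proj₁ I₁ I₂ G₁ G₂).toLinearMap +
    B₂.compl₁₂ (proj₂ I₁ I₂ G₁ G₂).toLinearMap (proj₂ I₁ I₂ G₁ G₂).toLinearMap

variable {B₁ : LinearMap.BilinForm ℝ (GroupLieAlgebra I₁ G₁)}
    {B₂ : LinearMap.BilinForm ℝ (GroupLieAlgebra I₂ G₂)}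

lemma prodForm_apply (x y : GroupLieAlgebra (I₁.prod I₂) (G₁ × G₂)) :
    prodForm I₁ I₂ B₁ B₂ x y = B₁ (proj₁ I₁ I₂ G₁ G₂ x) (proj₁ I₁ I₂ G₁ G₂ y) +
      B₂ (proj₂ I₁ I₂ G₁ G₂ x) (proj₂ I₁ I₂ G₁ G₂ y) := rfl

lemma isInnerForm_prodForm (h1 : IsInnerForm B₁) (h2 : IsInnerForm B₂) :
    IsInnerForm (prodForm I₁ I₂ B₁ B₂) := by
  refine ⟨fun x y => ?_, fun x hx => ?_⟩
  · rw [prodForm_apply, prodForm_apply, h1.symm, h2.symm]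
  · rw [prodForm_apply]
    by_cases hx1 : proj₁ I₁ I₂ G₁ G₂ x = 0
    · have hx2 : proj₂ I₁ I₂ G₁ G₂ x ≠ 0 := fun h => hx (ext_proj I₁ I₂ (by rw [hx1, map_zero])
        (by rw [h, map_zero]))
      rw [hx1, map_zero, zero_add]
      exact h2.pos _ hx2
    · refine add_pos_of_pos_of_nonneg (h1.pos _ hx1) ?_
      by_cases hx2 : proj₂ I₁ I₂ G₁ G₂ x = 0
      · rw [hx2, map_zero]
      · exact (h2.pos _ hx2).le

lemma adInvariant_prodForm {K₁ : Subgroup G₁} {K₂ : Subgroup G₂} (h1 : AdInvariant I₁ K₁ B₁)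
    (h2 : AdInvariant I₂ K₂ B₂) : AdInvariant (I₁.prod I₂) (K₁.prod K₂) (prodForm I₁ I₂ B₁ B₂) := by
  intro a ha x y
  rw [prodForm_apply, prodForm_apply, proj₁_Ad, proj₁_Ad, proj₂_Ad, proj₂_Ad, h1 _ ha.1,
    h2 _ ha.2]

/-- A connected compact subgroup is a product as soon as its Lie algebra is. -/
lemma eq_prod_of_incl₁_proj₁_mem {H : Subgroup (G₁ × G₂)} (hH : IsConnectedCompact H)
    (h : ∀ X ∈ lieAlg (I₁.prod I₂) H,
      incl₁ I₁ I₂ G₁ G₂ (proj₁ I₁ I₂ G₁ G₂ X) ∈ lieAlg (I₁.prod I₂) H) :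
    ∃ (H₁ : Subgroup G₁) (H₂ : Subgroup G₂), H = H₁.prod H₂ := by
  haveI : IsTopologicalGroup G₁ := topologicalGroup_of_lieGroup I₁ ∞
  haveI : IsTopologicalGroup G₂ := topologicalGroup_of_lieGroup I₂ ∞
  have hcl := hH.1.isClosed
  set L₁ : Subgroup G₁ := H.comap (MonoidHom.inl G₁ G₂) with hL₁
  set L₂ : Subgroup G₂ := H.comap (MonoidHom.inr G₁ G₂) with hL₂
  have hc1 : IsCompact (L₁ : Set G₁) := by
    have h1 : IsClosed (L₁ : Set G₁) := hcl.preimage (continuous_id.prodMk continuous_const)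
    refine (hH.1.image continuous_fst).of_isClosed_subset h1 fun x hx => ⟨(x, 1), hx, rfl⟩
  have hc2 : IsCompact (L₂ : Set G₂) := by
    have h1 : IsClosed (L₂ : Set G₂) := hcl.preimage (continuous_const.prodMk continuous_id)
    refine (hH.1.image continuous_snd).of_isClosed_subset h1 fun x hx => ⟨(1, x), hx, rfl⟩
  have h1 := isConnectedCompact_idComp hc1
  have h2 := isConnectedCompact_idComp hc2
  refine ⟨idComp L₁, idComp L₂, le_antisymm ?_ ?_⟩
  · refine le_of_lieAlg_le (I₁.prod I₂) hcl hH.2 (h1.prod h2).1.isClosed fun X hX => ?_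
    have hX1 := h X hX
    have hX2 : incl₂ I₁ I₂ G₁ G₂ (proj₂ I₁ I₂ G₁ G₂ X) ∈ lieAlg (I₁.prod I₂) H := by
      have := Submodule.sub_mem _ hX hX1
      rwa [← incl_add_incl I₁ I₂ X, map_add, proj₁_incl₁, proj₁_incl₂, add_zero,
        add_sub_cancel_left] at this
    rw [mem_lieAlg_prod I₁ I₂ h1.1.isClosed h2.1.isClosed, lieAlg_idComp I₁ hc1,
      lieAlg_idComp I₂ hc2, mem_lieAlg_iff I₁ hc1.isClosed, mem_lieAlg_iff I₂ hc2.isClosed]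
    exact ⟨(incl₁_mem_lieAlg_iff I₁ I₂ hcl).1 hX1, (incl₂_mem_lieAlg_iff I₁ I₂ hcl).1 hX2⟩
  · rintro ⟨x, y⟩ ⟨hx, hy⟩
    have hx' : ((x, 1) : G₁ × G₂) ∈ H := idComp_le L₁ hx
    have hy' : ((1, y) : G₁ × G₂) ∈ H := idComp_le L₂ hy
    simpa using H.mul_mem hx' hy'

end Product

/-! ### Centralizers and orthogonal fixed vectors -/

section Single
variable {E : Type*} [NormedAddCommGroup E] [NormedSpace ℝ E] [FiniteDimensional ℝ E]
  [CompleteSpace E]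
  {HM : Type*} [TopologicalSpace HM] (I : ModelWithCorners ℝ E HM) [I.Boundaryless]
  {G : Type*} [TopologicalSpace G] [ChartedSpace HM G] [Group G] [LieGroup I ∞ G] [T2Space G]

lemma mem_centralizerIn {W : Submodule ℝ (GroupLieAlgebra I G)} {t X : GroupLieAlgebra I G} :
    X ∈ centralizerIn I W t ↔ X ∈ W ∧ ⁅t, X⁆ = 0 := Iff.rfl

lemma centralizerIn_smul (W : Submodule ℝ (GroupLieAlgebra I G)) (t : GroupLieAlgebra I G) {c : ℝ}
    (hc : c ≠ 0) : centralizerIn I W (c • t) = centralizerIn I W t := by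
  ext X
  rw [mem_centralizerIn, mem_centralizerIn, smul_lie, smul_eq_zero, or_iff_right hc]

lemma lieAlg_inf_adFix {K : Subgroup G} (hK : IsClosed (K : Set G)) (t : GroupLieAlgebra I G) :
    lieAlg I (K ⊓ adFix I t) = centralizerIn I (lieAlg I K) t :=
  Submodule.ext fun _ => (mem_centralizerIn_iff I hK).symm

lemma Ad_mem_centralizerIn {K : Subgroup G} (hK : IsClosed (K : Set G)) {t : GroupLieAlgebra I G}
    {a : G} (ha : a ∈ K) (hat : Ad I a t = t) {X : GroupLieAlgebra I G}
    (hX : X ∈ centralizerIn I (lieAlg I K) t) : Ad I a X ∈ centralizerIn I (lieAlg I K) t := by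
  rw [mem_centralizerIn_iff I hK] at hX ⊢
  exact Ad_mem_lieAlg I (H := K ⊓ adFix I t) (hK.inter (isClosed_adFix I t)) ⟨ha, hat⟩ hX

/-- The component of an invariant vector orthogonal to the Lie algebra of a compact subgroup. -/
lemma exists_fixed_orthogonal {H : Subgroup G} (hH : IsClosed (H : Set G))
    {B : LinearMap.BilinForm ℝ (GroupLieAlgebra I G)} (hB : IsInnerForm B)
    (hinv : AdInvariant I H B) {t : GroupLieAlgebra I G} (ht : t ∉ lieAlg I H)
    (hfix : ∀ a ∈ H, Ad I a t = t) :
    ∃ u ∈ B.orthogonal (lieAlg I H), u ≠ 0 ∧ ∀ a ∈ H, Ad I a u = u := by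
  obtain ⟨y, hy, hu⟩ := hB.exists_decomp (lieAlg I H) t
  refine ⟨t - y, hu, fun h => ht (by rwa [sub_eq_zero.1 h]), fun a ha => ?_⟩
  have h1 : Ad I a (t - y) ∈ B.orthogonal (lieAlg I H) :=
    hinv.Ad_mem_orthogonal hB (fun a ha y hy => Ad_mem_lieAlg I hH ha hy) ha hu
  -- The left side is orthogonal to `𝔥` and the right side lies in `𝔥`, so both vanish.
  have h2 : Ad I a (t - y) - (t - y) = y - Ad I a y := by
    rw [map_sub, hfix a ha]; abel
  refine sub_eq_zero.1 ((Submodule.disjoint_def.1 (hB.isCompl_orthogonal (lieAlg I H)).disjoint) _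
    ?_ (Submodule.sub_mem _ h1 hu))
  rw [h2]
  exact Submodule.sub_mem _ hy (Ad_mem_lieAlg I hH ha hy)

end Single

/-! ### The Lie algebra of a non-product maximal admissible subgroup -/

section Product
variable {E₁ : Type*} [NormedAddCommGroup E₁] [NormedSpace ℝ E₁] [FiniteDimensional ℝ E₁]
  [CompleteSpace E₁]
  {E₂ : Type*} [NormedAddCommGroup E₂] [NormedSpace ℝ E₂] [FiniteDimensional ℝ E₂]
  [CompleteSpace E₂]
  {HM₁ : Type*} [TopologicalSpace HM₁] (I₁ : ModelWithCorners ℝ E₁ HM₁) [I₁.Boundaryless]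
  {HM₂ : Type*} [TopologicalSpace HM₂] (I₂ : ModelWithCorners ℝ E₂ HM₂) [I₂.Boundaryless]
  {G₁ : Type*} [TopologicalSpace G₁] [ChartedSpace HM₁ G₁] [Group G₁] [LieGroup I₁ ∞ G₁]
  [T2Space G₁]
  {G₂ : Type*} [TopologicalSpace G₂] [ChartedSpace HM₂ G₂] [Group G₂] [LieGroup I₂ ∞ G₂]
  [T2Space G₂]

/-- The description of the Lie algebra of `H` by centralizers in compact subgroups and one linear
equation. -/
structure IsHyperplaneData (H : Subgroup (G₁ × G₂)) (K₁ : Subgroup G₁) (K₂ : Subgroup G₂)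
    (B₁ : LinearMap.BilinForm ℝ (GroupLieAlgebra I₁ G₁))
    (B₂ : LinearMap.BilinForm ℝ (GroupLieAlgebra I₂ G₂))
    (u₁ : GroupLieAlgebra I₁ G₁) (u₂ : GroupLieAlgebra I₂ G₂) : Prop where
  inner₁ : IsInnerForm B₁
  inner₂ : IsInnerForm B₂
  inv₁ : AdInvariant I₁ K₁ B₁
  inv₂ : AdInvariant I₂ K₂ B₂
  fst_mem : ∀ a ∈ H, a.1 ∈ K₁
  snd_mem : ∀ a ∈ H, a.2 ∈ K₂
  fix₁ : ∀ a ∈ H, Ad I₁ a.1 u₁ = u₁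
  fix₂ : ∀ a ∈ H, Ad I₂ a.2 u₂ = u₂
  mem₁ : u₁ ∈ centralizerIn I₁ (lieAlg I₁ K₁) u₁
  mem₂ : u₂ ∈ centralizerIn I₂ (lieAlg I₂ K₂) u₂
  mem_iff : ∀ X, X ∈ lieAlg (I₁.prod I₂) H ↔
    (proj₁ I₁ I₂ G₁ G₂ X ∈ centralizerIn I₁ (lieAlg I₁ K₁) u₁ ∧
      proj₂ I₁ I₂ G₁ G₂ X ∈ centralizerIn I₂ (lieAlg I₂ K₂) u₂) ∧
      B₁ u₁ (proj₁ I₁ I₂ G₁ G₂ X) + B₂ u₂ (proj₂ I₁ I₂ G₁ G₂ X) = 0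

/-- Maximality is used twice: against `P₁ × P₂`, to force `u` into the Lie algebra of the
projections, and against the codimension-one subgroup `H'` of `Q`, to identify it with `H`. -/
theorem exists_isHyperplaneData {H : Subgroup (G₁ × G₂)}
    (hH : IsMaximalAdmissible (I₁.prod I₂) H)
    (hnp : ¬ ∃ (H₁ : Subgroup G₁) (H₂ : Subgroup G₂), H = H₁.prod H₂) :
    ∃ K₁ K₂ B₁ B₂ u₁ u₂, IsMaximalCompact K₁ ∧ IsMaximalCompact K₂ ∧
      IsHyperplaneData I₁ I₂ H K₁ K₂ B₁ B₂ u₁ u₂ := by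
  haveI : IsTopologicalGroup G₁ := topologicalGroup_of_lieGroup I₁ ∞
  haveI : IsTopologicalGroup G₂ := topologicalGroup_of_lieGroup I₂ ∞
  obtain ⟨hadm, hmax⟩ := hH
  have hcl := hadm.1.1.isClosed
  set P₁ := H.map (MonoidHom.fst G₁ G₂) with hP₁
  set P₂ := H.map (MonoidHom.snd G₁ G₂) with hP₂
  have hc1 : IsConnectedCompact P₁ := hadm.1.map continuous_fst
  have hc2 : IsConnectedCompact P₂ := hadm.1.map continuous_snd
  have hHP : H ≤ P₁.prod P₂ := le_prod_map H
  obtain ⟨K₁, hK₁, hPK₁⟩ := exists_isMaximalCompact I₁ hc1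
  obtain ⟨K₂, hK₂, hPK₂⟩ := exists_isMaximalCompact I₂ hc2
  obtain ⟨B₁, hB₁, hinv₁⟩ := exists_adInvariant I₁ hK₁.1.1
  obtain ⟨B₂, hB₂, hinv₂⟩ := exists_adInvariant I₂ hK₂.1.1
  have hB := isInnerForm_prodForm I₁ I₂ hB₁ hB₂
  have hinv := adInvariant_prodForm I₁ I₂ hinv₁ hinv₂
  have hHK : H ≤ K₁.prod K₂ := hHP.trans (Subgroup.prod_mono hPK₁ hPK₂)
  obtain ⟨t, ht, hfix⟩ := exists_fixed_of_isAdmissible _ hadm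
  obtain ⟨u, horth, hu0, hufix⟩ := exists_fixed_orthogonal (I₁.prod I₂) hcl hB (hinv.mono hHK)
    ht hfix
  rw [hB.mem_orthogonal] at horth
  set u₁ := proj₁ I₁ I₂ G₁ G₂ u with hu₁
  set u₂ := proj₂ I₁ I₂ G₁ G₂ u with hu₂
  have hf₁ : ∀ a ∈ P₁, Ad I₁ a u₁ = u₁ := by
    rintro _ ⟨a, ha, rfl⟩
    exact ((Ad_prod_eq_self_iff I₁ I₂).1 (hufix a ha)).1
  have hf₂ : ∀ a ∈ P₂, Ad I₂ a u₂ = u₂ := by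
    rintro _ ⟨a, ha, rfl⟩
    exact ((Ad_prod_eq_self_iff I₁ I₂).1 (hufix a ha)).2
  -- If not, `u` shows that `P₁ × P₂` is admissible; as it contains `H`, it equals `H`, contrary to
  -- `hnp`.
  have huP : u ∈ lieAlg (I₁.prod I₂) (P₁.prod P₂) := by
    by_contra hn
    refine hnp ⟨P₁, P₂, (hmax _ (isAdmissible_of_fixed _ (hc1.prod hc2) hn fun a ha => ?_) hHP).symm⟩
    exact (Ad_prod_eq_self_iff I₁ I₂).2 ⟨hf₁ _ ha.1, hf₂ _ ha.2⟩
  rw [mem_lieAlg_prod I₁ I₂ hc1.1.isClosed hc2.1.isClosed] at huP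
  have hz₁ : u₁ ∈ centralizerIn I₁ (lieAlg I₁ K₁) u₁ :=
    (mem_centralizerIn I₁).2 ⟨lieAlg_mono I₁ hPK₁ huP.1, lie_self _⟩
  have hz₂ : u₂ ∈ centralizerIn I₂ (lieAlg I₂ K₂) u₂ :=
    (mem_centralizerIn I₂).2 ⟨lieAlg_mono I₂ hPK₂ huP.2, lie_self _⟩
  have hL₁ : IsCompact ((K₁ ⊓ adFix I₁ u₁ : Subgroup G₁) : Set G₁) :=
    hK₁.1.1.inter_right (isClosed_adFix I₁ u₁)
  have hL₂ : IsCompact ((K₂ ⊓ adFix I₂ u₂ : Subgroup G₂) : Set G₂) :=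
    hK₂.1.1.inter_right (isClosed_adFix I₂ u₂)
  -- The product of the connected stabilizers of `u₁`, `u₂` in `K₁`, `K₂`: its Lie algebra is the
  -- sum of the two centralizers.
  set Q := (idComp (K₁ ⊓ adFix I₁ u₁)).prod (idComp (K₂ ⊓ adFix I₂ u₂)) with hQ
  have hQc₁ := isConnectedCompact_idComp hL₁
  have hQc₂ := isConnectedCompact_idComp hL₂
  have hQc : IsConnectedCompact Q := hQc₁.prod hQc₂
  have hHQ : H ≤ Q := hHP.trans (Subgroup.prod_mono
    (le_idComp hc1.2 (le_inf hPK₁ hf₁)) (le_idComp hc2.2 (le_inf hPK₂ hf₂)))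
  have hQK : Q ≤ K₁.prod K₂ := Subgroup.prod_mono ((idComp_le _).trans inf_le_left)
    ((idComp_le _).trans inf_le_left)
  have hQfix : ∀ a ∈ Q, Ad (I₁.prod I₂) a u = u := fun a ha =>
    (Ad_prod_eq_self_iff I₁ I₂).2 ⟨(idComp_le _ ha.1).2, (idComp_le _ ha.2).2⟩
  have hmemQ : ∀ X, X ∈ lieAlg (I₁.prod I₂) Q ↔
      proj₁ I₁ I₂ G₁ G₂ X ∈ centralizerIn I₁ (lieAlg I₁ K₁) u₁ ∧
      proj₂ I₁ I₂ G₁ G₂ X ∈ centralizerIn I₂ (lieAlg I₂ K₂) u₂ := fun X => by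
    rw [mem_lieAlg_prod I₁ I₂ hQc₁.1.isClosed hQc₂.1.isClosed, lieAlg_idComp I₁ hL₁,
      lieAlg_idComp I₂ hL₂, lieAlg_inf_adFix I₁ hK₁.1.1.isClosed,
      lieAlg_inf_adFix I₂ hK₂.1.1.isClosed]
  have huQ : u ∈ lieAlg (I₁.prod I₂) Q := (hmemQ u).2 ⟨hz₁, hz₂⟩
  obtain ⟨H', hH'c, hHH', hH'Q, huH', d, hd⟩ := exists_codim_one_subgroup hB (hinv.mono hQK) hQc.1
    hcl hadm.1.2 hHQ huQ hQfix hu0 horth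
  have hH' : H' = H := hmax _ (isAdmissible_of_fixed _ hH'c huH' fun a ha => hQfix a (hH'Q ha)) hHH'
  rw [hH'] at huH' hd
  have hdu : d u ≠ 0 := fun h => huH' (hd u huQ h)
  refine ⟨K₁, K₂, B₁, B₂, u₁, u₂, hK₁, hK₂, hB₁, hB₂, hinv₁, hinv₂, fun a ha => (hHK ha).1,
    fun a ha => (hHK ha).2, fun a ha => hf₁ _ (hHP ha).1, fun a ha => hf₂ _ (hHP ha).2, hz₁, hz₂,
    fun X => ?_⟩
  rw [← hmemQ]
  refine ⟨fun hX => ⟨lieAlg_mono _ hHQ hX, horth X hX⟩, fun ⟨hXQ, hX⟩ => ?_⟩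
  have hX' : prodForm I₁ I₂ B₁ B₂ u X = 0 := hX
  -- Subtracting a multiple of `u` puts `X` into the kernel of `d`, hence into `𝔥`. Since `X` and
  -- `𝔥` are both orthogonal to `u`, that multiple is zero.
  have h1 : X - (d X / d u) • u ∈ lieAlg (I₁.prod I₂) H := by
    refine hd _ (Submodule.sub_mem _ hXQ (Submodule.smul_mem _ _ huQ)) ?_
    rw [map_sub, map_smul, smul_eq_mul, div_mul_cancel₀ _ hdu, sub_self]
  have h2 := horth _ h1
  rw [map_sub, hX', map_smul, smul_eq_mul, zero_sub, neg_eq_zero] at h2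
  rcases mul_eq_zero.1 h2 with h | h
  · rwa [h, zero_smul, sub_zero] at h1
  · exact absurd h (hB.pos u hu0).ne'

variable {I₁ I₂}
namespace IsHyperplaneData
variable {H : Subgroup (G₁ × G₂)} {K₁ : Subgroup G₁} {K₂ : Subgroup G₂}
    {B₁ : LinearMap.BilinForm ℝ (GroupLieAlgebra I₁ G₁)}
    {B₂ : LinearMap.BilinForm ℝ (GroupLieAlgebra I₂ G₂)}
    {u₁ : GroupLieAlgebra I₁ G₁} {u₂ : GroupLieAlgebra I₂ G₂}
    (D : IsHyperplaneData I₁ I₂ H K₁ K₂ B₁ B₂ u₁ u₂)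
include D

lemma incl₁_mem_iff (X : GroupLieAlgebra I₁ G₁) : incl₁ I₁ I₂ G₁ G₂ X ∈ lieAlg (I₁.prod I₂) H ↔
    X ∈ centralizerIn I₁ (lieAlg I₁ K₁) u₁ ∧ B₁ u₁ X = 0 := by
  rw [D.mem_iff, proj₁_incl₁, proj₂_incl₁, map_zero, add_zero,
    and_iff_left (Submodule.zero_mem _)]

lemma incl₂_mem_iff (X : GroupLieAlgebra I₂ G₂) : incl₂ I₁ I₂ G₁ G₂ X ∈ lieAlg (I₁.prod I₂) H ↔
    X ∈ centralizerIn I₂ (lieAlg I₂ K₂) u₂ ∧ B₂ u₂ X = 0 := by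
  rw [D.mem_iff, proj₁_incl₂, proj₂_incl₂, map_zero, zero_add,
    and_iff_right (Submodule.zero_mem _)]

/-- If `u₁ = 0`, the defining equation constrains only the second component, so `𝔥`, and with it the
connected group `H`, splits as a product. -/
lemma fst_ne_zero (hH : IsConnectedCompact H)
    (hnp : ¬ ∃ (H₁ : Subgroup G₁) (H₂ : Subgroup G₂), H = H₁.prod H₂) : u₁ ≠ 0 := by
  intro h
  refine hnp (eq_prod_of_incl₁_proj₁_mem I₁ I₂ hH fun X hX => (D.incl₁_mem_iff _).2 ?_)
  refine ⟨((D.mem_iff X).1 hX).1.1, ?_⟩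
  rw [h, map_zero]; rfl

lemma snd_ne_zero (hH : IsConnectedCompact H)
    (hnp : ¬ ∃ (H₁ : Subgroup G₁) (H₂ : Subgroup G₂), H = H₁.prod H₂) : u₂ ≠ 0 := by
  intro h
  refine hnp (eq_prod_of_incl₁_proj₁_mem I₁ I₂ hH fun X hX => (D.incl₁_mem_iff _).2 ?_)
  have h1 := (D.mem_iff X).1 hX
  refine ⟨h1.1.1, ?_⟩
  have h2 := h1.2
  rw [h, map_zero] at h2
  exact (add_zero _).symm.trans h2

end IsHyperplaneData
end Product

/-! ### Linear algebra of the decomposition -/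

section Product
variable {E₁ : Type*} [NormedAddCommGroup E₁] [NormedSpace ℝ E₁] [FiniteDimensional ℝ E₁]
  [CompleteSpace E₁]
  {E₂ : Type*} [NormedAddCommGroup E₂] [NormedSpace ℝ E₂] [FiniteDimensional ℝ E₂]
  [CompleteSpace E₂]
  {HM₁ : Type*} [TopologicalSpace HM₁] {I₁ : ModelWithCorners ℝ E₁ HM₁} [I₁.Boundaryless]
  {HM₂ : Type*} [TopologicalSpace HM₂] {I₂ : ModelWithCorners ℝ E₂ HM₂} [I₂.Boundaryless]
  {G₁ : Type*} [TopologicalSpace G₁] [ChartedSpace HM₁ G₁] [Group G₁] [LieGroup I₁ ∞ G₁]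
  [T2Space G₁]
  {G₂ : Type*} [TopologicalSpace G₂] [ChartedSpace HM₂ G₂] [Group G₂] [LieGroup I₂ ∞ G₂]
  [T2Space G₂]

/-- A hyperplane of a subspace and a vector off it span the subspace. -/
lemma hyperplane_sup_span {V : Type*} [AddCommGroup V] [Module ℝ V] {W W' : Submodule ℝ V}
    (ℓ : V →ₗ[ℝ] ℝ) (hW' : ∀ x, x ∈ W' ↔ x ∈ W ∧ ℓ x = 0) {t : V} (ht : t ∈ W) (hℓ : ℓ t ≠ 0) :
    W' ⊔ Submodule.span ℝ {t} = W := by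
  refine le_antisymm (sup_le (fun x hx => ((hW' x).1 hx).1)
    ((Submodule.span_singleton_le_iff_mem _ _).2 ht)) fun x hx => ?_
  rw [Submodule.mem_sup]
  refine ⟨x - (ℓ x / ℓ t) • t, (hW' _).2 ⟨W.sub_mem hx (W.smul_mem _ ht), ?_⟩, (ℓ x / ℓ t) • t,
    Submodule.smul_mem _ _ (Submodule.mem_span_singleton_self t), sub_add_cancel _ _⟩
  rw [map_sub, map_smul, smul_eq_mul, div_mul_cancel₀ _ hℓ, sub_self]

namespace IsHyperplaneData
variable {H : Subgroup (G₁ × G₂)} {K₁ : Subgroup G₁} {K₂ : Subgroup G₂}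
    {B₁ : LinearMap.BilinForm ℝ (GroupLieAlgebra I₁ G₁)}
    {B₂ : LinearMap.BilinForm ℝ (GroupLieAlgebra I₂ G₂)}
    {u₁ : GroupLieAlgebra I₁ G₁} {u₂ : GroupLieAlgebra I₂ G₂}
    (D : IsHyperplaneData I₁ I₂ H K₁ K₂ B₁ B₂ u₁ u₂)
    {t₁ : GroupLieAlgebra I₁ G₁} {t₂ : GroupLieAlgebra I₂ G₂}

include D

lemma incl_add_incl_mem_iff (x : GroupLieAlgebra I₁ G₁) (y : GroupLieAlgebra I₂ G₂) :
    (incl₁ I₁ I₂ G₁ G₂).toLinearMap x + (incl₂ I₁ I₂ G₁ G₂).toLinearMap y ∈ (lieAlg (I₁.prod I₂) H) ↔ (x ∈ (centralizerIn I₁ (lieAlg I₁ K₁) u₁) ∧ y ∈ (centralizerIn I₂ (lieAlg I₂ K₂) u₂)) ∧ B₁ u₁ x + B₂ u₂ y = 0 := by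
  have h1 : proj₁ I₁ I₂ G₁ G₂ ((incl₁ I₁ I₂ G₁ G₂).toLinearMap x + (incl₂ I₁ I₂ G₁ G₂).toLinearMap y) = x := by
    rw [map_add]
    exact (congrArg₂ (· + ·) (proj₁_incl₁ I₁ I₂ G₁ G₂ x) (proj₁_incl₂ I₁ I₂ G₁ G₂ y)).trans
      (add_zero x)
  have h2 : proj₂ I₁ I₂ G₁ G₂ ((incl₁ I₁ I₂ G₁ G₂).toLinearMap x + (incl₂ I₁ I₂ G₁ G₂).toLinearMap y) = y := by
    rw [map_add]
    exact (congrArg₂ (· + ·) (proj₂_incl₁ I₁ I₂ G₁ G₂ x) (proj₂_incl₂ I₁ I₂ G₁ G₂ y)).trans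
      (zero_add y)
  rw [D.mem_iff, h1, h2]

lemma lieAlg_eq_sup (ht₁ : t₁ ∈ (centralizerIn I₁ (lieAlg I₁ K₁) u₁)) (ht₂ : t₂ ∈ (centralizerIn I₂ (lieAlg I₂ K₂) u₂)) (h₁ : B₁ u₁ t₁ = 1) (h₂ : B₂ u₂ t₂ = -1) :
    (lieAlg (I₁.prod I₂) H) = ((lieAlg (I₁.prod I₂) H).comap (incl₁ I₁ I₂ G₁ G₂).toLinearMap).map (incl₁ I₁ I₂ G₁ G₂).toLinearMap ⊔ ((lieAlg (I₁.prod I₂) H).comap (incl₂ I₁ I₂ G₁ G₂).toLinearMap).map (incl₂ I₁ I₂ G₁ G₂).toLinearMap ⊔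
      Submodule.span ℝ {incl₁ I₁ I₂ G₁ G₂ t₁ + incl₂ I₁ I₂ G₁ G₂ t₂} := by
  refine le_antisymm (fun X hX => ?_) (sup_le (sup_le (Submodule.map_comap_le _ _)
    (Submodule.map_comap_le _ _)) ((Submodule.span_singleton_le_iff_mem _ _).2 ?_))
  · obtain ⟨⟨hx, hy⟩, h0⟩ := (D.mem_iff X).1 hX
    set x := proj₁ I₁ I₂ G₁ G₂ X with hx'
    set y := proj₂ I₁ I₂ G₁ G₂ X with hy'
    -- The coefficient `B₁ u₁ x` makes the first component orthogonal to `u₁`, as `B₁ u₁ t₁ = 1`.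
    -- The same coefficient works for the second, since `B₂ u₂ t₂ = -1` and `B₂ u₂ y = -B₁ u₁ x`.
    have hX' : X = ((incl₁ I₁ I₂ G₁ G₂).toLinearMap (x - B₁ u₁ x • t₁) + (incl₂ I₁ I₂ G₁ G₂).toLinearMap (y - B₁ u₁ x • t₂)) +
        B₁ u₁ x • (incl₁ I₁ I₂ G₁ G₂ t₁ + incl₂ I₁ I₂ G₁ G₂ t₂) := by
      have h1 : X = (incl₁ I₁ I₂ G₁ G₂).toLinearMap x + (incl₂ I₁ I₂ G₁ G₂).toLinearMap y := (incl_add_incl I₁ I₂ X).symm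
      have h2 : incl₁ I₁ I₂ G₁ G₂ t₁ + incl₂ I₁ I₂ G₁ G₂ t₂ = (incl₁ I₁ I₂ G₁ G₂).toLinearMap t₁ + (incl₂ I₁ I₂ G₁ G₂).toLinearMap t₂ := rfl
      rw [h2, map_sub, map_sub, map_smul, map_smul, smul_add]
      nth_rewrite 1 [h1]
      abel
    rw [hX']
    refine Submodule.add_mem_sup (Submodule.add_mem_sup (Submodule.mem_map_of_mem
      ((D.incl₁_mem_iff _).2 ⟨Submodule.sub_mem _ hx (Submodule.smul_mem _ _ ht₁), ?_⟩))
      (Submodule.mem_map_of_mem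
      ((D.incl₂_mem_iff _).2 ⟨Submodule.sub_mem _ hy (Submodule.smul_mem _ _ ht₂), ?_⟩)))
      (Submodule.smul_mem _ _ (Submodule.mem_span_singleton_self _))
    · rw [map_sub, map_smul, h₁, smul_eq_mul, mul_one, sub_self]
    · rw [map_sub, map_smul, h₂, smul_eq_mul, mul_neg, mul_one, sub_neg_eq_add, add_comm, h0]
  · exact (D.incl_add_incl_mem_iff t₁ t₂).2 ⟨⟨ht₁, ht₂⟩, by rw [h₁, h₂]; norm_num⟩

/-- The orthogonal complement serves: first components of `H` lie in `K₁` and fix `u₁`, so they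
preserve both `B₁` and the centralizer. -/
lemma exists_complement₁ (hH : IsClosed (H : Set (G₁ × G₂))) (hK : IsClosed (K₁ : Set G₁)) :
    ∃ 𝔪, IsAdInvariantComplement (incl₁ I₁ I₂ G₁ G₂).toLinearMap (lieAlg (I₁.prod I₂) H) (centralizerIn I₁ (lieAlg I₁ K₁) u₁) 𝔪 := by
  refine ⟨B₁.orthogonal (centralizerIn I₁ (lieAlg I₁ K₁) u₁), D.inner₁.isCompl_orthogonal _, fun X hX Y hY => ?_⟩
  refine bracket_mem_of_Ad_mem (I₁.prod I₂) hH (fun a ha => Submodule.mem_map.2 ⟨Ad I₁ a.1 Y, ?_,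
    (Ad_incl₁ I₁ I₂ a Y).symm⟩) hX
  refine (D.inv₁.mono (inf_le_left : K₁ ⊓ adFix I₁ u₁ ≤ K₁)).Ad_mem_orthogonal D.inner₁
    (fun b hb y hy => Ad_mem_centralizerIn I₁ hK hb.1 hb.2 hy) ⟨D.fst_mem a ha, D.fix₁ a ha⟩ hY

lemma exists_complement₂ (hH : IsClosed (H : Set (G₁ × G₂))) (hK : IsClosed (K₂ : Set G₂)) :
    ∃ 𝔪, IsAdInvariantComplement (incl₂ I₁ I₂ G₁ G₂).toLinearMap (lieAlg (I₁.prod I₂) H) (centralizerIn I₂ (lieAlg I₂ K₂) u₂) 𝔪 := by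
  refine ⟨B₂.orthogonal (centralizerIn I₂ (lieAlg I₂ K₂) u₂), D.inner₂.isCompl_orthogonal _, fun X hX Y hY => ?_⟩
  refine bracket_mem_of_Ad_mem (I₁.prod I₂) hH (fun a ha => Submodule.mem_map.2 ⟨Ad I₂ a.2 Y, ?_,
    (Ad_incl₂ I₁ I₂ a Y).symm⟩) hX
  refine (D.inv₂.mono (inf_le_left : K₂ ⊓ adFix I₂ u₂ ≤ K₂)).Ad_mem_orthogonal D.inner₂
    (fun b hb y hy => Ad_mem_centralizerIn I₂ hK hb.1 hb.2 hy) ⟨D.snd_mem a ha, D.fix₂ a ha⟩ hY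

/-- Modulo `𝔪₁ + 𝔪₂` one works in the sum of the centralizers, where `𝔥` is the kernel of a
functional taking the value `2` on `t₁ - t₂`. Invariance holds since the `𝔪ᵢ` are `ad`-invariant
under the connected `H` and `t₁`, `t₂` are fixed. -/
lemma isReductiveDecomposition (hH : IsConnectedCompact H) (ht₁ : t₁ ∈ (centralizerIn I₁ (lieAlg I₁ K₁) u₁)) (ht₂ : t₂ ∈ (centralizerIn I₂ (lieAlg I₂ K₂) u₂))
    (h₁ : B₁ u₁ t₁ = 1) (h₂ : B₂ u₂ t₂ = -1) (hf₁ : ∀ a ∈ H, Ad I₁ a.1 t₁ = t₁)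
    (hf₂ : ∀ a ∈ H, Ad I₂ a.2 t₂ = t₂) {𝔪₁ : Submodule ℝ (GroupLieAlgebra I₁ G₁)}
    {𝔪₂ : Submodule ℝ (GroupLieAlgebra I₂ G₂)} (hm₁ : IsAdInvariantComplement (incl₁ I₁ I₂ G₁ G₂).toLinearMap (lieAlg (I₁.prod I₂) H) (centralizerIn I₁ (lieAlg I₁ K₁) u₁) 𝔪₁)
    (hm₂ : IsAdInvariantComplement (incl₂ I₁ I₂ G₁ G₂).toLinearMap (lieAlg (I₁.prod I₂) H) (centralizerIn I₂ (lieAlg I₂ K₂) u₂) 𝔪₂) :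
    IsReductiveDecomposition (I₁.prod I₂) H (𝔪₁.map (incl₁ I₁ I₂ G₁ G₂).toLinearMap ⊔ 𝔪₂.map (incl₂ I₁ I₂ G₁ G₂).toLinearMap ⊔
      Submodule.span ℝ {incl₁ I₁ I₂ G₁ G₂ t₁ - incl₂ I₁ I₂ G₁ G₂ t₂}) := by
  have hcl := hH.1.isClosed
  have hsplit : ∀ (c : ℝ) (x : GroupLieAlgebra I₁ G₁) (y : GroupLieAlgebra I₂ G₂),
      (incl₁ I₁ I₂ G₁ G₂).toLinearMap x + (incl₂ I₁ I₂ G₁ G₂).toLinearMap y + c • (incl₁ I₁ I₂ G₁ G₂ t₁ - incl₂ I₁ I₂ G₁ G₂ t₂) =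
        (incl₁ I₁ I₂ G₁ G₂).toLinearMap (x + c • t₁) + (incl₂ I₁ I₂ G₁ G₂).toLinearMap (y - c • t₂) := by
    intro c x y
    have h2 : incl₁ I₁ I₂ G₁ G₂ t₁ - incl₂ I₁ I₂ G₁ G₂ t₂ = (incl₁ I₁ I₂ G₁ G₂).toLinearMap t₁ - (incl₂ I₁ I₂ G₁ G₂).toLinearMap t₂ := rfl
    rw [h2, map_add, map_sub, map_smul, map_smul, smul_sub]
    abel
  refine ⟨IsCompl.of_le ?_ ?_, fun a ha Y hY => ?_⟩
  · rintro X ⟨hX, hX'⟩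
    obtain ⟨Z, hZ, W, hW, rfl⟩ := Submodule.mem_sup.1 hX'
    obtain ⟨_, ⟨x, hx, rfl⟩, _, ⟨y, hy, rfl⟩, rfl⟩ := Submodule.mem_sup.1 hZ
    obtain ⟨c, rfl⟩ := Submodule.mem_span_singleton.1 hW
    rw [SetLike.mem_coe, hsplit, D.incl_add_incl_mem_iff] at hX
    obtain ⟨⟨hx', hy'⟩, h0⟩ := hX
    have hx0 : x = 0 := by
      refine (Submodule.disjoint_def.1 hm₁.1.disjoint) x ?_ hx
      have := Submodule.sub_mem _ hx' (Submodule.smul_mem _ c ht₁)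
      rwa [add_sub_cancel_right] at this
    have hy0 : y = 0 := by
      refine (Submodule.disjoint_def.1 hm₂.1.disjoint) y ?_ hy
      have := Submodule.add_mem _ hy' (Submodule.smul_mem _ c ht₂)
      rwa [sub_add_cancel] at this
    rw [hx0, hy0, zero_add, zero_sub, map_neg, map_smul, map_smul, h₁, h₂, smul_eq_mul,
      smul_eq_mul] at h0
    have hc : c = 0 := by linarith
    rw [hx0, hy0, hc, map_zero, map_zero, zero_smul, add_zero, add_zero]
    exact Submodule.zero_mem _
  · intro X _
    have hx : proj₁ I₁ I₂ G₁ G₂ X ∈ (centralizerIn I₁ (lieAlg I₁ K₁) u₁) ⊔ 𝔪₁ := by rw [hm₁.1.sup_eq_top]; exact Submodule.mem_top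
    have hy : proj₂ I₁ I₂ G₁ G₂ X ∈ (centralizerIn I₂ (lieAlg I₂ K₂) u₂) ⊔ 𝔪₂ := by rw [hm₂.1.sup_eq_top]; exact Submodule.mem_top
    obtain ⟨a, ha, m, hm, hx⟩ := Submodule.mem_sup.1 hx
    obtain ⟨b, hb, n, hn, hy⟩ := Submodule.mem_sup.1 hy
    -- Division by `2`, the value of the defining functional on `t₁ - t₂`.
    set c := (B₁ u₁ a + B₂ u₂ b) / 2 with hc
    have h3 : (incl₁ I₁ I₂ G₁ G₂).toLinearMap (a - c • t₁) + (incl₂ I₁ I₂ G₁ G₂).toLinearMap (b + c • t₂) ∈ (lieAlg (I₁.prod I₂) H) := by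
      refine (D.incl_add_incl_mem_iff _ _).2 ⟨⟨Submodule.sub_mem _ ha (Submodule.smul_mem _ _ ht₁),
        Submodule.add_mem _ hb (Submodule.smul_mem _ _ ht₂)⟩, ?_⟩
      rw [map_sub, map_add, map_smul, map_smul, h₁, h₂, smul_eq_mul, smul_eq_mul, hc]
      ring
    have h4 : X = ((incl₁ I₁ I₂ G₁ G₂).toLinearMap (a - c • t₁) + (incl₂ I₁ I₂ G₁ G₂).toLinearMap (b + c • t₂)) +
        ((incl₁ I₁ I₂ G₁ G₂).toLinearMap m + (incl₂ I₁ I₂ G₁ G₂).toLinearMap n + c • (incl₁ I₁ I₂ G₁ G₂ t₁ - incl₂ I₁ I₂ G₁ G₂ t₂)) := by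
      have h5 : X = (incl₁ I₁ I₂ G₁ G₂).toLinearMap (a + m) + (incl₂ I₁ I₂ G₁ G₂).toLinearMap (b + n) := by
        rw [hx, hy]; exact (incl_add_incl I₁ I₂ X).symm
      rw [hsplit, h5]
      simp only [map_add, map_sub]
      abel
    rw [h4]
    exact Submodule.add_mem_sup h3 (Submodule.add_mem_sup (Submodule.add_mem_sup
      (Submodule.mem_map_of_mem hm) (Submodule.mem_map_of_mem hn))
      (Submodule.smul_mem _ _ (Submodule.mem_span_singleton_self _)))
  · obtain ⟨Z, hZ, W, hW, rfl⟩ := Submodule.mem_sup.1 hY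
    obtain ⟨x, hx, y, hy, rfl⟩ := Submodule.mem_sup.1 hZ
    obtain ⟨c, rfl⟩ := Submodule.mem_span_singleton.1 hW
    rw [map_add, map_add]
    refine Submodule.add_mem_sup (Submodule.add_mem_sup
      (Ad_mem_of_bracket_mem (I₁.prod I₂) hcl hH.2 (fun X hX _ hZ => ?_) ha hx)
      (Ad_mem_of_bracket_mem (I₁.prod I₂) hcl hH.2 (fun X hX _ hZ => ?_) ha hy))
      (Submodule.mem_span_singleton.2 ⟨c, ?_⟩)
    · obtain ⟨Y, hY, rfl⟩ := hZ
      exact hm₁.2 X hX Y hY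
    · obtain ⟨Y, hY, rfl⟩ := hZ
      exact hm₂.2 X hX Y hY
    · rw [map_smul, map_sub, Ad_incl₁, Ad_incl₂, hf₁ a ha, hf₂ a ha]

end IsHyperplaneData
end Product

end HomLorentz

end

/-! ### The main theorem -/

theorem mainTheorem3
    {E₁ : Type*} [NormedAddCommGroup E₁] [NormedSpace ℝ E₁] [FiniteDimensional ℝ E₁]
    {E₂ : Type*} [NormedAddCommGroup E₂] [NormedSpace ℝ E₂] [FiniteDimensional ℝ E₂]
    [CompleteSpace E₁] [CompleteSpace E₂]
    {HM₁ : Type*} [TopologicalSpace HM₁] (I₁ : ModelWithCorners ℝ E₁ HM₁) [I₁.Boundaryless]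
    {HM₂ : Type*} [TopologicalSpace HM₂] (I₂ : ModelWithCorners ℝ E₂ HM₂) [I₂.Boundaryless]
    {G₁ : Type*} [TopologicalSpace G₁] [ChartedSpace HM₁ G₁] [Group G₁] [LieGroup I₁ ∞ G₁]
    [T2Space G₁] [ConnectedSpace G₁]
    {G₂ : Type*} [TopologicalSpace G₂] [ChartedSpace HM₂ G₂] [Group G₂] [LieGroup I₂ ∞ G₂]
    [T2Space G₂] [ConnectedSpace G₂]
    (H : Subgroup (G₁ × G₂)) (hH : IsMaximalAdmissible (I₁.prod I₂) H) :
    -- the case of a subgroup which is consistent with the decomposition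
    (∀ (H₁ : Subgroup G₁) (H₂ : Subgroup G₂), H = H₁.prod H₂ →
      (IsMaximalAdmissible I₁ H₁ ∧ IsMaximalCompact H₂) ∨
      (IsMaximalCompact H₁ ∧ IsMaximalAdmissible I₂ H₂)) ∧
    -- the case of a subgroup which is not consistent with the decomposition
    ((¬ ∃ (H₁ : Subgroup G₁) (H₂ : Subgroup G₂), H = H₁.prod H₂) →
      ∃ (K₁ : Subgroup G₁) (K₂ : Subgroup G₂)
        (t₁ : GroupLieAlgebra I₁ G₁) (t₂ : GroupLieAlgebra I₂ G₂)
        (𝔥₁ : Submodule ℝ (GroupLieAlgebra I₁ G₁)) (𝔥₂ : Submodule ℝ (GroupLieAlgebra I₂ G₂)),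
        IsMaximalCompact K₁ ∧ IsMaximalCompact K₂ ∧
        -- `𝔥ᵢ = 𝔥 ∩ 𝔤ᵢ`
        𝔥₁ = (lieAlg (I₁.prod I₂) H).comap (incl₁ I₁ I₂ G₁ G₂).toLinearMap ∧
        𝔥₂ = (lieAlg (I₁.prod I₂) H).comap (incl₂ I₁ I₂ G₁ G₂).toLinearMap ∧
        -- all the sums are direct
        t₁ ∉ 𝔥₁ ∧ t₂ ∉ 𝔥₂ ∧
        -- `𝔥 = 𝔥₁ + 𝔥₂ + ℝ (t₁ + t₂)`
        lieAlg (I₁.prod I₂) H =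
          𝔥₁.map (incl₁ I₁ I₂ G₁ G₂).toLinearMap ⊔ 𝔥₂.map (incl₂ I₁ I₂ G₁ G₂).toLinearMap ⊔
            Submodule.span ℝ {incl₁ I₁ I₂ G₁ G₂ t₁ + incl₂ I₁ I₂ G₁ G₂ t₂} ∧
        -- `𝔥ᵢ + ℝ tᵢ` is the centralizer of `tᵢ` in `𝔨ᵢ`
        𝔥₁ ⊔ Submodule.span ℝ {t₁} = centralizerIn I₁ (lieAlg I₁ K₁) t₁ ∧
        𝔥₂ ⊔ Submodule.span ℝ {t₂} = centralizerIn I₂ (lieAlg I₂ K₂) t₂ ∧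
        -- the reductive decomposition `𝔤 = 𝔥 + (𝔪₁ + 𝔪₂ + ℝ (t₁ - t₂))`
        (∃ 𝔪₁, IsAdInvariantComplement (incl₁ I₁ I₂ G₁ G₂).toLinearMap
          (lieAlg (I₁.prod I₂) H) (centralizerIn I₁ (lieAlg I₁ K₁) t₁) 𝔪₁) ∧
        (∃ 𝔪₂, IsAdInvariantComplement (incl₂ I₁ I₂ G₁ G₂).toLinearMap
          (lieAlg (I₁.prod I₂) H) (centralizerIn I₂ (lieAlg I₂ K₂) t₂) 𝔪₂) ∧
        ∀ 𝔪₁ 𝔪₂,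
          IsAdInvariantComplement (incl₁ I₁ I₂ G₁ G₂).toLinearMap
            (lieAlg (I₁.prod I₂) H) (centralizerIn I₁ (lieAlg I₁ K₁) t₁) 𝔪₁ →
          IsAdInvariantComplement (incl₂ I₁ I₂ G₁ G₂).toLinearMap
            (lieAlg (I₁.prod I₂) H) (centralizerIn I₂ (lieAlg I₂ K₂) t₂) 𝔪₂ →
          IsReductiveDecomposition (I₁.prod I₂) H
            (𝔪₁.map (incl₁ I₁ I₂ G₁ G₂).toLinearMap ⊔ 𝔪₂.map (incl₂ I₁ I₂ G₁ G₂).toLinearMap ⊔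
              Submodule.span ℝ {incl₁ I₁ I₂ G₁ G₂ t₁ - incl₂ I₁ I₂ G₁ G₂ t₂})) := by
  refine ⟨fun H₁ H₂ h => maximalAdmissible_prod I₁ I₂ (h ▸ hH), fun hnp => ?_⟩
  have hHc := hH.1.1
  obtain ⟨K₁, K₂, B₁, B₂, u₁, u₂, hK₁, hK₂, D⟩ := exists_isHyperplaneData I₁ I₂ hH hnp
  have hu₁ := (D.inner₁.pos u₁ (D.fst_ne_zero hHc hnp)).ne'
  have hu₂ := (D.inner₂.pos u₂ (D.snd_ne_zero hHc hnp)).ne'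
  -- The scalings normalize the functionals to `1` on `t₁` and `-1` on `t₂`, so that `t₁ + t₂` lies
  -- in `𝔥` and neither `tᵢ` does; nonzero multiples have the same centralizers.
  set c₁ := (B₁ u₁ u₁)⁻¹ with hc₁
  set c₂ := -(B₂ u₂ u₂)⁻¹ with hc₂
  have h₁ : B₁ u₁ (c₁ • u₁) = 1 := by rw [map_smul, smul_eq_mul, hc₁, inv_mul_cancel₀ hu₁]
  have h₂ : B₂ u₂ (c₂ • u₂) = -1 := by
    rw [map_smul, smul_eq_mul, hc₂, neg_mul, inv_mul_cancel₀ hu₂]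
  have ht₁ := Submodule.smul_mem _ c₁ D.mem₁
  have ht₂ := Submodule.smul_mem _ c₂ D.mem₂
  have hz₁ := centralizerIn_smul I₁ (lieAlg I₁ K₁) u₁ (inv_ne_zero hu₁ : c₁ ≠ 0)
  have hz₂ := centralizerIn_smul I₂ (lieAlg I₂ K₂) u₂ (neg_ne_zero.2 (inv_ne_zero hu₂) : c₂ ≠ 0)
  refine ⟨K₁, K₂, c₁ • u₁, c₂ • u₂, _, _, hK₁, hK₂, rfl, rfl, fun h => ?_, fun h => ?_,
    D.lieAlg_eq_sup ht₁ ht₂ h₁ h₂, ?_, ?_, ?_, ?_, ?_⟩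
  · exact one_ne_zero (h₁.symm.trans ((D.incl₁_mem_iff _).1 h).2)
  · exact neg_ne_zero.2 one_ne_zero (h₂.symm.trans ((D.incl₂_mem_iff _).1 h).2)
  · rw [hz₁]
    exact hyperplane_sup_span (B₁ u₁) D.incl₁_mem_iff ht₁ (by rw [h₁]; exact one_ne_zero)
  · rw [hz₂]
    exact hyperplane_sup_span (B₂ u₂) D.incl₂_mem_iff ht₂
      (by rw [h₂]; exact neg_ne_zero.2 one_ne_zero)
  · rw [hz₁]
    exact D.exists_complement₁ hHc.1.isClosed hK₁.1.1.isClosed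
  · rw [hz₂]
    exact D.exists_complement₂ hHc.1.isClosed hK₂.1.1.isClosed
  · rw [hz₁, hz₂]
    exact fun 𝔪₁ 𝔪₂ hm₁ hm₂ => D.isReductiveDecomposition hHc ht₁ ht₂ h₁ h₂
      (fun a ha => by rw [map_smul, D.fix₁ a ha]) (fun a ha => by rw [map_smul, D.fix₂ a ha])
      hm₁ hm₂
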